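/- **Setting.** Let $d\in\mathbb N$, let $L$ be a real $d\times d$ matrix with $\det L\neq 0$, $\mathcal L=L\mathbb Z^d$, $\mathcal C=L[-\frac12,\frac12]^d$, $L^*=2\pi (L^T)^{-1}$ and $\mathcal B=L^*[-\frac12,\frac12]^d$. Let $W$ be a bounded measurable $\mathcal L$-periodic function on $\mathbb R^d$ with $W\ge 1$, and let $(E_n,v_n)_{n\in\mathbb N}$ be the eigenpairs, with $E_0\le E_1\le\cdots$, of $-\frac12\Delta+W$ on $\mathcal C$ with periodic boundary conditions (in the weak sense, $v_n\in H^1_{\rm per}$), the $v_n$ being extended $\mathcal L$-periodically and forming an orthonormal basis of $L^2(\mathcal C)$. Put $P_{nn'}=\int_{\mathcal C}\overline{v_n}\,\nabla v_{n'}\,dx\in\mathbb C^d$. Let $\mathcal L^2=\ell^2(\mathbb N,L^2(\mathbb R^d))$ and, for $\mu\ge0$, let $\mathcal L^2_\mu$ be the set of $g\in\mathcal L^2$ with $\|g\|_{\mathcal L^2_\mu}^2=\sum_n\int(1+|k|^2)^{\mu}|g_n(k)|^2\,dk<\infty$. Fourier transforms are $\hat f(k)=(2\pi)^{-d/2}\int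 e^{-ik\cdot x}f(x)\,dx$. Let $\mathcal W_\mu$ be the set of real $V\in L^\infty(\mathbb R^d_x\times\mathbb R^d_z)$, $\mathcal L$-periodic in $z$, such that for a.e. $z$ the function $V(\cdot,z)$ has an integrable Fourier transform $\hat V(\cdot,z)$, i.e. $V(x,z)=(2\pi)^{-d/2}\int e^{ik\cdot x}\hat V(k,z)\,dk$ for all $x$ (this fixes the representative, continuous in $x$, that is used in $V(x,x/\epsilon)$), with $\hat V$ measurable in $(k,z)$ and $$\|V\|_{\mathcal W_\mu}=(2\pi)^{-d/2}\operatorname*{ess\,sup}_{z\in\mathcal C}\int(1+|k|)^\mu|\hat V(k,z)|\,dk<\infty .$$ For $\epsilon>0$ define the following operators in $\mathcal L^2$. * $(A^\epsilon_{\rm kp}g)_n(k)=\big(\frac{E_n}{\epsilon^2}+\frac{|k|^2}2\big)g_n(k)-\frac i\epsilon\sum_{n'}k\cdot P_{nn'}\,g_{n'}(k)$, on the domain of all $g\in\mathcal L^2$ such that $\sum_n|E_ng_n(k)|^2<\infty$ for a.e. $k$ and the right-hand side defines an element of $\mathcal L^2$. * $\mathcal U^\epsilon$: given $g$, let $\psi=|\mathcal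 C|^{1/2}\sum_n f_n\,v_n(\cdot/\epsilon)$ in $L^2(\mathbb R^d)$ with $\hat f_n=\mathbf 1_{\mathcal B/\epsilon}g_n$. Then $\mathcal U^\epsilon g=(h_n)_n$, where the $h_n$ are the Fourier transforms of the $\epsilon$-scaled envelope functions of $V(x,x/\epsilon)\psi(x)$: $(h_n)_n\in\mathcal L^2$ is the sequence with $h_n=0$ a.e. outside $\mathcal B/\epsilon$ and $V(\cdot,\cdot/\epsilon)\psi=|\mathcal C|^{1/2}\sum_n \mathcal F^{-1}(h_n)\,v_n(\cdot/\epsilon)$ in $L^2(\mathbb R^d)$. * $(\mathcal U^0g)_n(k)=\sum_{n'}(2\pi)^{-d/2}\int\hat V_{nn'}(k-k')g_{n'}(k')\,dk'$ (series in $L^2(\mathbb R^d)$), where $V_{nn'}(x)=\int_{\mathcal C}\overline{v_n(z)}\,v_{n'}(z)\,V(x,z)\,dz$. A mild solution of $i\partial_tg=(A+U)g$, $g(0)=g^{in}$, is a continuous $g:[0,\infty)\to\mathcal L^2$ such that, for every $t\ge0$, $\int_0^tg(s)\,ds$ lies in the domain of $A+U$ and $g(t)=g^{in}-i(A+U)\int_0^tg(s)\,ds$.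 **Theorem.** Let $\mu\ge0$, $V\in\mathcal W_\mu$ and $\tau\ge0$. There is a constant $C=C(\mu,V,\tau)\ge0$, depending only on $\mu,V,\tau$ and the lattice (in particular not on $\epsilon$ or on the initial datum), such that for every $\epsilon>0$ and every $g^{in}=g^{in,\epsilon}\in\mathcal L^2_\mu$: if $g^\epsilon$ is the mild solution of $i\partial_tg=(A^\epsilon_{\rm kp}+\mathcal U^\epsilon)g$, $g(0)=g^{in}$ (exact dynamics), and $g^\epsilon_{\rm kp}$ is the mild solution of $i\partial_tg=(A^\epsilon_{\rm kp}+\mathcal U^0)g$, $g(0)=g^{in}$ (k$\cdot$p dynamics), then $$\|g^\epsilon(t)-g^\epsilon_{\rm kp}(t)\|_{\mathcal L^2}\le \epsilon^\mu\,C\,\|g^{in}\|_{\mathcal L^2_\mu}\qquad\text{for all }0\le t\le\tau .$$ -/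

import Mathlib

open MeasureTheory Set Filter Topology
open scoped ENNReal ContDiff ComplexConjugate Matrix

noncomputable section

namespace KP

/-- Euclidean space `ℝ^d`. -/
abbrev Sp (d : ℕ) : Type := EuclideanSpace ℝ (Fin d)

variable {d : ℕ}

/-! ### Lattice, cell, Brillouin zone -/

/-- The linear map `t ↦ L t` with values in Euclidean space. -/
def latMap (L : Matrix (Fin d) (Fin d) ℝ) (t : Fin d → ℝ) : Sp d :=
  WithLp.toLp 2 (L *ᵥ t)

/-- Centered fundamental domain `{L t | t ∈ [-1/2, 1/2]^d}` of the lattice `L ℤ^d`. -/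
def cell (L : Matrix (Fin d) (Fin d) ℝ) : Set (Sp d) :=
  latMap L '' {t | ∀ i, t i ∈ Icc (-(1 / 2) : ℝ) (1 / 2)}

/-- Generator of the reciprocal lattice: `Lᵀ L* = 2π I`. -/
def recip (L : Matrix (Fin d) (Fin d) ℝ) : Matrix (Fin d) (Fin d) ℝ :=
  (2 * Real.pi) • (Lᵀ)⁻¹

/-- The Brillouin zone: the centered fundamental domain of the reciprocal lattice. -/
def brillouin (L : Matrix (Fin d) (Fin d) ℝ) : Set (Sp d) := cell (recip L)

/-- The scaled Brillouin zone `𝓑/ε`. -/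
def brillouinScaled (L : Matrix (Fin d) (Fin d) ℝ) (ε : ℝ) : Set (Sp d) :=
  {k | ε • k ∈ brillouin L}

/-- Periodicity with respect to the lattice `L ℤ^d`. -/
def IsPeriodic {α : Type*} (L : Matrix (Fin d) (Fin d) ℝ) (f : Sp d → α) : Prop :=
  ∀ (m : Fin d → ℤ) (x : Sp d), f (x + latMap L (fun i => (m i : ℝ))) = f x

/-! ### Bloch functions at zero wavevector -/

/-- Classical partial derivative (used for test functions only). -/
def partialDeriv (j : Fin d) (φ : Sp d → ℂ) (x : Sp d) : ℂ :=
  fderiv ℝ φ x (EuclideanSpace.single j 1)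

/-- Periodic smooth test functions. -/
def IsPerTest (L : Matrix (Fin d) (Fin d) ℝ) (φ : Sp d → ℂ) : Prop :=
  ContDiff ℝ ∞ φ ∧ IsPeriodic L φ

/-- The crystal potential: measurable, bounded, lattice-periodic, and at least one. -/
structure IsCrystalPotential (L : Matrix (Fin d) (Fin d) ℝ) (W : Sp d → ℝ) : Prop where
  measurable : Measurable W
  periodic : IsPeriodic L W
  one_le : ∀ x, 1 ≤ W x
  bounded : ∃ M, ∀ x, W x ≤ M

/-- `(E n, v n)` is the sequence of eigenpairs of `-½Δ + W` on the cell with periodic boundary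
conditions, listed with multiplicity in nondecreasing order; the `v n` form an orthonormal basis
of `L²(𝓒)` and lie in the periodic Sobolev space `H¹`, with weak gradient
`dv n = (∂₁ v n, …, ∂_d v n)`. The eigenvalue equation is understood weakly. -/
structure IsBlochBasis (L : Matrix (Fin d) (Fin d) ℝ) (W : Sp d → ℝ) (E : ℕ → ℝ)
    (v : ℕ → Sp d → ℂ) (dv : ℕ → Fin d → Sp d → ℂ) : Prop where
  periodic : ∀ n, IsPeriodic L (v n)
  memLp : ∀ n, MemLp (v n) 2 (volume.restrict (cell L))
  orthonormal : ∀ n m, ∫ x in cell L, conj (v n x) * v m x = if n = m then 1 else 0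
  complete : ∀ φ : Sp d → ℂ, MemLp φ 2 (volume.restrict (cell L)) →
    (∀ n, ∫ x in cell L, conj (v n x) * φ x = 0) → φ =ᵐ[volume.restrict (cell L)] 0
  grad_memLp : ∀ n j, MemLp (dv n j) 2 (volume.restrict (cell L))
  weak_grad : ∀ n j φ, IsPerTest L φ →
    ∫ x in cell L, v n x * partialDeriv j φ x = -∫ x in cell L, dv n j x * φ x
  eigen : ∀ n φ, IsPerTest L φ →
    (1 / 2 : ℂ) * ∑ j, (∫ x in cell L, dv n j x * partialDeriv j φ x)
      + ∫ x in cell L, (W x : ℂ) * v n x * φ x = (E n : ℂ) * ∫ x in cell L, v n x * φ x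
  monotone : Monotone E

/-- Matrix elements of the gradient, `P_{nn'} = ∫_𝓒 conj(v_n) ∇v_{n'}` (a vector in `ℂ^d`). -/
def gradElem (L : Matrix (Fin d) (Fin d) ℝ) (v : ℕ → Sp d → ℂ) (dv : ℕ → Fin d → Sp d → ℂ)
    (n n' : ℕ) (j : Fin d) : ℂ :=
  ∫ x in cell L, conj (v n x) * dv n' j x

/-! ### Spaces of sequences -/

/-- The Hilbert space `ℓ²(ℕ, L²(ℝ^d))`. -/
abbrev EnvSpace (d : ℕ) : Type := lp (fun _ : ℕ => Lp ℂ 2 (volume : Measure (Sp d))) 2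

/-- `∑_n ∫ (1+|k|²)^μ |g_n(k)|² dk`, with values in `[0, ∞]`. -/
def weightedSq (μ : ℝ) (g : EnvSpace d) : ℝ≥0∞ :=
  ∑' n, ∫⁻ k : Sp d, ENNReal.ofReal ((1 + ‖k‖ ^ 2) ^ μ) * ‖g n k‖ₑ ^ 2

/-- Membership in the weighted space `𝓛²_μ`. -/
def MemL2mu (μ : ℝ) (g : EnvSpace d) : Prop := weightedSq μ g < ⊤

/-- The norm of `𝓛²_μ` (meaningful for members). -/
def normL2mu (μ : ℝ) (g : EnvSpace d) : ℝ := Real.sqrt (weightedSq μ g).toReal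

/-! ### External potentials -/

/-- The normalization constant `(2π)^{-d/2}` of the Fourier transform. -/
def fourierConst (d : ℕ) : ℝ := (2 * Real.pi) ^ (-(d : ℝ) / 2)

/-- `e^{i k·x}`. -/
def planeWave (k x : Sp d) : ℂ := Complex.exp (Complex.I * ((inner ℝ k x : ℝ) : ℂ))

/-- `w` is the Fourier transform, as an integrable function, of the bounded continuous function
`f`: `f(x) = (2π)^{-d/2} ∫ e^{ik·x} w(k) dk`. This makes sense without integrability of `f`, and
it determines `w` almost everywhere. -/
def HasFourierL1 (f w : Sp d → ℂ) : Prop :=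
  Integrable w ∧ ∀ x, f x = (fourierConst d : ℂ) * ∫ k, planeWave k x * w k

/-- `‖V‖_{𝓦_μ}` in terms of the partial Fourier transform `Vhat (k, z)`. -/
def normW (L : Matrix (Fin d) (Fin d) ℝ) (μ : ℝ) (Vhat : Sp d → Sp d → ℂ) : ℝ≥0∞ :=
  ENNReal.ofReal (fourierConst d) *
    essSup (fun z => ∫⁻ k : Sp d, ENNReal.ofReal ((1 + ‖k‖) ^ μ) * ‖Vhat k z‖ₑ)
      (volume.restrict (cell L))

/-- The class `𝓦_μ` of real potentials `V(x, z)`, `V ∈ L^∞(ℝ^{2d})`, lattice-periodic in `z`, with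
finite `𝓦_μ`-norm. For almost every `z`, `V(·, z)` has an integrable Fourier transform, hence is
(after a change on a null set) continuous; `V` denotes that representative, which is what gives
`V(x, x/ε)` a meaning. -/
structure MemW (L : Matrix (Fin d) (Fin d) ℝ) (μ : ℝ) (V : Sp d → Sp d → ℝ) : Prop where
  memLp : MemLp (Function.uncurry V) ⊤ (volume.prod volume)
  periodic : ∀ x, IsPeriodic L (V x)
  norm_lt_top : ∃ Vhat : Sp d → Sp d → ℂ, Measurable (Function.uncurry Vhat) ∧
    (∀ᵐ z : Sp d, HasFourierL1 (fun x => (V x z : ℂ)) (fun k => Vhat k z)) ∧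
    normW L μ Vhat < ⊤

/-! ### The operators, as graphs: `h` is the image of `g` -/

/-- `h = A_kp^ε g`, the fibered operator with fibers
`ε⁻² A(εk)`, `A(ξ)_{nn'} = (E_n + |ξ|²/2) δ_{nn'} - i ξ·P_{nn'}`, each on the domain
`{c ∈ ℓ² | ∑ |E_n c_n|² < ∞}`. Since `h` ranges over `ℓ²(ℕ, L²)`, this includes the condition
`∫ ‖ε⁻² A(εk) g(k)‖² dk < ∞` in the domain. -/
def IsAkp (E : ℕ → ℝ) (P : ℕ → ℕ → Fin d → ℂ) (ε : ℝ) (g h : EnvSpace d) : Prop :=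
  ∀ᵐ k : Sp d, Summable (fun n => ‖(E n : ℂ) * g n k‖ ^ 2) ∧
    ∀ n, h n k = ((E n / ε ^ 2 + ‖k‖ ^ 2 / 2 : ℝ) : ℂ) * g n k
      - Complex.I / (ε : ℂ) * ∑' n', (∑ j, (k j : ℂ) * P n n' j) * g n' k

/-- The function `(2π)^{-d/2} ∫_{𝓑/ε} e^{ik·x} c(k) dk`, i.e. the inverse Fourier transform of
`c` cut off to the scaled Brillouin zone. -/
def envFun (L : Matrix (Fin d) (Fin d) ℝ) (ε : ℝ) (c : Sp d → ℂ) (x : Sp d) : ℂ :=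
  (fourierConst d : ℂ) * ∫ k in brillouinScaled L ε, planeWave k x * c k

/-- `ψ = |𝓒|^{1/2} ∑_n f_n v_n(·/ε)` in `L²(ℝ^d)`, where `f_n` is the inverse Fourier transform
of `𝟙_{𝓑/ε} g_n`. -/
def IsSynthesis (L : Matrix (Fin d) (Fin d) ℝ) (v : ℕ → Sp d → ℂ) (ε : ℝ)
    (g : EnvSpace d) (ψ : Sp d → ℂ) : Prop :=
  MemLp ψ 2 volume ∧
  Tendsto (fun N => eLpNorm (fun x => ψ x - (Real.sqrt (volume.real (cell L)) : ℂ) *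
    ∑ n ∈ Finset.range N, envFun L ε (fun k => g n k) x * v n (ε⁻¹ • x)) 2 volume) atTop (𝓝 0)

/-- `g` is the sequence of Fourier transforms of the `ε`-scaled envelope functions of `ψ`. -/
def IsEnvelope (L : Matrix (Fin d) (Fin d) ℝ) (v : ℕ → Sp d → ℂ) (ε : ℝ)
    (ψ : Sp d → ℂ) (g : EnvSpace d) : Prop :=
  (∀ n, ∀ᵐ k : Sp d, k ∉ brillouinScaled L ε → g n k = 0) ∧ IsSynthesis L v ε g ψ

/-- `h = 𝓤^ε g`: synthesize the wave function `ψ = ∑_n ∫ 𝓧^ε_{n,k} g_n(k) dk`, multiply it by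
`V(x, x/ε)`, and take Fourier transforms of envelope functions (pair with `𝓧^ε_{n,k}`). This is
the integral operator with the (in general oscillatory) kernel
`U^ε_{nn'}(k,k') = ∫ conj(𝓧^ε_{n,k}(x)) V(x, x/ε) 𝓧^ε_{n',k'}(x) dx`. -/
def IsUeps (L : Matrix (Fin d) (Fin d) ℝ) (v : ℕ → Sp d → ℂ) (V : Sp d → Sp d → ℝ) (ε : ℝ)
    (g h : EnvSpace d) : Prop :=
  ∃ ψ : Sp d → ℂ, IsSynthesis L v ε g ψ ∧
    IsEnvelope L v ε (fun x => (V x (ε⁻¹ • x) : ℂ) * ψ x) h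

/-- `V_{nn'}(x) = ∫_𝓒 conj(v_n(z)) v_{n'}(z) V(x, z) dz`. -/
def potElem (L : Matrix (Fin d) (Fin d) ℝ) (v : ℕ → Sp d → ℂ) (V : Sp d → Sp d → ℝ)
    (n n' : ℕ) (x : Sp d) : ℂ :=
  ∫ z in cell L, conj (v n z) * v n' z * (V x z : ℂ)

/-- `h = 𝓤⁰ g`: `h_n(k) = ∑_{n'} (2π)^{-d/2} ∫ V̂_{nn'}(k-k') g_{n'}(k') dk'`, where `V̂_{nn'}` is
the Fourier transform of `V_{nn'}` and the series converges in `L²(ℝ^d)`. -/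
def IsU0 (L : Matrix (Fin d) (Fin d) ℝ) (v : ℕ → Sp d → ℂ) (V : Sp d → Sp d → ℝ)
    (g h : EnvSpace d) : Prop :=
  ∃ Vhat : ℕ → ℕ → Sp d → ℂ, (∀ n n', HasFourierL1 (potElem L v V n n') (Vhat n n')) ∧
    ∀ n, Tendsto (fun N => eLpNorm (fun k => h n k - ∑ n' ∈ Finset.range N,
      (fourierConst d : ℂ) * ∫ k', Vhat n n' (k - k') * g n' k') 2 volume) atTop (𝓝 0)

/-- `g` is the mild solution, for `t ≥ 0`, of `i ∂_t g = A g + U g`, `g(0) = g₀`, the operators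
`A` and `U` being given by their graphs: `g` is continuous, `∫₀ᵗ g` lies in the domain, and
`g(t) = g₀ - i (A + U) ∫₀ᵗ g(s) ds`. -/
def IsMildSolution (A U : EnvSpace d → EnvSpace d → Prop) (g₀ : EnvSpace d)
    (g : ℝ → EnvSpace d) : Prop :=
  ContinuousOn g (Ici 0) ∧
  ∀ t, 0 ≤ t → ∃ a u : EnvSpace d, A (∫ s in (0 : ℝ)..t, g s) a ∧ U (∫ s in (0 : ℝ)..t, g s) u ∧
    g t = g₀ - Complex.I • (a + u)

end KP

end

/-!
A sequence `g` of envelopes is identified, isometrically, with the function `∑ₙ gₙ(k) vₙ(z)` of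
`k ∈ ℝ^d` and `z ∈ 𝓒`. Under this identification `𝓤⁰` becomes convolution in `k` with `V̂(·, z)`,
and `𝓤^ε` becomes the same convolution on `𝓑/ε` folded modulo the lattice reciprocal to `ε𝓛`. By
Schur's test both are bounded uniformly in `ε`, and `𝓤⁰` is also bounded for the weight
`(1 + |k|²)^{μ/2}`, which varies at most by the factor `(1 + |k - k'|)^μ` between `k` and `k'`. The
kernels differ only through folding and cut-off, which involve frequencies outside the interior of
`𝓑/ε`; there the weight is at least of order `ε^{-μ}`, so `𝓤^ε - 𝓤⁰` gains a factor `ε^μ`.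

The operator `A_kp^ε` is symmetric on its domain and commutes with multiplication by functions of
`k`. Hence the weighted norm of the `k·p` solution and the norm of the difference of the two
solutions obey Gronwall inequalities. Mild solutions need not be differentiable in time, so these
inequalities are derived for sliding means `h⁻¹ ∫ₜ^{t+h} g`; likewise the weight is truncated at
size `ε^{-μ}` to keep multiplication by it bounded.
-/

noncomputable section

namespace KP

variable {d : ℕ}

/-! ### Lattices and their cells -/

section Lattice

variable {L M : Matrix (Fin d) (Fin d) ℝ} {ε : ℝ}

lemma latMap_eq (M : Matrix (Fin d) (Fin d) ℝ) :
    latMap M = WithLp.toLp 2 ∘ Matrix.toLin' M := by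
  ext; simp [latMap, Matrix.toLin'_apply]

lemma latMap_add (M : Matrix (Fin d) (Fin d) ℝ) (s t : Fin d → ℝ) :
    latMap M (s + t) = latMap M s + latMap M t := by
  simp [latMap, Matrix.mulVec_add]

lemma latMap_smul_matrix (ε : ℝ) (L : Matrix (Fin d) (Fin d) ℝ) (t : Fin d → ℝ) :
    latMap (ε • L) t = ε • latMap L t := by
  simp [latMap, Matrix.smul_mulVec]

lemma continuous_latMap (M : Matrix (Fin d) (Fin d) ℝ) : Continuous (latMap M) := by
  rw [latMap_eq]
  exact (PiLp.continuous_toLp 2 _).comp (Matrix.toLin' M).continuous_of_finiteDimensional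

/-- The coordinates `t ↦ M t` of an invertible matrix, as a homeomorphism. -/
def latHomeomorph (hM : M.det ≠ 0) : (Fin d → ℝ) ≃ₜ Sp d where
  toFun := latMap M
  invFun x := M⁻¹ *ᵥ x.ofLp
  left_inv t := by
    simp [latMap, Matrix.mulVec_mulVec, Matrix.nonsing_inv_mul M (isUnit_iff_ne_zero.2 hM)]
  right_inv x := by
    simp [latMap, Matrix.mulVec_mulVec, Matrix.mul_nonsing_inv M (isUnit_iff_ne_zero.2 hM)]
  continuous_toFun := continuous_latMap M
  continuous_invFun := by fun_prop

lemma latMap_injective (hM : M.det ≠ 0) : Function.Injective (latMap M) :=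
  (latHomeomorph hM).injective

lemma measurableEmbedding_latMap (hM : M.det ≠ 0) : MeasurableEmbedding (latMap M) :=
  (latHomeomorph hM).measurableEmbedding

lemma volume_eq_smul_map_latMap (hM : M.det ≠ 0) :
    (volume : Measure (Sp d)) = ENNReal.ofReal |M.det| • Measure.map (latMap M) volume := by
  have hmap : Measure.map (latMap M) volume
      = ENNReal.ofReal |M.det⁻¹| • (volume : Measure (Sp d)) := by
    rw [latMap_eq, ← Measure.map_map (by fun_prop)
      (Matrix.toLin' M).continuous_of_finiteDimensional.measurable,
      Real.map_matrix_volume_pi_eq_smul_volume_pi hM, Measure.map_smul,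
      (PiLp.volume_preserving_toLp (Fin d)).map_eq]
  rw [hmap, smul_smul, ← ENNReal.ofReal_mul (abs_nonneg _), ← abs_mul, mul_inv_cancel₀ hM]
  simp

/-- The point `M m`, `m ∈ ℤ^d`, of the lattice generated by `M`. -/
def latVec (M : Matrix (Fin d) (Fin d) ℝ) (m : Fin d → ℤ) : Sp d :=
  latMap M fun i => (m i : ℝ)

lemma latVec_neg (M : Matrix (Fin d) (Fin d) ℝ) (m : Fin d → ℤ) :
    latVec M (-m) = -latVec M m := by
  rw [eq_neg_iff_add_eq_zero, latVec, latVec, ← latMap_add]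
  ext; simp [latMap, Matrix.mulVec, dotProduct]

lemma latVec_zero (M : Matrix (Fin d) (Fin d) ℝ) : latVec M 0 = 0 := by
  ext; simp [latVec, latMap, Matrix.mulVec, dotProduct]

/-- The half-open unit cube centered at the integer point `m`. Unlike the closed cubes defining
`cell`, these are pairwise disjoint. -/
def cube (m : Fin d → ℤ) : Set (Fin d → ℝ) :=
  Set.pi univ fun i => Ioc (-(1 / 2) + m i : ℝ) (-(1 / 2) + m i + 1)

lemma measurableSet_cube (m : Fin d → ℤ) : MeasurableSet (cube m) :=
  .univ_pi fun _ => measurableSet_Ioc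

lemma iUnion_cube : ⋃ m : Fin d → ℤ, cube m = univ := by
  simp only [cube, iUnion_univ_pi fun (_ : Fin d) (n : ℤ) =>
    Ioc (-(1 / 2) + n : ℝ) (-(1 / 2) + n + 1), iUnion_Ioc_add_intCast, pi_univ]

lemma pairwise_disjoint_cube : Pairwise (Function.onFun Disjoint (cube (d := d))) := by
  intro m n hmn
  obtain ⟨i, hi⟩ := Function.ne_iff.1 hmn
  exact Disjoint.set_pi (mem_univ i) (pairwise_disjoint_Ioc_add_intCast (-(1 / 2) : ℝ) hi)

lemma preimage_add_cube (m : Fin d → ℤ) :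
    (fun t : Fin d → ℝ => t + fun i => (m i : ℝ)) ⁻¹' cube m = cube 0 := by
  ext t
  simp only [cube, mem_preimage, mem_univ_pi, mem_Ioc, Pi.add_apply, Pi.zero_apply, Int.cast_zero]
  refine forall_congr' fun i => and_congr ⟨fun h => ?_, fun h => ?_⟩ ⟨fun h => ?_, fun h => ?_⟩ <;>
    linarith

lemma lintegral_eq_tsum_cube (F : (Fin d → ℝ) → ℝ≥0∞) :
    ∫⁻ t, F t = ∑' m : Fin d → ℤ, ∫⁻ t in cube 0, F (t + fun i => (m i : ℝ)) := by
  rw [← setLIntegral_univ, ← iUnion_cube,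
    lintegral_iUnion measurableSet_cube pairwise_disjoint_cube]
  refine tsum_congr fun m => ?_
  rw [← preimage_add_cube m]
  exact ((measurePreserving_add_right volume _).setLIntegral_comp_preimage_emb
    (MeasurableEquiv.addRight fun i => (m i : ℝ)).measurableEmbedding F (cube m)).symm

lemma cell_eq_image_pi (M : Matrix (Fin d) (Fin d) ℝ) :
    cell M = latMap M '' Set.pi univ fun _ => Icc (-(1 / 2)) (1 / 2) := by
  simp only [cell, Set.pi, mem_univ, true_imp_iff]

lemma isCompact_cell (M : Matrix (Fin d) (Fin d) ℝ) : IsCompact (cell M) := by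
  rw [cell_eq_image_pi]
  exact (isCompact_univ_pi fun _ => isCompact_Icc).image (continuous_latMap M)

lemma measurableSet_cell (M : Matrix (Fin d) (Fin d) ℝ) : MeasurableSet (cell M) :=
  (isCompact_cell M).measurableSet

instance isFiniteMeasure_restrict_cell (M : Matrix (Fin d) (Fin d) ℝ) :
    IsFiniteMeasure ((volume : Measure (Sp d)).restrict (cell M)) :=
  isFiniteMeasure_restrict.2 (isCompact_cell M).measure_ne_top

lemma restrict_cell_eq (hM : M.det ≠ 0) :
    (volume : Measure (Sp d)).restrict (cell M)
      = ENNReal.ofReal |M.det| • Measure.map (latMap M) (volume.restrict (cube 0)) := by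
  have hcube : cube (0 : Fin d → ℤ) =ᵐ[volume] Set.pi univ fun _ => Icc (-(1 / 2)) (1 / 2) := by
    refine Measure.ae_eq_set_pi fun i _ => ?_
    norm_num
    exact Ioc_ae_eq_Icc
  conv_lhs => rw [volume_eq_smul_map_latMap hM]
  rw [Measure.restrict_smul, cell_eq_image_pi, (measurableEmbedding_latMap hM).restrict_map,
    (latMap_injective hM).preimage_image, Measure.restrict_congr_set hcube]

lemma lintegral_eq_tsum_cell (hM : M.det ≠ 0) (F : Sp d → ℝ≥0∞) :
    ∫⁻ x, F x = ∑' m : Fin d → ℤ, ∫⁻ x in cell M, F (x + latVec M m) := by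
  rw [volume_eq_smul_map_latMap hM, lintegral_smul_measure,
    (measurableEmbedding_latMap hM).lintegral_map, lintegral_eq_tsum_cube, smul_eq_mul,
    ← ENNReal.tsum_mul_left]
  refine tsum_congr fun m => ?_
  rw [← volume_eq_smul_map_latMap hM, restrict_cell_eq hM, lintegral_smul_measure,
    (measurableEmbedding_latMap hM).lintegral_map, smul_eq_mul]
  simp only [latMap_add, latVec]

lemma measurePreserving_add_latVec (hM : M.det ≠ 0) :
    MeasurePreserving (fun p : Sp d × (Fin d → ℤ) => p.1 + latVec M p.2)
      ((volume.restrict (cell M)).prod Measure.count) volume := by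
  have hmeas : Measurable fun p : Sp d × (Fin d → ℤ) => p.1 + latVec M p.2 :=
    measurable_fst.add ((measurable_of_countable (latVec M)).comp measurable_snd)
  refine ⟨hmeas, Measure.ext_of_lintegral _ fun f hf => ?_⟩
  rw [lintegral_map hf hmeas]
  refine (lintegral_prod_symm' _ (hf.comp hmeas)).trans ?_
  rw [lintegral_count]
  exact (lintegral_eq_tsum_cell hM f).symm

lemma interior_cell (hM : M.det ≠ 0) :
    interior (cell M) = latMap M '' Set.pi univ fun _ => Ioo (-(1 / 2)) (1 / 2) := by
  rw [cell_eq_image_pi]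
  refine ((latHomeomorph hM).image_interior _).symm.trans ?_
  simp only [interior_pi_set finite_univ, interior_Icc]
  rfl

lemma zero_mem_interior_cell (hM : M.det ≠ 0) : 0 ∈ interior (cell M) := by
  rw [interior_cell hM]
  exact ⟨0, by simp, by simp [latMap]⟩

lemma add_latVec_notMem_interior_cell (hM : M.det ≠ 0) {x : Sp d} (hx : x ∈ cell M)
    {m : Fin d → ℤ} (hm : m ≠ 0) : x + latVec M m ∉ interior (cell M) := by
  rw [interior_cell hM]
  rintro ⟨s, hs, hsx⟩
  obtain ⟨t, ht, rfl⟩ := hx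
  obtain ⟨i, hi⟩ := Function.ne_iff.1 hm
  rw [latVec, ← latMap_add] at hsx
  have hst : s i = t i + m i := congrFun (latMap_injective hM hsx) i
  have hsi : |s i| < 1 / 2 := abs_lt.2 (hs i (mem_univ i))
  have hti : |t i| ≤ 1 / 2 := abs_le.2 (ht i)
  have hmi : (1 : ℝ) ≤ |(m i : ℝ)| := by exact_mod_cast Int.one_le_abs hi
  have hsub : |(m i : ℝ)| ≤ |s i| + |t i| := by
    simpa [hst] using abs_sub (s i) (t i)
  linarith

/-! ### Reciprocal lattices -/

lemma isUnit_det_transpose (hM : M.det ≠ 0) : IsUnit Mᵀ.det := by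
  simpa [isUnit_iff_ne_zero] using hM

lemma det_smul_ne_zero (hL : L.det ≠ 0) (hε : ε ≠ 0) : (ε • L).det ≠ 0 := by
  rw [Matrix.det_smul]
  exact mul_ne_zero (pow_ne_zero _ hε) hL

lemma det_recip_ne_zero (hM : M.det ≠ 0) : (recip M).det ≠ 0 :=
  det_smul_ne_zero (Matrix.isUnit_nonsing_inv_det _ (isUnit_det_transpose hM)).ne_zero
    Real.two_pi_pos.ne'

lemma inner_latMap_recip (hM : M.det ≠ 0) (s t : Fin d → ℝ) :
    inner ℝ (latMap (recip M) s) (latMap M t) = 2 * Real.pi * ∑ i, s i * t i := by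
  have hdot : inner ℝ (latMap (recip M) s) (latMap M t) = (recip M *ᵥ s) ⬝ᵥ (M *ᵥ t) := by
    simp [latMap, PiLp.inner_apply, dotProduct, mul_comm]
  rw [hdot, Matrix.dotProduct_mulVec, ← Matrix.mulVec_transpose, Matrix.mulVec_mulVec, recip,
    Matrix.mul_smul, Matrix.mul_nonsing_inv _ (isUnit_det_transpose hM), Matrix.smul_mulVec,
    Matrix.one_mulVec, smul_dotProduct]
  simp [dotProduct]

lemma recip_smul (hL : L.det ≠ 0) (hε : ε ≠ 0) : recip (ε • L) = ε⁻¹ • recip L := by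
  have hinv : (ε • L)ᵀ * (ε⁻¹ • (Lᵀ)⁻¹) = 1 := by
    rw [Matrix.transpose_smul, Matrix.smul_mul, Matrix.mul_smul,
      Matrix.mul_nonsing_inv _ (isUnit_det_transpose hL), smul_smul, mul_inv_cancel₀ hε, one_smul]
  rw [recip, recip, Matrix.inv_eq_right_inv hinv, smul_comm]

lemma recip_recip (hM : M.det ≠ 0) : recip (recip M) = M := by
  have hinv : (recip M)ᵀ * ((2 * Real.pi)⁻¹ • M) = 1 := by
    rw [recip, Matrix.transpose_smul, Matrix.transpose_nonsing_inv, Matrix.transpose_transpose,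
      Matrix.smul_mul, Matrix.mul_smul, Matrix.nonsing_inv_mul _ (isUnit_iff_ne_zero.2 hM),
      smul_smul, mul_inv_cancel₀ Real.two_pi_pos.ne', one_smul]
  rw [recip, Matrix.inv_eq_right_inv hinv, smul_smul, mul_inv_cancel₀ Real.two_pi_pos.ne', one_smul]

lemma brillouinScaled_eq_cell (hL : L.det ≠ 0) (hε : ε ≠ 0) :
    brillouinScaled L ε = cell (recip (ε • L)) := by
  ext k
  simp only [brillouinScaled, brillouin, cell, mem_ofPred_eq, mem_image, recip_smul hL hε,
    latMap_smul_matrix]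
  refine exists_congr fun t => and_congr_right fun _ => ?_
  rw [inv_smul_eq_iff₀ hε]

lemma exists_le_norm_of_notMem_interior_cell_recip (hL : L.det ≠ 0) :
    ∃ r > 0, ∀ ε > 0, ∀ k ∉ interior (cell (recip (ε • L))), r / ε ≤ ‖k‖ := by
  obtain ⟨r, hr, hball⟩ := Metric.isOpen_iff.1 isOpen_interior 0
    (zero_mem_interior_cell (det_recip_ne_zero hL))
  refine ⟨r, hr, fun ε hε k hk => ?_⟩
  contrapose! hk
  rw [lt_div_iff₀ hε] at hk
  have hmem : ε • k ∈ interior (cell (recip L)) :=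
    hball (by rwa [mem_ball_zero_iff, norm_smul, Real.norm_of_nonneg hε.le, mul_comm])
  rw [interior_cell (det_recip_ne_zero hL)] at hmem
  rw [interior_cell (det_recip_ne_zero (det_smul_ne_zero hL hε.ne')), recip_smul hL hε.ne']
  obtain ⟨t, ht, htk⟩ := hmem
  exact ⟨t, ht, by rw [latMap_smul_matrix, htk, inv_smul_smul₀ hε.ne']⟩

end Lattice

/-! ### Plane waves -/

section PlaneWave

lemma planeWave_add_left (k k' x : Sp d) :
    planeWave (k + k') x = planeWave k x * planeWave k' x := by
  rw [planeWave, planeWave, planeWave, ← Complex.exp_add, inner_add_left]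
  push_cast; ring_nf

lemma planeWave_comm (k x : Sp d) : planeWave k x = planeWave x k := by
  rw [planeWave, planeWave, real_inner_comm]

lemma planeWave_add_right (k x y : Sp d) :
    planeWave k (x + y) = planeWave k x * planeWave k y := by
  simp only [planeWave_comm k, planeWave_add_left]

lemma norm_planeWave (k x : Sp d) : ‖planeWave k x‖ = 1 := by
  rw [planeWave, mul_comm, Complex.norm_exp_ofReal_mul_I]

lemma enorm_planeWave (k x : Sp d) : ‖planeWave k x‖ₑ = 1 := by
  rw [← ofReal_norm, norm_planeWave, ENNReal.ofReal_one]

lemma conj_planeWave (k x : Sp d) : conj (planeWave k x) = planeWave (-k) x := by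
  rw [planeWave, planeWave, ← Complex.exp_conj]
  simp

lemma planeWave_ne_zero (k x : Sp d) : planeWave k x ≠ 0 := Complex.exp_ne_zero _

lemma continuous_planeWave : Continuous fun p : Sp d × Sp d => planeWave p.1 p.2 := by
  unfold planeWave; fun_prop

lemma continuous_planeWave_right (k : Sp d) : Continuous (planeWave k) :=
  continuous_planeWave.comp (Continuous.prodMk_right k)

lemma planeWave_latVec_recip {M : Matrix (Fin d) (Fin d) ℝ} (hM : M.det ≠ 0)
    (m n : Fin d → ℤ) : planeWave (latVec (recip M) m) (latVec M n) = 1 := by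
  rw [planeWave, latVec, latVec, inner_latMap_recip hM, Complex.exp_eq_one_iff]
  refine ⟨∑ i, m i * n i, ?_⟩
  push_cast; ring

end PlaneWave

/-! ### Fourier series on a cell -/

section CellFourier

attribute [local instance] instMeasureSpaceUnitAddCircle

variable {M : Matrix (Fin d) (Fin d) ℝ} {f g : Sp d → ℂ}

lemma hasSum_conj_mFourierCoeff_mul {F G : UnitAddTorus (Fin d) → ℂ}
    (hF : MemLp F 2 volume) (hG : MemLp G 2 volume) :
    HasSum (fun n => conj (UnitAddTorus.mFourierCoeff F n) * UnitAddTorus.mFourierCoeff G n)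
      (∫ θ, conj (F θ) * G θ) := by
  have hcoeff : ∀ {H : UnitAddTorus (Fin d) → ℂ} (hH : MemLp H 2 volume) (n : Fin d → ℤ),
      UnitAddTorus.mFourierCoeff (hH.toLp H) n = UnitAddTorus.mFourierCoeff H n := by
    intro H hH n
    refine integral_congr_ae ?_
    filter_upwards [hH.coeFn_toLp] with θ hθ
    rw [hθ]
  have hinner : ∫ θ, conj (hF.toLp F θ) * hG.toLp G θ = ∫ θ, conj (F θ) * G θ := by
    refine integral_congr_ae ?_
    filter_upwards [hF.coeFn_toLp, hG.coeFn_toLp] with θ hθF hθG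
    rw [hθF, hθG]
  rw [← hinner]
  simpa only [hcoeff] using UnitAddTorus.hasSum_prod_mFourierCoeff (hF.toLp F) (hG.toLp G)

/-- The parametrization of the cell of `M` by the torus `(ℝ/ℤ)^d`, through the representatives in
`(-1/2, 1/2]^d`. -/
def torusCell (M : Matrix (Fin d) (Fin d) ℝ) (θ : UnitAddTorus (Fin d)) : Sp d :=
  latMap M (UnitAddTorus.measurableEquivPiIoc (fun _ => (-(1 / 2) : ℝ)) θ).1

lemma measurePreserving_torusCell (M : Matrix (Fin d) (Fin d) ℝ) :
    MeasurePreserving (torusCell M) volume (Measure.map (latMap M) (volume.restrict (cube 0))) := by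
  have hcube : {x : Fin d → ℝ | ∀ i, x i ∈ Ioc (-(1 / 2) : ℝ) (-(1 / 2) + 1)} = cube 0 := by
    ext; simp [cube]
  have hval : MeasurePreserving
      (Subtype.val : {x : Fin d → ℝ // ∀ i, x i ∈ Ioc (-(1 / 2) : ℝ) (-(1 / 2) + 1)} → _)
      (Measure.comap Subtype.val volume) (volume.restrict (cube 0)) := by
    rw [← hcube]
    exact ⟨measurable_subtype_coe,
      map_comap_subtype_coe (hcube ▸ measurableSet_cube (d := d) 0 :
        MeasurableSet {x : Fin d → ℝ | ∀ i, x i ∈ Ioc (-(1 / 2) : ℝ) (-(1 / 2) + 1)}) volume⟩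
  have hlat : MeasurePreserving (latMap M) (volume.restrict (cube 0))
      (Measure.map (latMap M) (volume.restrict (cube 0))) :=
    ⟨(continuous_latMap M).measurable, rfl⟩
  exact hlat.comp (hval.comp (UnitAddTorus.measurePreserving_equivPiIoc _))

lemma mFourier_neg_eq_conj_planeWave (hM : M.det ≠ 0) (n : Fin d → ℤ)
    (θ : UnitAddTorus (Fin d)) :
    UnitAddTorus.mFourier (-n) θ = conj (planeWave (latVec (recip M) n) (torusCell M θ)) := by
  rw [UnitAddTorus.mFourier_neg, planeWave, torusCell, latVec, inner_latMap_recip hM]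
  congr 1
  set y := UnitAddTorus.measurableEquivPiIoc (fun _ => (-(1 / 2) : ℝ)) θ with hy
  have hθ : θ = fun i => ((y.1 i : ℝ) : UnitAddCircle) := by
    rw [← UnitAddTorus.coe_symm_measurableEquivPiIoc_apply, hy, MeasurableEquiv.symm_apply_apply]
  rw [hθ]
  simp only [UnitAddTorus.mFourier, ContinuousMap.coe_mk, fourier_coe_apply]
  rw [← Complex.exp_sum]
  congr 1
  push_cast
  rw [Finset.mul_sum, Finset.mul_sum]
  exact Finset.sum_congr rfl fun i _ => by ring

lemma memLp_comp_torusCell (hM : M.det ≠ 0) (hf : MemLp f 2 (volume.restrict (cell M))) :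
    MemLp (f ∘ torusCell M) 2 volume := by
  refine MemLp.comp_measurePreserving ?_ (measurePreserving_torusCell M)
  rw [restrict_cell_eq hM] at hf
  have hscaled := hf.smul_measure (c := (ENNReal.ofReal |M.det|)⁻¹) (by simpa using hM)
  rwa [smul_smul, ENNReal.inv_mul_cancel (by simpa using hM) (by simp), one_smul] at hscaled

lemma setIntegral_cell_eq_torus (hM : M.det ≠ 0)
    (hf : AEStronglyMeasurable f (volume.restrict (cell M))) :
    ∫ x in cell M, f x = (|M.det| : ℝ) * ∫ θ, f (torusCell M θ) := by
  have hmp := measurePreserving_torusCell M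
  rw [restrict_cell_eq hM] at hf ⊢
  have hf' : AEStronglyMeasurable f (Measure.map (torusCell M) volume) := by
    rw [hmp.map_eq]
    exact hf.mono_ac (Measure.absolutelyContinuous_smul (by simpa using hM))
  rw [integral_smul_measure, ← hmp.map_eq, integral_map hmp.measurable.aemeasurable hf',
    ENNReal.toReal_ofReal (abs_nonneg _), Complex.real_smul]

/-- The Fourier coefficients `∫ conj (e^{iξ·x}) f(x) dx` of a function on the cell of `M`, where
`ξ` runs over the reciprocal lattice. They are not normalized by the volume of the cell. -/
def cellCoeff (M : Matrix (Fin d) (Fin d) ℝ) (f : Sp d → ℂ) (n : Fin d → ℤ) : ℂ :=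
  ∫ x in cell M, conj (planeWave (latVec (recip M) n) x) * f x

lemma cellCoeff_eq_mFourierCoeff (hM : M.det ≠ 0) (hf : MemLp f 2 (volume.restrict (cell M)))
    (n : Fin d → ℤ) :
    cellCoeff M f n = (|M.det| : ℝ) * UnitAddTorus.mFourierCoeff (f ∘ torusCell M) n := by
  have hwave : Continuous fun x : Sp d => conj (planeWave (latVec (recip M) n) x) :=
    Complex.continuous_conj.comp (continuous_planeWave_right _)
  rw [cellCoeff, setIntegral_cell_eq_torus hM
    (f := fun x => conj (planeWave (latVec (recip M) n) x) * f x)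
    (hwave.aestronglyMeasurable.mul hf.1), UnitAddTorus.mFourierCoeff]
  simp only [mFourier_neg_eq_conj_planeWave hM, smul_eq_mul, Function.comp_apply]

theorem hasSum_conj_cellCoeff_mul (hM : M.det ≠ 0) (hf : MemLp f 2 (volume.restrict (cell M)))
    (hg : MemLp g 2 (volume.restrict (cell M))) :
    HasSum (fun n => conj (cellCoeff M f n) * cellCoeff M g n)
      ((|M.det| : ℝ) * ∫ x in cell M, conj (f x) * g x) := by
  rw [setIntegral_cell_eq_torus hM (f := fun x => conj (f x) * g x)
    ((Complex.continuous_conj.comp_aestronglyMeasurable hf.1).mul hg.1), ← mul_assoc]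
  refine ((hasSum_conj_mFourierCoeff_mul (memLp_comp_torusCell hM hf)
    (memLp_comp_torusCell hM hg)).mul_left _).congr_fun fun n => ?_
  rw [cellCoeff_eq_mFourierCoeff hM hf, cellCoeff_eq_mFourierCoeff hM hg, map_mul,
    Complex.conj_ofReal]
  ring

theorem ae_eq_zero_of_cellCoeff_eq_zero (hM : M.det ≠ 0)
    (hf : MemLp f 2 (volume.restrict (cell M))) (h : ∀ n, cellCoeff M f n = 0) :
    f =ᵐ[volume.restrict (cell M)] 0 := by
  have hparseval := hasSum_conj_cellCoeff_mul hM hf hf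
  simp only [h, mul_zero] at hparseval
  have hinner : ∫ x in cell M, conj (f x) * f x = 0 :=
    (mul_eq_zero.1 (hparseval.unique hasSum_zero)).resolve_left (by simpa using hM)
  have hnorm : ∫ x in cell M, ‖f x‖ ^ 2 = 0 := by
    simp only [Complex.conj_mul', ← Complex.ofReal_pow, integral_complex_ofReal] at hinner
    exact_mod_cast hinner
  rw [integral_eq_zero_iff_of_nonneg (fun x => by positivity)
    ((memLp_two_iff_integrable_sq_norm hf.1).1 hf)] at hnorm
  filter_upwards [hnorm] with x hx
  simpa using hx

end CellFourier

/-! ### Schur's test and fibred integral operators -/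

section Schur

variable {X Y Z : Type*} [MeasurableSpace X] [MeasurableSpace Y] [MeasurableSpace Z]

lemma sq_eLpNorm_two {G : Type*} [NormedAddCommGroup G] (f : X → G) (μ : Measure X) :
    eLpNorm f 2 μ ^ 2 = ∫⁻ x, ‖f x‖ₑ ^ 2 ∂μ := by
  have := eLpNorm_nnreal_pow_eq_lintegral (f := f) (μ := μ) (p := 2) (by norm_num)
  simpa using this

lemma sq_lintegral_mul_le (μ : Measure X) {f g : X → ℝ≥0∞} (hf : AEMeasurable f μ)
    (hg : AEMeasurable g μ) :
    (∫⁻ x, f x * g x ∂μ) ^ 2 ≤ (∫⁻ x, f x ^ 2 ∂μ) * ∫⁻ x, g x ^ 2 ∂μ := by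
  have h := ENNReal.lintegral_mul_le_Lp_mul_Lq μ Real.HolderConjugate.two_two hf hg
  have h2 := pow_le_pow_left' h 2
  simp only [Pi.mul_apply, ENNReal.rpow_two] at h2
  refine h2.trans (le_of_eq ?_)
  rw [mul_pow, ← ENNReal.rpow_natCast, ← ENNReal.rpow_natCast, ← ENNReal.rpow_mul,
    ← ENNReal.rpow_mul]
  norm_num

lemma sq_lintegral_kernel_le (μ : Measure Y) {k f : Y → ℝ≥0∞} (hk : AEMeasurable k μ)
    (hf : AEMeasurable f μ) :
    (∫⁻ y, k y * f y ∂μ) ^ 2 ≤ (∫⁻ y, k y ∂μ) * ∫⁻ y, k y * f y ^ 2 ∂μ := by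
  have h := sq_lintegral_mul_le μ (f := fun y => k y ^ (1 / 2 : ℝ))
    (g := fun y => k y ^ (1 / 2 : ℝ) * f y) (hk.pow_const _) ((hk.pow_const _).mul hf)
  have e : ∀ a : ℝ≥0∞, a ^ (1 / 2 : ℝ) * a ^ (1 / 2 : ℝ) = a := fun a => by
    rw [← ENNReal.rpow_add_of_nonneg _ _ (by norm_num) (by norm_num)]; norm_num
  have e2 : ∀ a : ℝ≥0∞, (a ^ (1 / 2 : ℝ)) ^ 2 = a := fun a => by rw [sq, e]
  simpa only [← mul_assoc, e, mul_pow, e2] using h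

theorem lintegral_sq_lintegral_kernel_le (μ : Measure X) (ν : Measure Y) [SFinite μ] [SFinite ν]
    {k : X → Y → ℝ≥0∞} (hk : Measurable (Function.uncurry k)) {f : Y → ℝ≥0∞}
    (hf : AEMeasurable f ν) {A B : ℝ≥0∞} (hA : ∀ x, ∫⁻ y, k x y ∂ν ≤ A)
    (hB : ∀ y, ∫⁻ x, k x y ∂μ ≤ B) :
    ∫⁻ x, (∫⁻ y, k x y * f y ∂ν) ^ 2 ∂μ ≤ A * B * ∫⁻ y, f y ^ 2 ∂ν := by
  calc ∫⁻ x, (∫⁻ y, k x y * f y ∂ν) ^ 2 ∂μ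
      ≤ ∫⁻ x, A * ∫⁻ y, k x y * f y ^ 2 ∂ν ∂μ := by
        refine lintegral_mono fun x => ?_
        refine (sq_lintegral_kernel_le ν hk.of_uncurry_left.aemeasurable hf).trans ?_
        gcongr
        exact hA x
    _ ≤ A * ∫⁻ x, ∫⁻ y, k x y * f y ^ 2 ∂ν ∂μ := by
        rw [lintegral_const_mul'']
        exact (hk.aemeasurable.mul ((hf.comp_snd).pow_const 2)).lintegral_prod_right'
    _ = A * ∫⁻ y, ∫⁻ x, k x y * f y ^ 2 ∂μ ∂ν := by
        rw [lintegral_lintegral_swap]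
        exact hk.aemeasurable.mul ((hf.comp_snd).pow_const 2)
    _ = A * ∫⁻ y, (∫⁻ x, k x y ∂μ) * f y ^ 2 ∂ν := by
        congr 1
        refine lintegral_congr fun y => ?_
        rw [lintegral_mul_const'' _ hk.of_uncurry_right.aemeasurable]
    _ ≤ A * ∫⁻ y, B * f y ^ 2 ∂ν := by
        gcongr with y
        exact hB y
    _ = A * B * ∫⁻ y, f y ^ 2 ∂ν := by
        rw [lintegral_const_mul'' _ (hf.pow_const 2), mul_assoc]
/-- Schur's test, with constant `A`, for almost every member of a family of integral kernels
`κ · · z` indexed by `z : Z`. -/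
structure IsSchur (μ : Measure X) (ν : Measure Z) (κ : X → X → Z → ℂ) (A : ℝ) : Prop where
  nonneg : 0 ≤ A
  meas : Measurable fun p : X × X × Z => κ p.1 p.2.1 p.2.2
  left : ∀ᵐ z ∂ν, ∀ x, ∫⁻ y, ‖κ x y z‖ₑ ∂μ ≤ ENNReal.ofReal A
  right : ∀ᵐ z ∂ν, ∀ y, ∫⁻ x, ‖κ x y z‖ₑ ∂μ ≤ ENNReal.ofReal A

/-- The integral operator with kernel `κ · · z` applied in each fibre `X × {z}`. -/
def kernelFun (μ : Measure X) (κ : X → X → Z → ℂ) (u : X × Z → ℂ) (p : X × Z) : ℂ :=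
  ∫ y, κ p.1 y p.2 * u (y, p.2) ∂μ

variable {μ : Measure X} {ν : Measure Z} {κ κ' : X → X → Z → ℂ} {A A' : ℝ}

lemma IsSchur.measurable_kernel (hκ : IsSchur μ ν κ A) :
    Measurable fun q : (X × Z) × X => κ q.1.1 q.2 q.1.2 :=
  hκ.meas.comp (by fun_prop : Measurable fun q : (X × Z) × X => (q.1.1, q.2, q.1.2))

lemma IsSchur.measurable_kernel_mul (hκ : IsSchur μ ν κ A) {u : X × Z → ℂ} (hu : Measurable u) :
    Measurable fun q : (X × Z) × X => κ q.1.1 q.2 q.1.2 * u (q.2, q.1.2) :=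
  hκ.measurable_kernel.mul (hu.comp (by fun_prop))

lemma IsSchur.sub (hκ : IsSchur μ ν κ A) (hκ' : IsSchur μ ν κ' A') :
    IsSchur μ ν (fun x y z => κ x y z - κ' x y z) (A + A') where
  nonneg := add_nonneg hκ.nonneg hκ'.nonneg
  meas := hκ.meas.sub hκ'.meas
  left := by
    filter_upwards [hκ.left, hκ'.left] with z h h' x
    have hm : Measurable fun y => ‖κ x y z‖ₑ :=
      (hκ.meas.comp (by fun_prop : Measurable fun y : X => (x, y, z))).enorm
    calc ∫⁻ y, ‖κ x y z - κ' x y z‖ₑ ∂μ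
        ≤ ∫⁻ y, ‖κ x y z‖ₑ + ‖κ' x y z‖ₑ ∂μ := lintegral_mono fun y => enorm_sub_le
      _ ≤ ENNReal.ofReal (A + A') := by
        rw [lintegral_add_left hm, ENNReal.ofReal_add hκ.nonneg hκ'.nonneg]
        exact add_le_add (h x) (h' x)
  right := by
    filter_upwards [hκ.right, hκ'.right] with z h h' y
    have hm : Measurable fun x => ‖κ x y z‖ₑ :=
      (hκ.meas.comp (by fun_prop : Measurable fun x : X => (x, y, z))).enorm
    calc ∫⁻ x, ‖κ x y z - κ' x y z‖ₑ ∂μ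
        ≤ ∫⁻ x, ‖κ x y z‖ₑ + ‖κ' x y z‖ₑ ∂μ := lintegral_mono fun x => enorm_sub_le
      _ ≤ ENNReal.ofReal (A + A') := by
        rw [lintegral_add_left hm, ENNReal.ofReal_add hκ.nonneg hκ'.nonneg]
        exact add_le_add (h y) (h' y)

lemma ae_prod_fst [SFinite ν] {P : X → Prop} (h : ∀ᵐ x ∂μ, P x) : ∀ᵐ p ∂(μ.prod ν), P p.1 :=
  Measure.quasiMeasurePreserving_fst.ae h

lemma ae_prod_snd {P : Z → Prop} (h : ∀ᵐ z ∂ν, P z) : ∀ᵐ p ∂(μ.prod ν), P p.2 :=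
  Measure.quasiMeasurePreserving_snd.ae h

variable [SFinite μ]

lemma IsSchur.aestronglyMeasurable_kernelFun (hκ : IsSchur μ ν κ A) {u : X × Z → ℂ}
    (hu : Measurable u) : AEStronglyMeasurable (kernelFun μ κ u) (μ.prod ν) :=
  ((hκ.measurable_kernel_mul hu).stronglyMeasurable.integral_prod_right' (ν := μ))
    |>.aestronglyMeasurable

variable [SFinite ν]

lemma ae_prod_swap {P : X × Z → Prop} (h : ∀ᵐ p ∂(μ.prod ν), P p) :
    ∀ᵐ z ∂ν, ∀ᵐ x ∂μ, P (x, z) :=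
  Measure.ae_ae_of_ae_prod (Measure.measurePreserving_swap.quasiMeasurePreserving.ae h)

lemma kernelFun_congr (κ : X → X → Z → ℂ) {u u' : X × Z → ℂ} (h : u =ᵐ[μ.prod ν] u') :
    kernelFun μ κ u =ᵐ[μ.prod ν] kernelFun μ κ u' := by
  filter_upwards [ae_prod_snd (μ := μ) (ae_prod_swap h)] with p hp
  refine integral_congr_ae ?_
  filter_upwards [hp] with y hy
  rw [hy]

lemma IsSchur.lintegral_le (hκ : IsSchur μ ν κ A) {f : X × Z → ℝ≥0∞} (hf : Measurable f) :
    ∫⁻ p, (∫⁻ y, ‖κ p.1 y p.2‖ₑ * f (y, p.2) ∂μ) ^ 2 ∂(μ.prod ν)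
      ≤ ENNReal.ofReal A ^ 2 * ∫⁻ p, f p ^ 2 ∂(μ.prod ν) := by
  have hmeas : Measurable fun q : (X × Z) × X => ‖κ q.1.1 q.2 q.1.2‖ₑ * f (q.2, q.1.2) :=
    hκ.measurable_kernel.enorm.mul (hf.comp (by fun_prop))
  rw [lintegral_prod_symm' _ (hmeas.lintegral_prod_right'.pow_const 2),
    lintegral_prod_symm' _ (hf.pow_const 2), ← lintegral_const_mul _
      (hf.pow_const 2).lintegral_prod_left']
  refine lintegral_mono_ae ?_
  filter_upwards [hκ.left, hκ.right] with z hleft hright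
  have hkernel : Measurable (Function.uncurry fun x y => ‖κ x y z‖ₑ) :=
    (hκ.meas.comp (by fun_prop : Measurable fun p : X × X => (p.1, p.2, z))).enorm
  simpa only [← sq] using lintegral_sq_lintegral_kernel_le μ μ hkernel
    (f := fun y => f (y, z)) (hf.comp (by fun_prop)).aemeasurable hleft hright

lemma IsSchur.eLpNorm_le (hκ : IsSchur μ ν κ A) {u : X × Z → ℂ} (hu : MemLp u 2 (μ.prod ν)) :
    eLpNorm (kernelFun μ κ u) 2 (μ.prod ν) ≤ ENNReal.ofReal A * eLpNorm u 2 (μ.prod ν) := by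
  obtain ⟨u', hu', he⟩ := hu.1
  rw [eLpNorm_congr_ae (kernelFun_congr κ he), eLpNorm_congr_ae he]
  refine (ENNReal.pow_le_pow_left_iff (n := 2) (by norm_num)).1 ?_
  rw [mul_pow, sq_eLpNorm_two, sq_eLpNorm_two]
  refine (lintegral_mono fun p => ?_).trans
    (hκ.lintegral_le (f := fun p => ‖u' p‖ₑ) hu'.measurable.enorm)
  gcongr
  refine (enorm_integral_le_lintegral_enorm _).trans_eq ?_
  simp only [enorm_mul]

lemma IsSchur.memLp (hκ : IsSchur μ ν κ A) {u : X × Z → ℂ} (hu : MemLp u 2 (μ.prod ν)) :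
    MemLp (kernelFun μ κ u) 2 (μ.prod ν) := by
  obtain ⟨u', hu', he⟩ := hu.1
  exact ⟨(hκ.aestronglyMeasurable_kernelFun hu'.measurable).congr (kernelFun_congr κ he).symm,
    (hκ.eLpNorm_le hu).trans_lt (ENNReal.mul_lt_top ENNReal.ofReal_lt_top hu.2)⟩

lemma IsSchur.ae_integrable (hκ : IsSchur μ ν κ A) {u : X × Z → ℂ}
    (hu : MemLp u 2 (μ.prod ν)) :
    ∀ᵐ p ∂(μ.prod ν), Integrable (fun y => κ p.1 y p.2 * u (y, p.2)) μ := by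
  obtain ⟨u', hu', he⟩ := hu.1
  have hmeas := hκ.measurable_kernel_mul hu'.measurable
  have hfin : ∫⁻ p, (∫⁻ y, ‖κ p.1 y p.2 * u' (y, p.2)‖ₑ ∂μ) ^ 2 ∂(μ.prod ν) < ⊤ := by
    simp only [enorm_mul]
    refine (hκ.lintegral_le (f := fun p => ‖u' p‖ₑ) hu'.measurable.enorm).trans_lt ?_
    rw [← sq_eLpNorm_two, ← eLpNorm_congr_ae he]
    exact ENNReal.mul_lt_top (ENNReal.pow_lt_top ENNReal.ofReal_lt_top)
      (ENNReal.pow_lt_top hu.2)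
  filter_upwards [ae_lt_top' (hmeas.enorm.lintegral_prod_right'.aemeasurable.pow_const 2) hfin.ne,
    ae_prod_snd (μ := μ) (ae_prod_swap he)] with p hp hz
  have hu'p : Integrable (fun y => κ p.1 y p.2 * u' (y, p.2)) μ :=
    ⟨(hmeas.comp (by fun_prop : Measurable fun y : X => (p, y))).aestronglyMeasurable,
      hasFiniteIntegral_iff_enorm.2 (by simpa using hp)⟩
  refine hu'p.congr ?_
  filter_upwards [hz] with y hy
  rw [hy]

lemma IsSchur.kernelFun_add (hκ : IsSchur μ ν κ A) {u u' : X × Z → ℂ}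
    (hu : MemLp u 2 (μ.prod ν)) (hu' : MemLp u' 2 (μ.prod ν)) :
    kernelFun μ κ (u + u') =ᵐ[μ.prod ν] kernelFun μ κ u + kernelFun μ κ u' := by
  filter_upwards [hκ.ae_integrable hu, hκ.ae_integrable hu'] with p hp hp'
  simp only [kernelFun, Pi.add_apply, mul_add]
  exact integral_add hp hp'

/-- The bounded operator on `L²(X × Z)` with kernel `κ · · z` in each fibre. -/
def IsSchur.op (hκ : IsSchur μ ν κ A) : Lp ℂ 2 (μ.prod ν) →L[ℂ] Lp ℂ 2 (μ.prod ν) :=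
  LinearMap.mkContinuous
    { toFun := fun u => (hκ.memLp (Lp.memLp u)).toLp _
      map_add' := fun u u' => by
        rw [← MemLp.toLp_add]
        exact MemLp.toLp_congr _ _ ((kernelFun_congr κ (Lp.coeFn_add u u')).trans
          (hκ.kernelFun_add (Lp.memLp u) (Lp.memLp u')))
      map_smul' := fun a u => by
        rw [RingHom.id_apply, ← MemLp.toLp_const_smul]
        refine MemLp.toLp_congr _ _ ((kernelFun_congr κ (Lp.coeFn_smul a u)).trans ?_)
        filter_upwards with p
        simp only [kernelFun, Pi.smul_apply, smul_eq_mul, mul_left_comm _ a, integral_const_mul] }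
    A (fun u => by
      rw [LinearMap.coe_mk, AddHom.coe_mk, Lp.norm_toLp, Lp.norm_def]
      refine (ENNReal.toReal_mono (ENNReal.mul_ne_top ENNReal.ofReal_ne_top (Lp.eLpNorm_ne_top u))
        (hκ.eLpNorm_le (Lp.memLp u))).trans_eq ?_
      rw [ENNReal.toReal_mul, ENNReal.toReal_ofReal hκ.nonneg])

lemma IsSchur.coeFn_op (hκ : IsSchur μ ν κ A) (u : Lp ℂ 2 (μ.prod ν)) :
    hκ.op u =ᵐ[μ.prod ν] kernelFun μ κ u :=
  (hκ.memLp (Lp.memLp u)).coeFn_toLp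

lemma IsSchur.norm_op_apply_le (hκ : IsSchur μ ν κ A) (u : Lp ℂ 2 (μ.prod ν)) :
    ‖hκ.op u‖ ≤ A * ‖u‖ :=
  hκ.op.le_of_opNorm_le (LinearMap.mkContinuous_norm_le _ hκ.nonneg _) u

lemma IsSchur.op_sub (hκ : IsSchur μ ν κ A) (hκ' : IsSchur μ ν κ' A') (u : Lp ℂ 2 (μ.prod ν)) :
    hκ.op u - hκ'.op u = (hκ.sub hκ').op u := by
  ext1
  filter_upwards [Lp.coeFn_sub (hκ.op u) (hκ'.op u), hκ.coeFn_op u, hκ'.coeFn_op u,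
    (hκ.sub hκ').coeFn_op u, hκ.ae_integrable (Lp.memLp u), hκ'.ae_integrable (Lp.memLp u)]
    with p hsub hop hop' hop_sub hint hint'
  rw [hsub, Pi.sub_apply, hop, hop', hop_sub]
  simp only [kernelFun, sub_mul]
  rw [integral_sub hint hint']

end Schur

/-! ### Multiplication by bounded weights -/

section Weight

variable {X : Type*} [MeasurableSpace X]

/-- A measurable real function with a chosen bound, to be used as a multiplication operator. -/
structure Weight (X : Type*) [MeasurableSpace X] where
  toFun : X → ℝ
  meas : Measurable toFun
  bound : ℝ
  bound_nonneg : 0 ≤ bound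
  abs_le : ∀ x, |toFun x| ≤ bound

/-- The weight `(x, z) ↦ a x` on a product. -/
def Weight.fst (a : Weight X) (Z : Type*) [MeasurableSpace Z] : Weight (X × Z) where
  toFun := fun p => a.toFun p.1
  meas := a.meas.comp measurable_fst
  bound := a.bound
  bound_nonneg := a.bound_nonneg
  abs_le := fun p => a.abs_le p.1

lemma Weight.norm_mul_apply_le (a : Weight X) (x : X) (w : ℂ) :
    ‖(a.toFun x : ℂ) * w‖ ≤ a.bound * ‖w‖ := by
  rw [norm_mul, Complex.norm_real]
  exact mul_le_mul_of_nonneg_right (a.abs_le x) (norm_nonneg _)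

lemma Weight.memLp_mul (a : Weight X) {μ : Measure X} {f : X → ℂ} (hf : MemLp f 2 μ) :
    MemLp (fun x => (a.toFun x : ℂ) * f x) 2 μ :=
  hf.of_le_mul ((Complex.measurable_ofReal.comp a.meas).aestronglyMeasurable.mul hf.1)
    (ae_of_all _ fun x => a.norm_mul_apply_le x (f x))

/-- Multiplication by a weight, as a bounded operator on `L²`. -/
def Weight.mul (a : Weight X) (μ : Measure X) : Lp ℂ 2 μ →L[ℂ] Lp ℂ 2 μ :=
  LinearMap.mkContinuous
    { toFun := fun f => (a.memLp_mul (Lp.memLp f)).toLp _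
      map_add' := fun f g => by
        rw [← MemLp.toLp_add]
        refine MemLp.toLp_congr _ _ ?_
        filter_upwards [Lp.coeFn_add f g] with x hx
        simp only [hx, Pi.add_apply, mul_add]
      map_smul' := fun c f => by
        rw [RingHom.id_apply, ← MemLp.toLp_const_smul]
        refine MemLp.toLp_congr _ _ ?_
        filter_upwards [Lp.coeFn_smul c f] with x hx
        simp only [hx, Pi.smul_apply, smul_eq_mul, mul_left_comm] }
    a.bound (fun f => by
      refine Lp.norm_le_mul_norm_of_ae_le_mul ?_
      filter_upwards [(a.memLp_mul (Lp.memLp f)).coeFn_toLp] with x hx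
      simpa only [LinearMap.coe_mk, AddHom.coe_mk, hx] using a.norm_mul_apply_le x (f x))

lemma Weight.coeFn_mul (a : Weight X) {μ : Measure X} (f : Lp ℂ 2 μ) :
    a.mul μ f =ᵐ[μ] fun x => (a.toFun x : ℂ) * f x :=
  (a.memLp_mul (Lp.memLp f)).coeFn_toLp

lemma Weight.norm_mul_le (a : Weight X) (μ : Measure X) : ‖a.mul μ‖ ≤ a.bound :=
  LinearMap.mkContinuous_norm_le _ a.bound_nonneg _

/-- Componentwise multiplication by a weight. -/
def Weight.env (a : Weight X) (μ : Measure X) :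
    lp (fun _ : ℕ => Lp ℂ 2 μ) 2 →L[ℂ] lp (fun _ : ℕ => Lp ℂ 2 μ) 2 :=
  lp.mapCLM 2 (fun _ => a.mul μ) a.bound_nonneg fun _ => a.norm_mul_le μ

lemma Weight.env_apply (a : Weight X) {μ : Measure X} (g : lp (fun _ : ℕ => Lp ℂ 2 μ) 2) (n : ℕ) :
    a.env μ g n = a.mul μ (g n) := rfl

variable {Z : Type*} [MeasurableSpace Z] {μ : Measure X} {ν : Measure Z} [SFinite μ] [SFinite ν]
  {κ κ' : X → X → Z → ℂ} {A A' : ℝ}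

lemma IsSchur.mul_op (hκ : IsSchur μ ν κ A) (hκ' : IsSchur μ ν κ' A') (a b : Weight X)
    (h : ∀ x y z, (a.toFun x : ℂ) * κ x y z = κ' x y z * b.toFun y) (u : Lp ℂ 2 (μ.prod ν)) :
    (a.fst Z).mul _ (hκ.op u) = hκ'.op ((b.fst Z).mul _ u) := by
  ext1
  filter_upwards [(a.fst Z).coeFn_mul (hκ.op u), hκ.coeFn_op u, hκ'.coeFn_op ((b.fst Z).mul _ u),
    kernelFun_congr κ' ((b.fst Z).coeFn_mul u)] with p hmul hop hop' hcongr
  rw [hmul, hop, hop', hcongr]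
  simp only [kernelFun, Weight.fst, ← integral_const_mul, ← mul_assoc, h]

lemma IsSchur.op_eq_op_mul (hκ : IsSchur μ ν κ A) (hκ' : IsSchur μ ν κ' A') (b : Weight X)
    (h : ∀ x y z, κ x y z = κ' x y z * b.toFun y) (u : Lp ℂ 2 (μ.prod ν)) :
    hκ.op u = hκ'.op ((b.fst Z).mul _ u) := by
  ext1
  filter_upwards [hκ.coeFn_op u, hκ'.coeFn_op ((b.fst Z).mul _ u),
    kernelFun_congr κ' ((b.fst Z).coeFn_mul u)] with p hop hop' hcongr
  rw [hop, hop', hcongr]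
  simp only [kernelFun, Weight.fst, ← mul_assoc, h]

end Weight

/-! ### The isometry `ℓ²(ℕ, L²(X)) → L²(X × Z)` given by an orthonormal system of `L²(Z)` -/

section Tensor

variable {X Z : Type*} [MeasurableSpace X] [MeasurableSpace Z]

/-- Functions `v n` that are orthonormal in `L²(ν)`. -/
structure IsONSystem (ν : Measure Z) (v : ℕ → Z → ℂ) : Prop where
  memLp : ∀ n, MemLp (v n) 2 ν
  orthonormal : ∀ n m, ∫ z, conj (v n z) * v m z ∂ν = if n = m then 1 else 0

variable {μ : Measure X} {ν : Measure Z} {v : ℕ → Z → ℂ}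

lemma enorm_partialInner_sq_le {w F : Z → ℂ} (hw : MemLp w 2 ν) (hF : AEStronglyMeasurable F ν) :
    ‖∫ z, conj (w z) * F z ∂ν‖ₑ ^ 2 ≤ eLpNorm w 2 ν ^ 2 * ∫⁻ z, ‖F z‖ₑ ^ 2 ∂ν := by
  rw [sq_eLpNorm_two]
  refine le_trans ?_ (sq_lintegral_mul_le ν hw.1.enorm hF.enorm)
  gcongr
  refine (enorm_integral_le_lintegral_enorm _).trans_eq ?_
  simp only [enorm_mul, RCLike.enorm_conj]

variable [SFinite ν]

lemma memLp_partialInner {w : Z → ℂ} (hw : MemLp w 2 ν) {F : X × Z → ℂ}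
    (hF : MemLp F 2 (μ.prod ν)) : MemLp (fun x => ∫ z, conj (w z) * F (x, z) ∂ν) 2 μ := by
  have hmeas : AEStronglyMeasurable (fun p : X × Z => conj (w p.2) * F p) (μ.prod ν) :=
    (Complex.continuous_conj.comp_aestronglyMeasurable hw.1).comp_snd.mul hF.1
  have hsq : eLpNorm (fun x => ∫ z, conj (w z) * F (x, z) ∂ν) 2 μ ^ 2 < ⊤ :=
    calc eLpNorm (fun x => ∫ z, conj (w z) * F (x, z) ∂ν) 2 μ ^ 2
        = ∫⁻ x, ‖∫ z, conj (w z) * F (x, z) ∂ν‖ₑ ^ 2 ∂μ := sq_eLpNorm_two _ _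
      _ ≤ ∫⁻ x, eLpNorm w 2 ν ^ 2 * ∫⁻ z, ‖F (x, z)‖ₑ ^ 2 ∂ν ∂μ := by
        refine lintegral_mono_ae ?_
        filter_upwards [hF.1.prodMk_left] with x hx
        exact enorm_partialInner_sq_le hw hx
      _ = eLpNorm w 2 ν ^ 2 * eLpNorm F 2 (μ.prod ν) ^ 2 := by
        rw [lintegral_const_mul' _ _ (ENNReal.pow_lt_top hw.2).ne, sq_eLpNorm_two F,
          lintegral_prod _ (hF.1.enorm.pow_const 2)]
      _ < ⊤ := ENNReal.mul_lt_top (ENNReal.pow_lt_top hw.2) (ENNReal.pow_lt_top hF.2)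
  exact ⟨hmeas.integral_prod_right', (ENNReal.pow_lt_top_iff.1 hsq).resolve_right two_ne_zero⟩

lemma memLp_tensor {f : X → ℂ} {w : Z → ℂ} (hf : MemLp f 2 μ) (hw : MemLp w 2 ν) :
    MemLp (fun p : X × Z => f p.1 * w p.2) 2 (μ.prod ν) := by
  have hsq : eLpNorm (fun p : X × Z => f p.1 * w p.2) 2 (μ.prod ν) ^ 2 < ⊤ := by
    rw [sq_eLpNorm_two]
    simp only [enorm_mul, mul_pow]
    rw [lintegral_prod_mul (hf.1.enorm.pow_const 2) (hw.1.enorm.pow_const 2),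
      ← sq_eLpNorm_two, ← sq_eLpNorm_two]
    exact ENNReal.mul_lt_top (ENNReal.pow_lt_top hf.2) (ENNReal.pow_lt_top hw.2)
  exact ⟨hf.1.comp_fst.mul hw.1.comp_snd, (ENNReal.pow_lt_top_iff.1 hsq).resolve_right two_ne_zero⟩

/-- The linear map `f ↦ f ⊗ w`. -/
def tensorLin (μ : Measure X) {w : Z → ℂ} (hw : MemLp w 2 ν) :
    Lp ℂ 2 μ →ₗ[ℂ] Lp ℂ 2 (μ.prod ν) where
  toFun f := (memLp_tensor (Lp.memLp f) hw).toLp _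
  map_add' f g := by
    rw [← MemLp.toLp_add]
    refine MemLp.toLp_congr _ _ ?_
    filter_upwards [ae_prod_fst (ν := ν) (Lp.coeFn_add f g)] with p hp
    simp only [hp, Pi.add_apply, add_mul]
  map_smul' c f := by
    rw [RingHom.id_apply, ← MemLp.toLp_const_smul]
    refine MemLp.toLp_congr _ _ ?_
    filter_upwards [ae_prod_fst (ν := ν) (Lp.coeFn_smul c f)] with p hp
    simp only [hp, Pi.smul_apply, smul_eq_mul, mul_assoc]

lemma coeFn_tensorLin {w : Z → ℂ} (hw : MemLp w 2 ν) (f : Lp ℂ 2 μ) :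
    tensorLin μ hw f =ᵐ[μ.prod ν] fun p => f p.1 * w p.2 :=
  (memLp_tensor (Lp.memLp f) hw).coeFn_toLp

variable [SFinite μ]

lemma inner_tensorLin {w w' : Z → ℂ} (hw : MemLp w 2 ν) (hw' : MemLp w' 2 ν)
    (f g : Lp ℂ 2 μ) :
    inner ℂ (tensorLin μ hw f) (tensorLin μ hw' g)
      = inner ℂ f g * ∫ z, conj (w z) * w' z ∂ν := by
  rw [L2.inner_def, L2.inner_def, ← integral_prod_mul]
  refine integral_congr_ae ?_
  filter_upwards [coeFn_tensorLin hw f, coeFn_tensorLin hw' g] with p hf hg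
  rw [hf, hg]
  simp only [RCLike.inner_apply, map_mul]
  ring

/-- The isometry `f ↦ f ⊗ v n`. -/
def IsONSystem.tensor (hv : IsONSystem ν v) (μ : Measure X) [SFinite μ] (n : ℕ) :
    Lp ℂ 2 μ →ₗᵢ[ℂ] Lp ℂ 2 (μ.prod ν) :=
  (tensorLin μ (hv.memLp n)).isometryOfInner fun f g => by
    rw [inner_tensorLin, hv.orthonormal]; simp

lemma IsONSystem.coeFn_tensor (hv : IsONSystem ν v) (n : ℕ) (f : Lp ℂ 2 μ) :
    hv.tensor μ n f =ᵐ[μ.prod ν] fun p => f p.1 * v n p.2 :=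
  coeFn_tensorLin (hv.memLp n) f

lemma IsONSystem.orthogonalFamily (hv : IsONSystem ν v) (μ : Measure X) [SFinite μ] :
    OrthogonalFamily ℂ (fun _ : ℕ => Lp ℂ 2 μ) (hv.tensor μ) := by
  intro n m hnm f g
  exact (inner_tensorLin (hv.memLp n) (hv.memLp m) f g).trans
    (by rw [hv.orthonormal, if_neg hnm, mul_zero])

/-- The isometry `(g n)_n ↦ ∑ g n ⊗ v n`. -/
def IsONSystem.synth (hv : IsONSystem ν v) (μ : Measure X) [SFinite μ] :
    lp (fun _ : ℕ => Lp ℂ 2 μ) 2 →ₗᵢ[ℂ] Lp ℂ 2 (μ.prod ν) :=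
  (hv.orthogonalFamily μ).linearIsometry

lemma IsONSystem.hasSum_synth (hv : IsONSystem ν v) (g : lp (fun _ : ℕ => Lp ℂ 2 μ) 2) :
    HasSum (fun n => hv.tensor μ n (g n)) (hv.synth μ g) :=
  (hv.orthogonalFamily μ).hasSum_linearIsometry g

/-- The adjoint of the isometry `synth`: the sequence of coefficients with respect to `v n`. -/
def IsONSystem.coeffs (hv : IsONSystem ν v) (μ : Measure X) [SFinite μ] :
    Lp ℂ 2 (μ.prod ν) →L[ℂ] lp (fun _ : ℕ => Lp ℂ 2 μ) 2 :=
  ContinuousLinearMap.adjoint (hv.synth μ).toContinuousLinearMap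

/-- The adjoint of the isometry `tensor n`. -/
def IsONSystem.coeff (hv : IsONSystem ν v) (μ : Measure X) [SFinite μ] (n : ℕ) :
    Lp ℂ 2 (μ.prod ν) →L[ℂ] Lp ℂ 2 μ :=
  ContinuousLinearMap.adjoint (hv.tensor μ n).toContinuousLinearMap

lemma IsONSystem.coeffs_apply (hv : IsONSystem ν v) (w : Lp ℂ 2 (μ.prod ν)) (n : ℕ) :
    hv.coeffs μ w n = hv.coeff μ n w := by
  refine ext_inner_left ℂ fun f : Lp ℂ 2 μ => ?_
  calc inner ℂ f (hv.coeffs μ w n)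
      = inner ℂ (lp.single 2 n f) (hv.coeffs μ w) :=
        (lp.inner_single_left (𝕜 := ℂ) (G := fun _ : ℕ => Lp ℂ 2 μ) n f (hv.coeffs μ w)).symm
    _ = inner ℂ (hv.synth μ (lp.single 2 n f)) w := by
        rw [IsONSystem.coeffs, ContinuousLinearMap.adjoint_inner_right]; rfl
    _ = inner ℂ (hv.tensor μ n f) w :=
        congrArg (inner ℂ · w) ((hv.orthogonalFamily μ).linearIsometry_apply_single f)
    _ = inner ℂ f (hv.coeff μ n w) := by
        rw [IsONSystem.coeff, ContinuousLinearMap.adjoint_inner_right]; rfl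

lemma IsONSystem.coeffs_synth (hv : IsONSystem ν v) (g : lp (fun _ : ℕ => Lp ℂ 2 μ) 2) :
    hv.coeffs μ (hv.synth μ g) = g := by
  refine ext_inner_left ℂ fun f => ?_
  rw [IsONSystem.coeffs, ContinuousLinearMap.adjoint_inner_right]
  exact (hv.synth μ).inner_map_map f g

lemma IsONSystem.norm_coeffs_le (hv : IsONSystem ν v) (w : Lp ℂ 2 (μ.prod ν)) :
    ‖hv.coeffs μ w‖ ≤ ‖w‖ := by
  have h : ‖hv.coeffs μ‖ ≤ 1 := by
    rw [IsONSystem.coeffs, LinearIsometryEquiv.norm_map]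
    exact (hv.synth μ).norm_toContinuousLinearMap_le
  simpa using (hv.coeffs μ).le_of_opNorm_le h w

lemma IsONSystem.inner_tensor (hv : IsONSystem ν v) (n : ℕ) (f : Lp ℂ 2 μ)
    (F : Lp ℂ 2 (μ.prod ν)) :
    inner ℂ (hv.tensor μ n f) F = ∫ x, (∫ z, conj (v n z) * F (x, z) ∂ν) * conj (f x) ∂μ := by
  rw [L2.inner_def, integral_prod _ (L2.integrable_inner _ _)]
  refine integral_congr_ae ?_
  filter_upwards [Measure.ae_ae_of_ae_prod (hv.coeFn_tensor n f)] with x hx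
  rw [← integral_mul_const]
  refine integral_congr_ae ?_
  filter_upwards [hx] with z hz
  rw [hz, RCLike.inner_apply, map_mul]
  ring

lemma IsONSystem.coeFn_coeff (hv : IsONSystem ν v) (n : ℕ) (F : Lp ℂ 2 (μ.prod ν)) :
    hv.coeff μ n F =ᵐ[μ] fun x => ∫ z, conj (v n z) * F (x, z) ∂ν := by
  have hmem := memLp_partialInner (hv.memLp n) (Lp.memLp F)
  suffices hv.coeff μ n F = hmem.toLp _ by rw [this]; exact hmem.coeFn_toLp
  refine ext_inner_left ℂ fun f => ?_
  rw [IsONSystem.coeff, ContinuousLinearMap.adjoint_inner_right]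
  refine (hv.inner_tensor n f F).trans ?_
  rw [L2.inner_def]
  refine integral_congr_ae ?_
  filter_upwards [hmem.coeFn_toLp] with x hx
  rw [hx, RCLike.inner_apply]

lemma IsONSystem.tensor_mul (hv : IsONSystem ν v) (a : Weight X) (n : ℕ) (f : Lp ℂ 2 μ) :
    hv.tensor μ n (a.mul μ f) = (a.fst Z).mul _ (hv.tensor μ n f) := by
  ext1
  filter_upwards [hv.coeFn_tensor n (a.mul μ f), (a.fst Z).coeFn_mul (hv.tensor μ n f),
    hv.coeFn_tensor n f, ae_prod_fst (ν := ν) (a.coeFn_mul f)] with p htensor_mul hmul htensor hf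
  rw [htensor_mul, hmul, htensor, hf, Weight.fst, mul_assoc]

lemma IsONSystem.synth_env (hv : IsONSystem ν v) (a : Weight X)
    (g : lp (fun _ : ℕ => Lp ℂ 2 μ) 2) :
    hv.synth μ (a.env μ g) = (a.fst Z).mul _ (hv.synth μ g) := by
  refine (hv.hasSum_synth (a.env μ g)).unique ?_
  simpa only [Weight.env_apply, hv.tensor_mul] using
    ((a.fst Z).mul (μ.prod ν)).hasSum (hv.hasSum_synth g)

lemma IsONSystem.coeffs_mul (hv : IsONSystem ν v) (a : Weight X) (F : Lp ℂ 2 (μ.prod ν)) :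
    hv.coeffs μ ((a.fst Z).mul _ F) = a.env μ (hv.coeffs μ F) := by
  ext1
  funext n
  rw [Weight.env_apply, hv.coeffs_apply, hv.coeffs_apply]
  ext1
  filter_upwards [hv.coeFn_coeff n ((a.fst Z).mul _ F), a.coeFn_mul (hv.coeff μ n F),
    hv.coeFn_coeff n F, Measure.ae_ae_of_ae_prod ((a.fst Z).coeFn_mul F)]
    with x hcoeff_mul hmul hcoeff hF
  rw [hcoeff_mul, hmul, hcoeff, ← integral_const_mul]
  refine integral_congr_ae ?_
  filter_upwards [hF] with z hz
  rw [hz, Weight.fst]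
  ring

lemma IsONSystem.norm_fst_mul_synth (hv : IsONSystem ν v) (a : Weight X)
    (g : lp (fun _ : ℕ => Lp ℂ 2 μ) 2) : ‖(a.fst Z).mul _ (hv.synth μ g)‖ = ‖a.env μ g‖ := by
  rw [← hv.synth_env, LinearIsometry.norm_map]

/-- The compression to coefficient sequences, with respect to the orthonormal system `v`, of an
operator on `L²(μ.prod ν)`. -/
def IsONSystem.compress (hv : IsONSystem ν v) (T : Lp ℂ 2 (μ.prod ν) →L[ℂ] Lp ℂ 2 (μ.prod ν)) :
    lp (fun _ : ℕ => Lp ℂ 2 μ) 2 →L[ℂ] lp (fun _ : ℕ => Lp ℂ 2 μ) 2 :=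
  (hv.coeffs μ).comp (T.comp (hv.synth μ).toContinuousLinearMap)

lemma IsONSystem.compress_apply (hv : IsONSystem ν v)
    (T : Lp ℂ 2 (μ.prod ν) →L[ℂ] Lp ℂ 2 (μ.prod ν)) (g : lp (fun _ : ℕ => Lp ℂ 2 μ) 2) :
    hv.compress T g = hv.coeffs μ (T (hv.synth μ g)) := rfl

end Tensor

/-! ### Uniqueness of integrable Fourier densities -/

lemma fourierConst_pos (d : ℕ) : 0 < fourierConst d := Real.rpow_pos_of_pos (by positivity) _

lemma integrable_planeWave_mul {w : Sp d → ℂ} {μ : Measure (Sp d)} (hw : Integrable w μ)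
    (x : Sp d) : Integrable (fun k => planeWave k x * w k) μ :=
  hw.bdd_mul (c := 1)
    (continuous_planeWave.comp (Continuous.prodMk_left x)).aestronglyMeasurable
    (ae_of_all _ fun k => (norm_planeWave k x).le)

lemma fourier_eq_integral_planeWave (u : Sp d → ℂ) (ξ : Sp d) :
    FourierTransform.fourier u ξ = ∫ k, planeWave k ((-(2 * Real.pi)) • ξ) * u k := by
  rw [Real.fourier_eq']
  refine integral_congr_ae (ae_of_all _ fun k => ?_)
  simp only [planeWave, smul_eq_mul, real_inner_smul_right]
  congr 2
  push_cast
  ring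

/-- Every test function is the Fourier transform of a Schwartz function, so the multiplication
formula turns the vanishing of `û` into the vanishing of `u` as a distribution. -/
theorem ae_eq_zero_of_fourier_eq_zero {u : Sp d → ℂ} (hu : Integrable u)
    (h : ∀ ξ, FourierTransform.fourier u ξ = 0) : u =ᵐ[volume] 0 := by
  refine ae_eq_zero_of_integral_contDiff_smul_eq_zero hu.locallyIntegrable fun φ hφ hc => ?_
  have hsupp : HasCompactSupport (Complex.ofRealCLM ∘ φ) := hc.comp_left rfl
  have hsmooth : ContDiff ℝ ∞ (Complex.ofRealCLM ∘ φ) := by fun_prop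
  set ψ : SchwartzMap (Sp d) ℂ := hsupp.toSchwartzMap hsmooth
  have hinv : FourierTransform.fourier (FourierTransformInv.fourierInv ψ) = ψ :=
    FourierTransform.fourier_fourierInv_eq ψ
  set χ : SchwartzMap (Sp d) ℂ := FourierTransformInv.fourierInv ψ
  have hu_fourier (ξ) :
      VectorFourier.fourierIntegral Real.fourierChar volume (innerₗ (Sp d)) u ξ = 0 := h ξ
  have hχ_fourier (x) :
      VectorFourier.fourierIntegral Real.fourierChar volume (innerₗ (Sp d)).flip χ x = φ x := by
    rw [flip_innerₗ]
    change FourierTransform.fourier (χ : Sp d → ℂ) x = _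
    rw [← SchwartzMap.fourier_coe, hinv]
    rfl
  have hmult := VectorFourier.integral_fourierIntegral_smul_eq_flip (L := innerₗ (Sp d))
    Real.continuous_fourierChar continuous_inner hu (χ.integrable (μ := volume))
  simp only [hu_fourier, hχ_fourier, zero_smul, integral_zero] at hmult
  rw [hmult]
  refine integral_congr_ae (ae_of_all _ fun x => ?_)
  simp [mul_comm]

lemma HasFourierL1.ae_eq {f w w' : Sp d → ℂ} (h : HasFourierL1 f w) (h' : HasFourierL1 f w') :
    w =ᵐ[volume] w' := by
  have hsub : w - w' =ᵐ[volume] 0 := by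
    refine ae_eq_zero_of_fourier_eq_zero (h.1.sub h'.1) fun ξ => ?_
    have hne : (fourierConst d : ℂ) ≠ 0 := by exact_mod_cast (fourierConst_pos d).ne'
    have heq := mul_left_cancel₀ hne ((h.2 ((-(2 * Real.pi)) • ξ)).symm.trans (h'.2 _))
    rw [fourier_eq_integral_planeWave]
    simp only [Pi.sub_apply, mul_sub]
    rw [integral_sub (integrable_planeWave_mul h.1 _) (integrable_planeWave_mul h'.1 _), heq,
      sub_self]
  filter_upwards [hsub] with k hk
  exact sub_eq_zero.1 hk

/-! ### The truncated weight -/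

/-- The truncated Sobolev weight `min ((1 + |k|²)^{μ/2}, R)`. The truncation keeps multiplication
by it bounded on `L²`. -/
def kpWeight (d : ℕ) (μ R : ℝ) (hR : 0 < R) : Weight (Sp d) where
  toFun k := min ((1 + ‖k‖ ^ 2) ^ (μ / 2)) R
  meas := by fun_prop
  bound := R
  bound_nonneg := hR.le
  abs_le k := by
    rw [abs_of_nonneg (le_min (by positivity) hR.le)]
    exact min_le_right _ _

/-- The weight `a` is positive and moderate with respect to `(1 + |k|)^μ`. -/
structure Weight.IsModerate (a : Weight (Sp d)) (μ : ℝ) : Prop where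
  pos : ∀ k, 0 < a.toFun k
  le_mul : ∀ k k', a.toFun k ≤ (1 + ‖k - k'‖) ^ μ * a.toFun k'

lemma one_add_norm_sq_le {E : Type*} [SeminormedAddCommGroup E] (k k' : E) :
    1 + ‖k‖ ^ 2 ≤ (1 + ‖k - k'‖) ^ 2 * (1 + ‖k'‖ ^ 2) := by
  have htri : ‖k‖ ≤ ‖k - k'‖ + ‖k'‖ := by simpa using norm_add_le (k - k') k'
  have hsq : ‖k‖ ^ 2 ≤ (‖k - k'‖ + ‖k'‖) ^ 2 := pow_le_pow_left₀ (norm_nonneg k) htri 2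
  have hs := norm_nonneg (k - k')
  nlinarith [mul_nonneg hs (sq_nonneg (‖k'‖ - 1)), mul_nonneg hs (sq_nonneg ‖k'‖),
    mul_nonneg (sq_nonneg ‖k - k'‖) (sq_nonneg ‖k'‖)]

lemma rpow_one_add_norm_sq_le {E : Type*} [SeminormedAddCommGroup E] {μ : ℝ} (hμ : 0 ≤ μ)
    (k k' : E) :
    (1 + ‖k‖ ^ 2) ^ (μ / 2) ≤ (1 + ‖k - k'‖) ^ μ * (1 + ‖k'‖ ^ 2) ^ (μ / 2) := by
  refine (Real.rpow_le_rpow (by positivity) (one_add_norm_sq_le k k')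
    (by positivity)).trans_eq ?_
  rw [Real.mul_rpow (by positivity) (by positivity), ← Real.rpow_natCast,
    ← Real.rpow_mul (by positivity)]
  congr 2
  push_cast
  ring

lemma isModerate_kpWeight {μ R : ℝ} (hμ : 0 ≤ μ) (hR : 0 < R) :
    (kpWeight d μ R hR).IsModerate μ where
  pos k := lt_min (by positivity) hR
  le_mul k k' := by
    have hone : 1 ≤ (1 + ‖k - k'‖) ^ μ :=
      Real.one_le_rpow (by linarith [norm_nonneg (k - k')]) hμ
    simp only [kpWeight]
    rcases le_total ((1 + ‖k'‖ ^ 2) ^ (μ / 2)) R with h | h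
    · rw [min_eq_left h]
      exact (min_le_left _ _).trans (rpow_one_add_norm_sq_le hμ k k')
    · rw [min_eq_right h]
      exact (min_le_right _ _).trans (le_mul_of_one_le_left hR.le hone)

lemma rpow_le_kpWeight {μ s : ℝ} (hμ : 0 ≤ μ) (hs : 0 < s) {k : Sp d} (hk : s ≤ ‖k‖) :
    s ^ μ ≤ (kpWeight d μ (s ^ μ) (Real.rpow_pos_of_pos hs μ)).toFun k := by
  refine le_min ?_ le_rfl
  have hsq : s ^ 2 ≤ 1 + ‖k‖ ^ 2 := by
    have := pow_le_pow_left₀ hs.le hk 2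
    linarith
  calc s ^ μ = (s ^ 2) ^ (μ / 2) := by
        rw [← Real.rpow_natCast, ← Real.rpow_mul hs.le]; congr 1; push_cast; ring
    _ ≤ _ := Real.rpow_le_rpow (by positivity) hsq (by positivity)

/-! ### The kernels of the potential -/

/-- The integrand `(2π)^{-d/2} (1 + |k|)^μ |V̂(k, z)|` of the `𝓦_μ`-norm; it dominates all the
integral kernels below. -/
def majorant (μ : ℝ) (Vhat : Sp d → Sp d → ℂ) (k z : Sp d) : ℝ≥0∞ :=
  ENNReal.ofReal (fourierConst d) * (ENNReal.ofReal ((1 + ‖k‖) ^ μ) * ‖Vhat k z‖ₑ)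

/-- `Vhat` is the partial Fourier transform of `V`, with `𝓦_μ`-norm at most `c`. -/
structure IsPotHat (L : Matrix (Fin d) (Fin d) ℝ) (μ c : ℝ) (V : Sp d → Sp d → ℝ)
    (Vhat : Sp d → Sp d → ℂ) : Prop where
  mu_nonneg : 0 ≤ μ
  nonneg : 0 ≤ c
  meas : Measurable (Function.uncurry Vhat)
  fourier : ∀ᵐ z ∂(volume.restrict (cell L)),
    HasFourierL1 (fun x => (V x z : ℂ)) (fun k => Vhat k z)
  mass : ∀ᵐ z ∂(volume.restrict (cell L)), ∫⁻ k, majorant μ Vhat k z ≤ ENNReal.ofReal c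

lemma MemW.exists_isPotHat {L : Matrix (Fin d) (Fin d) ℝ} {μ : ℝ} (hμ : 0 ≤ μ)
    {V : Sp d → Sp d → ℝ} (hV : MemW L μ V) : ∃ c Vhat, IsPotHat L μ c V Vhat := by
  obtain ⟨Vhat, hm, hF, hlt⟩ := hV.norm_lt_top
  refine ⟨(normW L μ Vhat).toReal, Vhat, hμ, ENNReal.toReal_nonneg, hm,
    ae_restrict_of_ae hF, ?_⟩
  rw [ENNReal.ofReal_toReal hlt.ne]
  filter_upwards [ENNReal.ae_le_essSup (μ := volume.restrict (cell L))
    (fun z => ∫⁻ k : Sp d, ENNReal.ofReal ((1 + ‖k‖) ^ μ) * ‖Vhat k z‖ₑ)] with z hz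
  simp only [majorant]
  rw [lintegral_const_mul' _ _ ENNReal.ofReal_ne_top, normW]
  gcongr

section Kernels

variable {L : Matrix (Fin d) (Fin d) ℝ} {μ c : ℝ} {V : Sp d → Sp d → ℝ} {Vhat : Sp d → Sp d → ℂ}

lemma IsPotHat.measurable_majorant (h : IsPotHat L μ c V Vhat) :
    Measurable fun p : Sp d × Sp d => majorant μ Vhat p.1 p.2 := by
  have hVhat : Measurable fun p : Sp d × Sp d => Vhat p.1 p.2 := h.meas
  unfold majorant
  fun_prop

lemma IsPotHat.enorm_fourierConst_mul_le (h : IsPotHat L μ c V Vhat) (k z : Sp d) :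
    ‖(fourierConst d : ℂ) * Vhat k z‖ₑ ≤ majorant μ Vhat k z := by
  have hone : ENNReal.ofReal 1 ≤ ENNReal.ofReal ((1 + ‖k‖) ^ μ) :=
    ENNReal.ofReal_le_ofReal (Real.one_le_rpow (by linarith [norm_nonneg k]) h.mu_nonneg)
  rw [enorm_mul, majorant]
  gcongr
  · rw [← ofReal_norm, Complex.norm_real, Real.norm_of_nonneg (fourierConst_pos d).le]
  · exact le_mul_of_one_le_left' (by simpa using hone)

lemma enorm_weighted_le (k z : Sp d) {a b : ℝ} (ha : 0 ≤ a) (hb : 0 < b)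
    (hab : a ≤ (1 + ‖k‖) ^ μ * b) :
    ‖(a : ℂ) * ((fourierConst d : ℂ) * Vhat k z) / (b : ℂ)‖ₑ ≤ majorant μ Vhat k z := by
  have hnorm : ‖(a : ℂ) * ((fourierConst d : ℂ) * Vhat k z) / (b : ℂ)‖
      = fourierConst d * (a / b * ‖Vhat k z‖) := by
    rw [norm_div, norm_mul, norm_mul, Complex.norm_real, Complex.norm_real, Complex.norm_real,
      Real.norm_of_nonneg ha, Real.norm_of_nonneg hb.le,
      Real.norm_of_nonneg (fourierConst_pos d).le]
    ring
  rw [← ofReal_norm, hnorm, ENNReal.ofReal_mul (fourierConst_pos d).le,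
    ENNReal.ofReal_mul (by positivity), ofReal_norm, majorant]
  gcongr
  rwa [div_le_iff₀ hb]

/-- The convolution kernel of `𝓤⁰`, transported to `L²(ℝ^d × 𝓒)`. -/
def kernel0 (Vhat : Sp d → Sp d → ℂ) (x y z : Sp d) : ℂ :=
  (fourierConst d : ℂ) * Vhat (x - y) z

lemma IsPotHat.measurable_kernel0 (h : IsPotHat L μ c V Vhat) :
    Measurable fun p : Sp d × Sp d × Sp d => kernel0 Vhat p.1 p.2.1 p.2.2 := by
  exact measurable_const.mul
    (h.meas.comp (by fun_prop : Measurable fun p : Sp d × Sp d × Sp d => (p.1 - p.2.1, p.2.2)))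

lemma IsPotHat.isSchur_of_le (h : IsPotHat L μ c V Vhat) {κ : Sp d → Sp d → Sp d → ℂ}
    (hm : Measurable fun p : Sp d × Sp d × Sp d => κ p.1 p.2.1 p.2.2)
    (hle : ∀ x y z, ‖κ x y z‖ₑ ≤ majorant μ Vhat (x - y) z) :
    IsSchur volume (volume.restrict (cell L)) κ c where
  nonneg := h.nonneg
  meas := hm
  left := by
    filter_upwards [h.mass] with z hz x
    refine (lintegral_mono fun y => hle x y z).trans ?_
    rwa [lintegral_sub_left_eq_self (fun k => majorant μ Vhat k z) x]
  right := by
    filter_upwards [h.mass] with z hz y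
    refine (lintegral_mono fun x => hle x y z).trans ?_
    rwa [lintegral_sub_right_eq_self (fun k => majorant μ Vhat k z) y]

lemma IsPotHat.isSchur_kernel0 (h : IsPotHat L μ c V Vhat) :
    IsSchur volume (volume.restrict (cell L)) (kernel0 Vhat) c :=
  h.isSchur_of_le h.measurable_kernel0 fun _ _ _ => h.enorm_fourierConst_mul_le _ _

/-- The kernel of `𝓤⁰` conjugated with the weight. -/
def kernel0Weighted (Vhat : Sp d → Sp d → ℂ) (a : Weight (Sp d)) (x y z : Sp d) : ℂ :=
  (a.toFun x : ℂ) * kernel0 Vhat x y z / (a.toFun y : ℂ)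

lemma IsPotHat.isSchur_kernel0Weighted (h : IsPotHat L μ c V Vhat) {a : Weight (Sp d)}
    (ha : a.IsModerate μ) :
    IsSchur volume (volume.restrict (cell L)) (kernel0Weighted Vhat a) c := by
  refine h.isSchur_of_le ?_ fun x y z =>
    enorm_weighted_le _ _ (ha.pos x).le (ha.pos y) (ha.le_mul x y)
  have hkernel := h.measurable_kernel0
  have hweight := a.meas
  unfold kernel0Weighted
  fun_prop

lemma IsPotHat.norm_weight_op0_le (h : IsPotHat L μ c V Vhat) {a : Weight (Sp d)}
    (ha : a.IsModerate μ)
    (u : Lp ℂ 2 ((volume : Measure (Sp d)).prod (volume.restrict (cell L)))) :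
    ‖(a.fst (Sp d)).mul _ (h.isSchur_kernel0.op u)‖ ≤ c * ‖(a.fst (Sp d)).mul _ u‖ := by
  rw [h.isSchur_kernel0.mul_op (h.isSchur_kernel0Weighted ha) a a]
  · exact IsSchur.norm_op_apply_le _ _
  · intro x y z
    rw [kernel0Weighted, div_mul_cancel₀ _ (by exact_mod_cast (ha.pos y).ne')]

end Kernels

/-! ### The kernel of the exact potential operator -/

section Alias

variable {L M : Matrix (Fin d) (Fin d) ℝ} {μ c ε : ℝ} {V : Sp d → Sp d → ℝ}
  {Vhat : Sp d → Sp d → ℂ}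

/-- The terms of the periodization of `V̂`, twisted by the Bloch phases. -/
def aliasTerm (M : Matrix (Fin d) (Fin d) ℝ) (ε : ℝ) (Vhat : Sp d → Sp d → ℂ) (x y z : Sp d)
    (m : Fin d → ℤ) : ℂ :=
  planeWave (latVec M m) (ε • z) * Vhat (x + latVec M m - y) z

/-- The kernel of the exact potential operator `𝓤^ε`; `M` generates the lattice `ε⁻¹ 𝓛*`. -/
def kernelEps (M : Matrix (Fin d) (Fin d) ℝ) (ε : ℝ) (Vhat : Sp d → Sp d → ℂ) (x y z : Sp d) : ℂ :=
  (cell M).indicator 1 x * (cell M).indicator 1 y *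
    ((fourierConst d : ℂ) * ∫ m, aliasTerm M ε Vhat x y z m ∂Measure.count)

/-- The periodization of the majorant. -/
def majorantSum (M : Matrix (Fin d) (Fin d) ℝ) (μ : ℝ) (Vhat : Sp d → Sp d → ℂ) (x y z : Sp d) :
    ℝ≥0∞ :=
  (cell M).indicator 1 x * (cell M).indicator 1 y *
    ∑' m : Fin d → ℤ, majorant μ Vhat (x + latVec M m - y) z

lemma IsPotHat.measurable_aliasTerm (h : IsPotHat L μ c V Vhat) (M : Matrix (Fin d) (Fin d) ℝ)
    (ε : ℝ) : Measurable fun q : (Sp d × Sp d × Sp d) × (Fin d → ℤ) =>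
      aliasTerm M ε Vhat q.1.1 q.1.2.1 q.1.2.2 q.2 := by
  have hlat : Measurable fun q : (Sp d × Sp d × Sp d) × (Fin d → ℤ) => latVec M q.2 :=
    (measurable_of_countable (latVec M)).comp measurable_snd
  have hwave := continuous_planeWave.measurable.comp (by fun_prop :
    Measurable fun q : (Sp d × Sp d × Sp d) × (Fin d → ℤ) => (latVec M q.2, ε • q.1.2.2))
  have hVhat := h.meas.comp (by fun_prop :
    Measurable fun q : (Sp d × Sp d × Sp d) × (Fin d → ℤ) =>
      (q.1.1 + latVec M q.2 - q.1.2.1, q.1.2.2))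
  exact hwave.mul hVhat

lemma IsPotHat.measurable_kernelEps (h : IsPotHat L μ c V Vhat) (M : Matrix (Fin d) (Fin d) ℝ)
    (ε : ℝ) : Measurable fun p : Sp d × Sp d × Sp d => kernelEps M ε Vhat p.1 p.2.1 p.2.2 := by
  have hsum := ((h.measurable_aliasTerm M ε).stronglyMeasurable.integral_prod_right'
    (ν := Measure.count)).measurable
  have hcell : Measurable ((cell M).indicator (1 : Sp d → ℂ)) :=
    measurable_one.indicator (measurableSet_cell M)
  exact ((hcell.comp measurable_fst).mul (hcell.comp (measurable_fst.comp measurable_snd))).mul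
    (measurable_const.mul hsum)

lemma IsPotHat.measurable_majorant_left (h : IsPotHat L μ c V Vhat) (z : Sp d) :
    Measurable fun k => majorant μ Vhat k z := by
  have hmeas := h.measurable_majorant.comp (by fun_prop : Measurable fun k : Sp d => (k, z))
  simpa only [Function.comp_def] using hmeas

lemma lintegral_indicator_cell_tsum (hM : M.det ≠ 0) {F : Sp d → ℝ≥0∞} (hF : Measurable F) :
    ∫⁻ x, (cell M).indicator (fun x => ∑' m : Fin d → ℤ, F (x + latVec M m)) x = ∫⁻ x, F x := by
  rw [lintegral_indicator (measurableSet_cell M), lintegral_tsum, lintegral_eq_tsum_cell hM F]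
  exact fun m => (hF.comp (by fun_prop)).aemeasurable

lemma majorantSum_eq (M : Matrix (Fin d) (Fin d) ℝ) (x y z : Sp d) :
    majorantSum M μ Vhat x y z = (cell M).indicator 1 x * (cell M).indicator 1 y *
      ∑' m : Fin d → ℤ, majorant μ Vhat (x - (y + latVec M m)) z := by
  rw [majorantSum, ← (Equiv.neg (Fin d → ℤ)).tsum_eq]
  congr 1
  refine tsum_congr fun m => ?_
  rw [Equiv.neg_apply, latVec_neg]
  congr 1
  abel

lemma IsPotHat.lintegral_majorantSum_left (h : IsPotHat L μ c V Vhat) (hM : M.det ≠ 0)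
    (y z : Sp d) : ∫⁻ x, majorantSum M μ Vhat x y z ≤ ∫⁻ k, majorant μ Vhat k z := by
  calc ∫⁻ x, majorantSum M μ Vhat x y z
      ≤ ∫⁻ x, (cell M).indicator
          (fun x => ∑' m : Fin d → ℤ, majorant μ Vhat (x + latVec M m - y) z) x := by
        refine lintegral_mono fun x => ?_
        by_cases hx : x ∈ cell M <;> by_cases hy : y ∈ cell M <;> simp [majorantSum, hx, hy]
    _ = ∫⁻ k, majorant μ Vhat k z := by
        rw [lintegral_indicator_cell_tsum hM (F := fun x => majorant μ Vhat (x - y) z)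
          ((h.measurable_majorant_left z).comp (by fun_prop)),
          lintegral_sub_right_eq_self (fun k => majorant μ Vhat k z) y]

lemma IsPotHat.lintegral_majorantSum_right (h : IsPotHat L μ c V Vhat) (hM : M.det ≠ 0)
    (x z : Sp d) : ∫⁻ y, majorantSum M μ Vhat x y z ≤ ∫⁻ k, majorant μ Vhat k z := by
  calc ∫⁻ y, majorantSum M μ Vhat x y z
      ≤ ∫⁻ y, (cell M).indicator
          (fun y => ∑' m : Fin d → ℤ, majorant μ Vhat (x - (y + latVec M m)) z) y := by
        refine lintegral_mono fun y => ?_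
        rw [majorantSum_eq]
        by_cases hx : x ∈ cell M <;> by_cases hy : y ∈ cell M <;> simp [hx, hy]
    _ = ∫⁻ k, majorant μ Vhat k z := by
        rw [lintegral_indicator_cell_tsum hM (F := fun y => majorant μ Vhat (x - y) z)
          ((h.measurable_majorant_left z).comp (by fun_prop)),
          lintegral_sub_left_eq_self (fun k => majorant μ Vhat k z) x]

lemma kernelEps_of_notMem {x y : Sp d} (hxy : x ∉ cell M ∨ y ∉ cell M) (z : Sp d) :
    kernelEps M ε Vhat x y z = 0 := by
  rcases hxy with hx | hy
  · simp [kernelEps, hx]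
  · simp [kernelEps, hy]

lemma kernelEps_of_mem {x y : Sp d} (hx : x ∈ cell M) (hy : y ∈ cell M) (z : Sp d) :
    kernelEps M ε Vhat x y z
      = (fourierConst d : ℂ) * ∫ m, aliasTerm M ε Vhat x y z m ∂Measure.count := by
  simp [kernelEps, hx, hy]

lemma majorantSum_of_mem {x y : Sp d} (hx : x ∈ cell M) (hy : y ∈ cell M) (z : Sp d) :
    majorantSum M μ Vhat x y z = ∑' m : Fin d → ℤ, majorant μ Vhat (x + latVec M m - y) z := by
  simp [majorantSum, hx, hy]

lemma IsPotHat.enorm_fourierConst_mul_aliasTerm_le (h : IsPotHat L μ c V Vhat) (x y z : Sp d)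
    (m : Fin d → ℤ) : ‖(fourierConst d : ℂ) * aliasTerm M ε Vhat x y z m‖ₑ
      ≤ majorant μ Vhat (x + latVec M m - y) z := by
  rw [aliasTerm, mul_left_comm, enorm_mul, enorm_planeWave, one_mul]
  exact h.enorm_fourierConst_mul_le _ _

lemma IsPotHat.enorm_kernelEps_le (h : IsPotHat L μ c V Vhat) (x y z : Sp d) :
    ‖kernelEps M ε Vhat x y z‖ₑ ≤ majorantSum M μ Vhat x y z := by
  by_cases hxy : x ∈ cell M ∧ y ∈ cell M
  · rw [kernelEps_of_mem hxy.1 hxy.2, majorantSum_of_mem hxy.1 hxy.2, ← integral_const_mul,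
      ← lintegral_count]
    exact (enorm_integral_le_lintegral_enorm _).trans
      (lintegral_mono fun m => h.enorm_fourierConst_mul_aliasTerm_le x y z m)
  · rw [kernelEps_of_notMem (not_and_or.1 hxy), enorm_zero]
    exact zero_le

lemma IsPotHat.isSchur_kernelEps (h : IsPotHat L μ c V Vhat) (hM : M.det ≠ 0) (ε : ℝ) :
    IsSchur volume (volume.restrict (cell L)) (kernelEps M ε Vhat) c where
  nonneg := h.nonneg
  meas := h.measurable_kernelEps M ε
  left := by
    filter_upwards [h.mass] with z hz x
    exact (lintegral_mono fun y => h.enorm_kernelEps_le x y z).trans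
      ((h.lintegral_majorantSum_right hM x z).trans hz)
  right := by
    filter_upwards [h.mass] with z hz y
    exact (lintegral_mono fun x => h.enorm_kernelEps_le x y z).trans
      ((h.lintegral_majorantSum_left hM y z).trans hz)

/-- The difference of the kernels of `𝓤^ε` and `𝓤⁰`, divided by a weight in the second variable. -/
def kernelDiff (M : Matrix (Fin d) (Fin d) ℝ) (ε : ℝ) (Vhat : Sp d → Sp d → ℂ)
    (a : Weight (Sp d)) (x y z : Sp d) : ℂ :=
  (kernelEps M ε Vhat x y z - kernel0 Vhat x y z) / (a.toFun y : ℂ)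

lemma enorm_div_le (k z : Sp d) {R b : ℝ} (hR : 0 < R) (hb : 0 < b)
    (hab : R ≤ (1 + ‖k‖) ^ μ * b) :
    ‖(fourierConst d : ℂ) * Vhat k z / (b : ℂ)‖ₑ ≤ ENNReal.ofReal R⁻¹ * majorant μ Vhat k z := by
  have hR0 : (R : ℂ) ≠ 0 := by exact_mod_cast hR.ne'
  have hfactor : (fourierConst d : ℂ) * Vhat k z / (b : ℂ)
      = ((R⁻¹ : ℝ) : ℂ) * ((R : ℂ) * ((fourierConst d : ℂ) * Vhat k z) / (b : ℂ)) := by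
    push_cast; field_simp
  rw [hfactor, enorm_mul, ← ofReal_norm ((R⁻¹ : ℝ) : ℂ), Complex.norm_real,
    Real.norm_of_nonneg (inv_nonneg.2 hR.le)]
  gcongr
  exact enorm_weighted_le k z hR.le hb hab

lemma IsPotHat.integrable_aliasTerm (h : IsPotHat L μ c V Vhat) {x y z : Sp d} (hx : x ∈ cell M)
    (hy : y ∈ cell M) (hfin : majorantSum M μ Vhat x y z ≠ ⊤) :
    Integrable (aliasTerm M ε Vhat x y z) Measure.count := by
  have hc : (fourierConst d : ℂ) ≠ 0 := by exact_mod_cast (fourierConst_pos d).ne'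
  refine (integrable_const_mul_iff (IsUnit.mk0 _ hc) _).1
    ⟨(measurable_of_countable _).aestronglyMeasurable, ?_⟩
  rw [hasFiniteIntegral_iff_enorm, lintegral_count]
  refine (ENNReal.tsum_le_tsum fun m => h.enorm_fourierConst_mul_aliasTerm_le x y z m).trans_lt ?_
  rwa [← majorantSum_of_mem hx hy, lt_top_iff_ne_top]

lemma kernelDiff_of_mem {a : Weight (Sp d)} {x y z : Sp d} (hx : x ∈ cell M) (hy : y ∈ cell M)
    (hint : Integrable (aliasTerm M ε Vhat x y z) Measure.count) :
    kernelDiff M ε Vhat a x y z = ∫ m in {(0 : Fin d → ℤ)}ᶜ,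
      (fourierConst d : ℂ) * aliasTerm M ε Vhat x y z m / (a.toFun y : ℂ) ∂Measure.count := by
  have hzero : ∫ m in {(0 : Fin d → ℤ)}, aliasTerm M ε Vhat x y z m ∂Measure.count
      = Vhat (x - y) z := by
    rw [integral_singleton]
    simp [aliasTerm, latVec_zero, planeWave, measureReal_def]
  rw [integral_div, integral_const_mul, kernelDiff, kernelEps_of_mem hx hy, kernel0,
    ← integral_add_compl (measurableSet_singleton (0 : Fin d → ℤ)) hint, hzero]
  ring

lemma IsPotHat.enorm_kernelDiff_le_of_mem (h : IsPotHat L μ c V Vhat) (hM : M.det ≠ 0)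
    {a : Weight (Sp d)} (ha : a.IsModerate μ) {R : ℝ} (hR : 0 < R)
    (hRa : ∀ k ∉ interior (cell M), R ≤ a.toFun k) {x y : Sp d} (hx : x ∈ cell M)
    (hy : y ∈ cell M) (z : Sp d) :
    ‖kernelDiff M ε Vhat a x y z‖ₑ ≤ ENNReal.ofReal R⁻¹ * majorantSum M μ Vhat x y z := by
  by_cases hfin : majorantSum M μ Vhat x y z = ⊤
  · rw [hfin, ENNReal.mul_top (by simpa using hR)]
    exact le_top
  rw [kernelDiff_of_mem hx hy (h.integrable_aliasTerm hx hy hfin)]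
  calc ‖∫ m in {(0 : Fin d → ℤ)}ᶜ,
        (fourierConst d : ℂ) * aliasTerm M ε Vhat x y z m / (a.toFun y : ℂ) ∂Measure.count‖ₑ
      ≤ ∫⁻ m in {(0 : Fin d → ℤ)}ᶜ,
        ‖(fourierConst d : ℂ) * aliasTerm M ε Vhat x y z m / (a.toFun y : ℂ)‖ₑ ∂Measure.count :=
        enorm_integral_le_lintegral_enorm _
    _ ≤ ∫⁻ m in {(0 : Fin d → ℤ)}ᶜ,
          ENNReal.ofReal R⁻¹ * majorant μ Vhat (x + latVec M m - y) z ∂Measure.count := by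
        refine setLIntegral_mono (measurable_of_countable _) fun m hm => ?_
        rw [aliasTerm, mul_left_comm, mul_div_assoc, enorm_mul, enorm_planeWave, one_mul]
        exact enorm_div_le (μ := μ) _ z hR (ha.pos y) ((hRa _
          (add_latVec_notMem_interior_cell hM hx hm)).trans (ha.le_mul _ y))
    _ ≤ ∫⁻ m, ENNReal.ofReal R⁻¹ * majorant μ Vhat (x + latVec M m - y) z ∂Measure.count :=
        setLIntegral_le_lintegral _ _
    _ = ENNReal.ofReal R⁻¹ * majorantSum M μ Vhat x y z := by
        rw [lintegral_count, ENNReal.tsum_mul_left, majorantSum_of_mem hx hy]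

lemma IsPotHat.enorm_kernelDiff_le_of_notMem (h : IsPotHat L μ c V Vhat) {a : Weight (Sp d)}
    (ha : a.IsModerate μ) {R : ℝ} (hR : 0 < R) (hRa : ∀ k ∉ interior (cell M), R ≤ a.toFun k)
    {x y : Sp d} (hxy : x ∉ cell M ∨ y ∉ cell M) (z : Sp d) :
    ‖kernelDiff M ε Vhat a x y z‖ₑ ≤ ENNReal.ofReal R⁻¹ * majorant μ Vhat (x - y) z := by
  rw [kernelDiff, kernelEps_of_notMem hxy, zero_sub, neg_div, enorm_neg]
  refine enorm_div_le (μ := μ) (x - y) z hR (ha.pos y) ?_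
  rcases hxy with hx | hy
  · exact (hRa x fun hx' => hx (interior_subset hx')).trans (ha.le_mul x y)
  · exact (hRa y fun hy' => hy (interior_subset hy')).trans (le_mul_of_one_le_left (ha.pos y).le
      (Real.one_le_rpow (by linarith [norm_nonneg (x - y)]) h.mu_nonneg))

lemma IsPotHat.enorm_kernelDiff_le (h : IsPotHat L μ c V Vhat) (hM : M.det ≠ 0)
    {a : Weight (Sp d)} (ha : a.IsModerate μ) {R : ℝ} (hR : 0 < R)
    (hRa : ∀ k ∉ interior (cell M), R ≤ a.toFun k) (x y z : Sp d) :
    ‖kernelDiff M ε Vhat a x y z‖ₑ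
      ≤ ENNReal.ofReal R⁻¹ * (majorantSum M μ Vhat x y z + majorant μ Vhat (x - y) z) := by
  by_cases hxy : x ∈ cell M ∧ y ∈ cell M
  · refine (h.enorm_kernelDiff_le_of_mem hM ha hR hRa hxy.1 hxy.2 z).trans ?_
    gcongr
    exact le_self_add
  · refine (h.enorm_kernelDiff_le_of_notMem ha hR hRa (not_and_or.1 hxy) z).trans ?_
    gcongr
    exact le_add_self

lemma IsPotHat.isSchur_kernelDiff (h : IsPotHat L μ c V Vhat) (hM : M.det ≠ 0) (ε : ℝ)
    {a : Weight (Sp d)} (ha : a.IsModerate μ) {R : ℝ} (hR : 0 < R)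
    (hRa : ∀ k ∉ interior (cell M), R ≤ a.toFun k) :
    IsSchur volume (volume.restrict (cell L)) (kernelDiff M ε Vhat a) (R⁻¹ * (c + c)) where
  nonneg := mul_nonneg (inv_nonneg.2 hR.le) (add_nonneg h.nonneg h.nonneg)
  meas := by
    have hkernelEps := h.measurable_kernelEps M ε
    have hkernel0 := h.measurable_kernel0
    have hweight := a.meas
    unfold kernelDiff
    fun_prop
  left := by
    filter_upwards [h.mass] with z hz x
    refine (lintegral_mono fun y => h.enorm_kernelDiff_le hM ha hR hRa x y z).trans ?_
    have hmeas : Measurable fun y => majorant μ Vhat (x - y) z :=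
      (h.measurable_majorant_left z).comp (by fun_prop)
    rw [lintegral_const_mul' _ _ ENNReal.ofReal_ne_top, lintegral_add_right _ hmeas,
      lintegral_sub_left_eq_self (fun k => majorant μ Vhat k z) x,
      ENNReal.ofReal_mul (inv_nonneg.2 hR.le), ENNReal.ofReal_add h.nonneg h.nonneg]
    gcongr
    exact (h.lintegral_majorantSum_right hM x z).trans hz
  right := by
    filter_upwards [h.mass] with z hz y
    refine (lintegral_mono fun x => h.enorm_kernelDiff_le hM ha hR hRa x y z).trans ?_
    have hmeas : Measurable fun x => majorant μ Vhat (x - y) z :=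
      (h.measurable_majorant_left z).comp (by fun_prop)
    rw [lintegral_const_mul' _ _ ENNReal.ofReal_ne_top, lintegral_add_right _ hmeas,
      lintegral_sub_right_eq_self (fun k => majorant μ Vhat k z) y,
      ENNReal.ofReal_mul (inv_nonneg.2 hR.le), ENNReal.ofReal_add h.nonneg h.nonneg]
    gcongr
    exact (h.lintegral_majorantSum_left hM y z).trans hz

lemma IsPotHat.norm_opEps_sub_op0_le (h : IsPotHat L μ c V Vhat) (hM : M.det ≠ 0) (ε : ℝ)
    {a : Weight (Sp d)} (ha : a.IsModerate μ) {R : ℝ} (hR : 0 < R)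
    (hRa : ∀ k ∉ interior (cell M), R ≤ a.toFun k)
    (u : Lp ℂ 2 ((volume : Measure (Sp d)).prod (volume.restrict (cell L)))) :
    ‖(h.isSchur_kernelEps hM ε).op u - h.isSchur_kernel0.op u‖
      ≤ R⁻¹ * (c + c) * ‖(a.fst (Sp d)).mul _ u‖ := by
  rw [IsSchur.op_sub, IsSchur.op_eq_op_mul _ (h.isSchur_kernelDiff hM ε ha hR hRa) a]
  · exact IsSchur.norm_op_apply_le _ _
  · intro x y z
    rw [kernelDiff, div_mul_cancel₀ _ (by exact_mod_cast (ha.pos y).ne')]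

end Alias

/-! ### The operator `𝓤⁰` in terms of its Schur kernel -/

section Swap

variable {X Z : Type*} [MeasurableSpace X] [MeasurableSpace Z] {μ : Measure X} {ν : Measure Z}
  [SFinite μ] [SFinite ν] {κ : X → X → Z → ℂ} {A : ℝ}

lemma IsSchur.ae_sq_lintegral_lt_top (hκ : IsSchur μ ν κ A) {u : X × Z → ℂ} (hu : Measurable u)
    (hu2 : MemLp u 2 (μ.prod ν)) :
    ∀ᵐ x ∂μ, ∫⁻ z, (∫⁻ y, ‖κ x y z‖ₑ * ‖u (y, z)‖ₑ ∂μ) ^ 2 ∂ν < ⊤ := by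
  have hmeas : Measurable fun p : X × Z => (∫⁻ y, ‖κ p.1 y p.2‖ₑ * ‖u (y, p.2)‖ₑ ∂μ) ^ 2 :=
    (hκ.measurable_kernel.enorm.mul (hu.comp (by fun_prop : Measurable
      fun q : (X × Z) × X => (q.2, q.1.2))).enorm).lintegral_prod_right'.pow_const 2
  have hfin := hκ.lintegral_le (f := fun p => ‖u p‖ₑ) hu.enorm
  rw [← sq_eLpNorm_two, lintegral_prod _ hmeas.aemeasurable] at hfin
  exact ae_lt_top' hmeas.lintegral_prod_right'.aemeasurable
    (hfin.trans_lt (ENNReal.mul_lt_top (by simp) (ENNReal.pow_lt_top hu2.2))).ne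

lemma IsSchur.ae_integrable_prod (hκ : IsSchur μ ν κ A) {w : Z → ℂ} (hw : MemLp w 2 ν)
    {u : X × Z → ℂ} (hu : Measurable u) (hu2 : MemLp u 2 (μ.prod ν)) :
    ∀ᵐ x ∂μ, Integrable (fun q : Z × X => conj (w q.1) * (κ x q.2 q.1 * u (q.2, q.1)))
      (ν.prod μ) := by
  filter_upwards [hκ.ae_sq_lintegral_lt_top hu hu2] with x hx
  have hκx : Measurable fun q : Z × X => κ x q.2 q.1 * u (q.2, q.1) :=
    (hκ.meas.comp (by fun_prop : Measurable fun q : Z × X => (x, q.2, q.1))).mul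
      (hu.comp (by fun_prop))
  have hmeas : AEStronglyMeasurable
      (fun q : Z × X => conj (w q.1) * (κ x q.2 q.1 * u (q.2, q.1))) (ν.prod μ) :=
    (Complex.continuous_conj.comp_aestronglyMeasurable hw.1).comp_fst.mul
      hκx.aestronglyMeasurable
  refine ⟨hmeas, ?_⟩
  have hinner : ∫⁻ q, ‖conj (w q.1) * (κ x q.2 q.1 * u (q.2, q.1))‖ₑ ∂(ν.prod μ)
      = ∫⁻ z, ‖w z‖ₑ * ∫⁻ y, ‖κ x y z‖ₑ * ‖u (y, z)‖ₑ ∂μ ∂ν := by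
    rw [lintegral_prod _ hmeas.enorm]
    refine lintegral_congr fun z => ?_
    simp only [enorm_mul, RCLike.enorm_conj]
    exact lintegral_const_mul' _ _ enorm_ne_top
  rw [hasFiniteIntegral_iff_enorm, hinner]
  have hrow : Measurable fun z => ∫⁻ y, ‖κ x y z‖ₑ * ‖u (y, z)‖ₑ ∂μ := by
    simpa only [enorm_mul] using hκx.enorm.lintegral_prod_right'
  have hsq := (sq_lintegral_mul_le ν hw.1.enorm hrow.aemeasurable).trans_lt
    (ENNReal.mul_lt_top (sq_eLpNorm_two w ν ▸ ENNReal.pow_lt_top hw.2) hx)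
  exact (ENNReal.pow_lt_top_iff.1 hsq).resolve_right two_ne_zero

lemma IsSchur.coeFn_coeff_op (hκ : IsSchur μ ν κ A) {v : ℕ → Z → ℂ} (hv : IsONSystem ν v) (n : ℕ)
    (u : Lp ℂ 2 (μ.prod ν)) :
    hv.coeff μ n (hκ.op u) =ᵐ[μ] fun x => ∫ y, ∫ z, conj (v n z) * (κ x y z * u (y, z)) ∂ν ∂μ := by
  filter_upwards [hv.coeFn_coeff n (hκ.op u), Measure.ae_ae_of_ae_prod (hκ.coeFn_op u),
    hκ.ae_integrable_prod (hv.memLp n) (Lp.stronglyMeasurable u).measurable (Lp.memLp u)]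
    with x hcoeff hop hint
  rw [hcoeff, ← integral_integral_swap hint]
  refine integral_congr_ae ?_
  filter_upwards [hop] with z hz
  rw [hz, kernelFun, integral_const_mul]

lemma IsSchur.coeFn_coeff_op_tensor (hκ : IsSchur μ ν κ A) {v : ℕ → Z → ℂ} (hv : IsONSystem ν v)
    (n n' : ℕ) (f : Lp ℂ 2 μ) :
    hv.coeff μ n (hκ.op (hv.tensor μ n' f)) =ᵐ[μ]
      fun x => ∫ y, (∫ z, conj (v n z) * v n' z * κ x y z ∂ν) * f y ∂μ := by
  filter_upwards [hκ.coeFn_coeff_op hv n (hv.tensor μ n' f)] with x hx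
  rw [hx]
  refine integral_congr_ae ?_
  filter_upwards [Measure.ae_ae_of_ae_prod (hv.coeFn_tensor n' f)] with y hy
  rw [← integral_mul_const]
  refine integral_congr_ae ?_
  filter_upwards [hy] with z hz
  rw [hz]
  ring

end Swap

section PotElem

variable {L : Matrix (Fin d) (Fin d) ℝ} {μ c : ℝ} {V : Sp d → Sp d → ℝ} {Vhat : Sp d → Sp d → ℂ}
  {v : ℕ → Sp d → ℂ}

/-- The matrix elements `∫_𝓒 conj(v_n(z)) v_{n'}(z) V̂(k, z) dz` of the partial Fourier transform
of the potential. -/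
def potHat (L : Matrix (Fin d) (Fin d) ℝ) (v : ℕ → Sp d → ℂ) (Vhat : Sp d → Sp d → ℂ)
    (n n' : ℕ) (k : Sp d) : ℂ :=
  ∫ z in cell L, conj (v n z) * v n' z * Vhat k z

lemma IsPotHat.integrable_matrixElem (h : IsPotHat L μ c V Vhat) {w w' : Sp d → ℂ}
    (hw : MemLp w 2 (volume.restrict (cell L))) (hw' : MemLp w' 2 (volume.restrict (cell L))) :
    Integrable (fun p : Sp d × Sp d =>
      conj (w p.2) * w' p.2 * ((fourierConst d : ℂ) * Vhat p.1 p.2))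
      (volume.prod (volume.restrict (cell L))) := by
  have hVhat : Measurable fun p : Sp d × Sp d => Vhat p.1 p.2 := h.meas
  have hmeas : AEStronglyMeasurable (fun p : Sp d × Sp d =>
      conj (w p.2) * w' p.2 * ((fourierConst d : ℂ) * Vhat p.1 p.2))
      (volume.prod (volume.restrict (cell L))) :=
    ((Complex.continuous_conj.comp_aestronglyMeasurable hw.1).mul hw'.1).comp_snd.mul
      (hVhat.const_mul _).aestronglyMeasurable
  have hfibre : ∀ᵐ z ∂(volume.restrict (cell L)),
      ∫⁻ k, ‖conj (w z) * w' z * ((fourierConst d : ℂ) * Vhat k z)‖ₑ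
        ≤ ‖w z * w' z‖ₑ * ENNReal.ofReal c := by
    filter_upwards [h.mass] with z hz
    simp only [enorm_mul (conj (w z) * w' z), enorm_mul (conj (w z)), enorm_mul (w z),
      RCLike.enorm_conj]
    rw [lintegral_const_mul' _ _ (by finiteness)]
    gcongr
    exact (lintegral_mono fun k => h.enorm_fourierConst_mul_le k z).trans hz
  refine ⟨hmeas, ?_⟩
  rw [hasFiniteIntegral_iff_enorm, lintegral_prod_symm _ hmeas.enorm]
  refine (lintegral_mono_ae hfibre).trans_lt ?_
  rw [lintegral_mul_const' _ _ ENNReal.ofReal_ne_top]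
  exact ENNReal.mul_lt_top (hw.integrable_mul hw').2 ENNReal.ofReal_lt_top

lemma fourierConst_ne_zero : (fourierConst d : ℂ) ≠ 0 := by
  exact_mod_cast (fourierConst_pos d).ne'

lemma fourierConst_mul_potHat (n n' : ℕ) (k : Sp d) :
    (fourierConst d : ℂ) * potHat L v Vhat n n' k
      = ∫ z in cell L, conj (v n z) * v n' z * ((fourierConst d : ℂ) * Vhat k z) := by
  rw [potHat, ← integral_const_mul]
  exact integral_congr_ae (ae_of_all _ fun z => mul_left_comm _ _ _)

lemma IsPotHat.hasFourierL1_potElem (h : IsPotHat L μ c V Vhat)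
    (hv : ∀ n, MemLp (v n) 2 (volume.restrict (cell L))) (n n' : ℕ) :
    HasFourierL1 (potElem L v V n n') (potHat L v Vhat n n') := by
  have hint := h.integrable_matrixElem (hv n) (hv n')
  refine ⟨?_, fun x => ?_⟩
  · refine (hint.integral_prod_left.const_mul (fourierConst d : ℂ)⁻¹).congr
      (ae_of_all _ fun k => ?_)
    beta_reduce
    rw [← fourierConst_mul_potHat, inv_mul_cancel_left₀ fourierConst_ne_zero]
  · have hint' : Integrable (fun p : Sp d × Sp d => planeWave p.1 x *
        (conj (v n p.2) * v n' p.2 * ((fourierConst d : ℂ) * Vhat p.1 p.2)))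
        (volume.prod (volume.restrict (cell L))) := by
      refine hint.bdd_mul (c := 1) (Continuous.aestronglyMeasurable
        (continuous_planeWave.comp (f := fun p : Sp d × Sp d => (p.1, x)) (by fun_prop))) ?_
      exact ae_of_all _ fun p => (norm_planeWave p.1 x).le
    calc potElem L v V n n' x
        = ∫ z in cell L, ∫ k, planeWave k x *
            (conj (v n z) * v n' z * ((fourierConst d : ℂ) * Vhat k z)) := by
          refine integral_congr_ae ?_
          filter_upwards [h.fourier] with z hz
          simp only [hz.2 x]
          rw [← mul_assoc, ← integral_const_mul]
          refine integral_congr_ae (ae_of_all _ fun k => ?_)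
          simp only
          ring
      _ = ∫ k, ∫ z in cell L, planeWave k x *
            (conj (v n z) * v n' z * ((fourierConst d : ℂ) * Vhat k z)) :=
          (integral_integral_swap hint').symm
      _ = (fourierConst d : ℂ) * ∫ k, planeWave k x * potHat L v Vhat n n' k := by
          rw [← integral_const_mul]
          refine integral_congr_ae (ae_of_all _ fun k => ?_)
          beta_reduce
          rw [integral_const_mul, ← fourierConst_mul_potHat, mul_left_comm]

lemma IsPotHat.coeFn_coeff_op0_tensor (h : IsPotHat L μ c V Vhat)
    (hv : IsONSystem (volume.restrict (cell L)) v) {n n' : ℕ} {w : Sp d → ℂ}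
    (hw : HasFourierL1 (potElem L v V n n') w) (f : Lp ℂ 2 (volume : Measure (Sp d))) :
    hv.coeff volume n (h.isSchur_kernel0.op (hv.tensor volume n' f)) =ᵐ[volume]
      fun k => (fourierConst d : ℂ) * ∫ k', w (k - k') * f k' := by
  filter_upwards [h.isSchur_kernel0.coeFn_coeff_op_tensor hv n n' f] with k hk
  have hae : ∀ᵐ k', w (k - k') = potHat L v Vhat n n' (k - k') :=
    (Measure.measurePreserving_sub_left volume k).quasiMeasurePreserving.ae
      (hw.ae_eq (h.hasFourierL1_potElem hv.memLp n n'))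
  rw [hk, ← integral_const_mul]
  refine integral_congr_ae ?_
  filter_upwards [hae] with k' hk'
  rw [hk', ← mul_assoc, fourierConst_mul_potHat]
  rfl

theorem IsPotHat.eq_of_isU0 (h : IsPotHat L μ c V Vhat)
    (hv : IsONSystem (volume.restrict (cell L)) v) {g f : EnvSpace d} (hU : IsU0 L v V g f) :
    f = hv.coeffs volume (h.isSchur_kernel0.op (hv.synth volume g)) := by
  obtain ⟨w, hw, hseries⟩ := hU
  ext1
  funext n
  rw [hv.coeffs_apply]
  set T := (hv.coeff volume n).comp h.isSchur_kernel0.op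
  have hlim : Tendsto (fun N => ∑ n' ∈ Finset.range N, T (hv.tensor volume n' (g n'))) atTop
      (𝓝 (T (hv.synth volume g))) :=
    ((hv.hasSum_synth g).mapL T).tendsto_sum_nat
  have hterm : ∀ᵐ k, ∀ n', T (hv.tensor volume n' (g n')) k =
      (fourierConst d : ℂ) * ∫ k', w n n' (k - k') * g n' k' :=
    ae_all_iff.2 fun n' => h.coeFn_coeff_op0_tensor hv (hw n n') (g n')
  refine tendsto_nhds_unique ?_ hlim
  rw [Lp.tendsto_Lp_iff_tendsto_eLpNorm']
  refine (hseries n).congr fun N => ?_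
  rw [← eLpNorm_neg]
  refine eLpNorm_congr_ae ?_
  filter_upwards [Lp.coeFn_finsetSum (Finset.range N) fun n' => T (hv.tensor volume n' (g n')),
    hterm] with k hsum hk
  simp only [Pi.neg_apply, Pi.sub_apply, hsum, Finset.sum_apply, hk, neg_sub]

end PotElem

/-! ### The operator `𝓤^ε` in terms of its Schur kernel -/

section FibreIntegral

variable {X Z : Type*} [MeasurableSpace X] [MeasurableSpace Z] {μ : Measure X} {ν : Measure Z}
  [SFinite μ] [SFinite ν] {w F : X × Z → ℂ} {K : NNReal}

lemma aestronglyMeasurable_swap (hF : AEStronglyMeasurable F (μ.prod ν)) :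
    AEStronglyMeasurable (fun q : Z × X => F (q.2, q.1)) (ν.prod μ) :=
  hF.comp_quasiMeasurePreserving Measure.measurePreserving_swap.quasiMeasurePreserving

lemma ae_memLp_slice (hF : MemLp F 2 (μ.prod ν)) : ∀ᵐ z ∂ν, MemLp (fun x => F (x, z)) 2 μ := by
  have hswap := aestronglyMeasurable_swap hF.1
  have hfin : ∫⁻ z, ∫⁻ x, ‖F (x, z)‖ₑ ^ 2 ∂μ ∂ν < ⊤ := by
    rw [← lintegral_prod_symm (fun p : X × Z => ‖F p‖ₑ ^ 2) (hF.1.enorm.pow_const 2),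
      ← sq_eLpNorm_two]
    exact ENNReal.pow_lt_top hF.2
  filter_upwards [ae_lt_top' (hswap.enorm.pow_const 2).lintegral_prod_right' hfin.ne,
    hswap.prodMk_left] with z hz hmeas
  rw [← sq_eLpNorm_two] at hz
  exact ⟨hmeas, (ENNReal.pow_lt_top_iff.1 hz).resolve_right two_ne_zero⟩

lemma eLpNorm_fibreIntegral_le (hw : Measurable w)
    (hK : ∀ z, eLpNorm (fun x => w (x, z)) 2 μ ≤ K) (hF : AEStronglyMeasurable F (μ.prod ν)) :
    eLpNorm (fun z => ∫ x, w (x, z) * F (x, z) ∂μ) 2 ν ≤ K * eLpNorm F 2 (μ.prod ν) := by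
  refine (ENNReal.pow_le_pow_left_iff (n := 2) (by norm_num)).1 ?_
  rw [mul_pow, sq_eLpNorm_two, sq_eLpNorm_two, lintegral_prod_symm _ (hF.enorm.pow_const 2),
    ← lintegral_const_mul' _ _ (by finiteness)]
  refine lintegral_mono_ae ?_
  filter_upwards [(aestronglyMeasurable_swap hF).prodMk_left] with z hz
  have hwz : Measurable fun x => w (x, z) := hw.comp (by fun_prop)
  calc ‖∫ x, w (x, z) * F (x, z) ∂μ‖ₑ ^ 2
      ≤ (∫⁻ x, ‖w (x, z)‖ₑ * ‖F (x, z)‖ₑ ∂μ) ^ 2 := by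
        gcongr
        refine (enorm_integral_le_lintegral_enorm _).trans_eq ?_
        simp only [enorm_mul]
    _ ≤ (∫⁻ x, ‖w (x, z)‖ₑ ^ 2 ∂μ) * ∫⁻ x, ‖F (x, z)‖ₑ ^ 2 ∂μ :=
        sq_lintegral_mul_le μ hwz.enorm.aemeasurable hz.enorm
    _ ≤ K ^ 2 * ∫⁻ x, ‖F (x, z)‖ₑ ^ 2 ∂μ := by
        rw [← sq_eLpNorm_two (fun x => w (x, z))]
        gcongr
        exact hK z

lemma memLp_fibreIntegral (hw : Measurable w) (hK : ∀ z, eLpNorm (fun x => w (x, z)) 2 μ ≤ K)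
    (hF : MemLp F 2 (μ.prod ν)) : MemLp (fun z => ∫ x, w (x, z) * F (x, z) ∂μ) 2 ν :=
  ⟨(aestronglyMeasurable_swap (hw.aestronglyMeasurable.mul hF.1)).integral_prod_right',
    (eLpNorm_fibreIntegral_le hw hK hF.1).trans_lt (ENNReal.mul_lt_top ENNReal.coe_lt_top hF.2)⟩

lemma ae_integrable_slice_mul (hw : Measurable w) (hK : ∀ z, eLpNorm (fun x => w (x, z)) 2 μ ≤ K)
    (hF : MemLp F 2 (μ.prod ν)) : ∀ᵐ z ∂ν, Integrable (fun x => w (x, z) * F (x, z)) μ := by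
  filter_upwards [ae_memLp_slice hF] with z hz
  exact MemLp.integrable_mul ⟨(hw.comp (by fun_prop)).aestronglyMeasurable,
    (hK z).trans_lt ENNReal.coe_lt_top⟩ hz

/-- The bounded operator `L²(X × Z) → L²(Z)` that integrates against `w (·, z)` in each fibre
`X × {z}`, the functions `w (·, z)` being bounded in `L²(X)`. -/
def fibreIntegral (hw : Measurable w) (hK : ∀ z, eLpNorm (fun x => w (x, z)) 2 μ ≤ K)
    (ν : Measure Z) [SFinite ν] : Lp ℂ 2 (μ.prod ν) →L[ℂ] Lp ℂ 2 ν :=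
  LinearMap.mkContinuous
    { toFun := fun F => (memLp_fibreIntegral hw hK (Lp.memLp F)).toLp _
      map_add' := fun F G => by
        rw [← MemLp.toLp_add]
        refine MemLp.toLp_congr _ _ ?_
        filter_upwards [ae_prod_swap (Lp.coeFn_add F G),
          ae_integrable_slice_mul hw hK (Lp.memLp F), ae_integrable_slice_mul hw hK (Lp.memLp G)]
          with z hz hFz hGz
        rw [Pi.add_apply, ← integral_add hFz hGz]
        refine integral_congr_ae ?_
        filter_upwards [hz] with x hx
        rw [hx, Pi.add_apply, mul_add]
      map_smul' := fun a F => by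
        rw [RingHom.id_apply, ← MemLp.toLp_const_smul]
        refine MemLp.toLp_congr _ _ ?_
        filter_upwards [ae_prod_swap (Lp.coeFn_smul a F)] with z hz
        rw [Pi.smul_apply, smul_eq_mul, ← integral_const_mul]
        refine integral_congr_ae ?_
        filter_upwards [hz] with x hx
        rw [hx, Pi.smul_apply, smul_eq_mul, mul_left_comm] }
    K (fun F => by
      rw [LinearMap.coe_mk, AddHom.coe_mk, Lp.norm_toLp, Lp.norm_def]
      refine (ENNReal.toReal_mono (ENNReal.mul_ne_top ENNReal.coe_ne_top (Lp.eLpNorm_ne_top F))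
        (eLpNorm_fibreIntegral_le hw hK (Lp.memLp F).1)).trans_eq ?_
      rw [ENNReal.toReal_mul, ENNReal.coe_toReal])

lemma coeFn_fibreIntegral (hw : Measurable w) (hK : ∀ z, eLpNorm (fun x => w (x, z)) 2 μ ≤ K)
    (F : Lp ℂ 2 (μ.prod ν)) :
    fibreIntegral hw hK ν F =ᵐ[ν] fun z => ∫ x, w (x, z) * F (x, z) ∂μ :=
  (memLp_fibreIntegral hw hK (Lp.memLp F)).coeFn_toLp

lemma coeFn_fibreIntegral_tensor (hw : Measurable w)
    (hK : ∀ z, eLpNorm (fun x => w (x, z)) 2 μ ≤ K) {v : ℕ → Z → ℂ} (hv : IsONSystem ν v) (n : ℕ)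
    (f : Lp ℂ 2 μ) : fibreIntegral hw hK ν (hv.tensor μ n f) =ᵐ[ν]
      fun z => (∫ x, w (x, z) * f x ∂μ) * v n z := by
  filter_upwards [coeFn_fibreIntegral hw hK (hv.tensor μ n f),
    ae_prod_swap (hv.coeFn_tensor n f)] with z hz htensor
  rw [hz, ← integral_mul_const]
  refine integral_congr_ae ?_
  filter_upwards [htensor] with x hx
  rw [hx, mul_assoc]

end FibreIntegral

lemma ae_eq_of_tendsto_eLpNorm_sub {X : Type*} [MeasurableSpace X] {μ : Measure X}
    {S : ℕ → X → ℂ} {f g : X → ℂ} (hS : ∀ N, AEStronglyMeasurable (S N) μ)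
    (hf : AEStronglyMeasurable f μ) (hg : AEStronglyMeasurable g μ)
    (hSf : Tendsto (fun N => eLpNorm (S N - f) 2 μ) atTop (𝓝 0))
    (hSg : Tendsto (fun N => eLpNorm (S N - g) 2 μ) atTop (𝓝 0)) : f =ᵐ[μ] g :=
  tendstoInMeasure_ae_unique (tendstoInMeasure_of_tendsto_eLpNorm two_ne_zero hS hf hSf)
    (tendstoInMeasure_of_tendsto_eLpNorm two_ne_zero hS hg hSg)

section Affine

variable {ε : ℝ}

lemma map_affine (hε : ε ≠ 0) (a : Sp d) :
    Measure.map (fun z : Sp d => ε • (z + a)) volume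
      = ENNReal.ofReal |(ε ^ d)⁻¹| • (volume : Measure (Sp d)) := by
  have hcomp : (fun z : Sp d => ε • (z + a)) = (fun y => ε • y) ∘ fun z => z + a := rfl
  rw [hcomp, ← Measure.map_map (by fun_prop) (by fun_prop), map_add_right_eq_self,
    Measure.map_addHaar_smul volume hε, finrank_euclideanSpace_fin]

lemma quasiMeasurePreserving_affine (hε : ε ≠ 0) (a : Sp d) :
    Measure.QuasiMeasurePreserving (fun z : Sp d => ε • (z + a)) volume volume :=
  ⟨by fun_prop, map_affine hε a ▸ Measure.smul_absolutelyContinuous⟩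

lemma measurableEmbedding_affine (hε : ε ≠ 0) (a : Sp d) :
    MeasurableEmbedding fun z : Sp d => ε • (z + a) :=
  Continuous.measurableEmbedding (by fun_prop) fun _ _ hxy =>
    add_right_cancel (smul_right_injective _ hε hxy)

lemma tendsto_eLpNorm_comp_affine (hε : ε ≠ 0) (a : Sp d) (s : Set (Sp d))
    {F : ℕ → Sp d → ℂ} (hF : Tendsto (fun N => eLpNorm (F N) 2 volume) atTop (𝓝 0)) :
    Tendsto (fun N => eLpNorm (fun z => F N (ε • (z + a))) 2 (volume.restrict s)) atTop (𝓝 0) := by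
  have hmap : ∀ N, eLpNorm (fun z => F N (ε • (z + a))) 2 volume
      = ENNReal.ofReal |(ε ^ d)⁻¹| ^ (1 / 2 : ℝ≥0∞).toReal * eLpNorm (F N) 2 volume := by
    intro N
    rw [← smul_eq_mul, ← eLpNorm_smul_measure_of_ne_top ENNReal.ofNat_ne_top, ← map_affine hε a,
      (measurableEmbedding_affine hε a).eLpNorm_map_measure]
    rfl
  have hlim := ENNReal.Tendsto.const_mul
    (a := ENNReal.ofReal |(ε ^ d)⁻¹| ^ (1 / 2 : ℝ≥0∞).toReal) hF (Or.inr (by finiteness))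
  rw [mul_zero] at hlim
  exact tendsto_of_tendsto_of_tendsto_of_le_of_le tendsto_const_nhds hlim (fun _ => zero_le)
    fun N => (eLpNorm_mono_measure _ Measure.restrict_le_self).trans_eq (hmap N)

end Affine

section Synthesis

variable {L : Matrix (Fin d) (Fin d) ℝ} {ε : ℝ} {v : ℕ → Sp d → ℂ}

/-- The phase `𝟙_B(k) e^{ik·ε(z+a)}`. -/
def phase (B : Set (Sp d)) (ε : ℝ) (a : Sp d) (p : Sp d × Sp d) : ℂ :=
  B.indicator 1 p.1 * planeWave p.1 (ε • (p.2 + a))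

lemma measurable_phase {B : Set (Sp d)} (hB : MeasurableSet B) (ε : ℝ) (a : Sp d) :
    Measurable (phase B ε a) := by
  have hindicator : Measurable fun p : Sp d × Sp d => B.indicator (1 : Sp d → ℂ) p.1 :=
    (measurable_one.indicator hB).comp measurable_fst
  have hwave := continuous_planeWave.measurable.comp
    (by fun_prop : Measurable fun p : Sp d × Sp d => (p.1, ε • (p.2 + a)))
  exact hindicator.mul hwave

lemma eLpNorm_phase {B : Set (Sp d)} (hB : MeasurableSet B) (hBfin : volume B ≠ ⊤) (ε : ℝ)
    (a z : Sp d) :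
    eLpNorm (fun k => phase B ε a (k, z)) 2 volume ≤ (volume B ^ (1 / 2 : ℝ)).toNNReal := by
  have hindicator : ∀ k, ‖phase B ε a (k, z)‖ = ‖B.indicator (fun _ => (1 : ℂ)) k‖ := by
    intro k
    rw [phase, norm_mul, norm_planeWave, mul_one]
    rfl
  rw [eLpNorm_congr_norm_ae (ae_of_all _ hindicator),
    eLpNorm_indicator_const hB two_ne_zero ENNReal.ofNat_ne_top, ENNReal.coe_toNNReal
      (ENNReal.rpow_ne_top_of_nonneg (by norm_num) hBfin)]
  simp

lemma integral_phase_mul {B : Set (Sp d)} (hB : MeasurableSet B) (ε : ℝ) (a z : Sp d)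
    (f : Sp d → ℂ) :
    ∫ k, phase B ε a (k, z) * f k = ∫ k in B, planeWave k (ε • (z + a)) * f k := by
  rw [← integral_indicator hB]
  refine integral_congr_ae (ae_of_all _ fun k => ?_)
  by_cases hk : k ∈ B <;> simp [phase, hk]

lemma measurableSet_brillouinScaled (hL : L.det ≠ 0) (hε : ε ≠ 0) :
    MeasurableSet (brillouinScaled L ε) :=
  brillouinScaled_eq_cell hL hε ▸ measurableSet_cell _

lemma volume_brillouinScaled_ne_top (hL : L.det ≠ 0) (hε : ε ≠ 0) :
    volume (brillouinScaled L ε) ≠ ⊤ :=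
  brillouinScaled_eq_cell hL hε ▸ (isCompact_cell _).measure_lt_top.ne

/-- On a translate of the cell, both sides are `L²` limits of the partial sums of the series for
`ψ`: the left one by definition, the right one by continuity of `fibreIntegral`. -/
lemma IsSynthesis.ae_eq (hL : L.det ≠ 0) (hε : 0 < ε)
    (hv : IsONSystem (volume.restrict (cell L)) v) (hper : ∀ n, IsPeriodic L (v n))
    {g : EnvSpace d} {ψ : Sp d → ℂ} (h : IsSynthesis L v ε g ψ) (m : Fin d → ℤ) :
    ∀ᵐ z ∂(volume.restrict (cell L)), ψ (ε • (z + latVec L m))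
      = (Real.sqrt (volume.real (cell L)) : ℂ) * ((fourierConst d : ℂ) *
        ∫ k in brillouinScaled L ε, planeWave k (ε • (z + latVec L m)) *
          hv.synth volume g (k, z)) := by
  have hB := measurableSet_brillouinScaled hL hε.ne'
  set a := latVec L m
  set C : ℂ := (Real.sqrt (volume.real (cell L)) : ℂ) * (fourierConst d : ℂ) with hC
  set Φ := fibreIntegral (measurable_phase hB ε a)
    (eLpNorm_phase hB (volume_brillouinScaled_ne_top hL hε.ne') ε a) (volume.restrict (cell L))
    with hΦ
  set S : ℕ → Lp ℂ 2 (volume.restrict (cell L)) :=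
    fun N => ∑ n ∈ Finset.range N, C • Φ (hv.tensor volume n (g n)) with hS
  have hlim : Tendsto S atTop (𝓝 (C • Φ (hv.synth volume g))) :=
    ((hv.hasSum_synth g).mapL (C • Φ)).tendsto_sum_nat
  have hterm : ∀ᵐ z ∂(volume.restrict (cell L)), ∀ n, (C • Φ (hv.tensor volume n (g n))) z
      = (Real.sqrt (volume.real (cell L)) : ℂ) *
        (envFun L ε (fun k => g n k) (ε • (z + a)) * v n (ε⁻¹ • ε • (z + a))) := by
    refine ae_all_iff.2 fun n => ?_
    filter_upwards [Lp.coeFn_smul C (Φ (hv.tensor volume n (g n))),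
      coeFn_fibreIntegral_tensor (measurable_phase hB ε a) _ hv n (g n)] with z hsmul hz
    rw [hsmul, Pi.smul_apply, hΦ, hz, integral_phase_mul hB, inv_smul_smul₀ hε.ne',
      show v n (z + a) = v n z from hper n m z, envFun, hC, smul_eq_mul]
    ring
  have hψ : (fun z => ψ (ε • (z + a))) =ᵐ[volume.restrict (cell L)]
      (C • Φ (hv.synth volume g) : Lp ℂ 2 (volume.restrict (cell L))) := by
    refine ae_eq_of_tendsto_eLpNorm_sub (fun N => (Lp.aestronglyMeasurable (S N)))
      (h.1.1.comp_quasiMeasurePreserving (quasiMeasurePreserving_affine hε.ne' a)).restrict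
      (Lp.aestronglyMeasurable _) ?_ ((Lp.tendsto_Lp_iff_tendsto_eLpNorm' _ _).1 hlim)
    refine (tendsto_eLpNorm_comp_affine hε.ne' a (cell L) h.2).congr fun N => ?_
    rw [← eLpNorm_neg]
    refine eLpNorm_congr_ae ?_
    filter_upwards [Lp.coeFn_finsetSum (Finset.range N)
      fun n => C • Φ (hv.tensor volume n (g n)), hterm] with z hsum hz
    simp only [Pi.neg_apply, Pi.sub_apply, hS, hsum, Finset.sum_apply, hz, Finset.mul_sum,
      neg_sub]
  filter_upwards [hψ, Lp.coeFn_smul C (Φ (hv.synth volume g)),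
    coeFn_fibreIntegral (measurable_phase hB ε a) _ (hv.synth volume g)] with z hz hsmul hfibre
  rw [hz, hsmul, Pi.smul_apply, hΦ, hfibre, smul_eq_mul, hC, mul_assoc,
    integral_phase_mul hB ε a z (fun k => hv.synth volume g (k, z))]

end Synthesis

section Periodization

variable {M : Matrix (Fin d) (Fin d) ℝ}

lemma integral_prod_eq_setIntegral_cell (hM : M.det ≠ 0) {Y : Type*} [MeasurableSpace Y]
    {ν : Measure Y} [SFinite ν] {F : Sp d × Y → ℂ} (hF : Integrable F (volume.prod ν)) :
    ∫ p, F p ∂(volume.prod ν)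
      = ∫ k in cell M, ∫ y, ∫ m, F (k + latVec M m, y) ∂Measure.count ∂ν := by
  have htiling : MeasurePreserving
      (fun q : Sp d × (Fin d → ℤ) × Y => (q.1 + latVec M q.2.1, q.2.2))
      ((volume.restrict (cell M)).prod (Measure.count.prod ν)) (volume.prod ν) :=
    ((measurePreserving_add_latVec hM).prod (MeasurePreserving.id ν)).comp
      (measurePreserving_prodAssoc (volume.restrict (cell M)) Measure.count ν).symm
  have hint : Integrable
      (fun q : Sp d × (Fin d → ℤ) × Y => F (q.1 + latVec M q.2.1, q.2.2))
      ((volume.restrict (cell M)).prod (Measure.count.prod ν)) :=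
    htiling.integrable_comp_of_integrable hF
  calc ∫ p, F p ∂(volume.prod ν)
      = ∫ q, F (q.1 + latVec M q.2.1, q.2.2)
          ∂((volume.restrict (cell M)).prod (Measure.count.prod ν)) := by
        rw [← htiling.map_eq, integral_map htiling.measurable.aemeasurable
          (htiling.map_eq ▸ hF.aestronglyMeasurable)]
    _ = ∫ k in cell M, ∫ y, ∫ m, F (k + latVec M m, y) ∂Measure.count ∂ν := by
        rw [integral_prod _ hint]
        refine integral_congr_ae ?_
        filter_upwards [hint.prod_right_ae] with k hk
        exact integral_prod_symm _ hk

lemma integrable_planeWave_mul_convolution {f w : Sp d → ℂ} (hf : Integrable f)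
    (hw : Integrable w) (x : Sp d) :
    Integrable (fun p : Sp d × Sp d => planeWave p.1 x * (f p.2 * w (p.1 - p.2)))
      (volume.prod volume) :=
  (hf.convolution_integrand (ContinuousLinearMap.mul ℂ ℂ) hw).bdd_mul (c := 1)
    (Continuous.aestronglyMeasurable
      (continuous_planeWave.comp (f := fun p : Sp d × Sp d => (p.1, x)) (by fun_prop)))
    (ae_of_all _ fun p => (norm_planeWave p.1 x).le)

lemma integral_planeWave_mul_convolution {f w : Sp d → ℂ} (hf : Integrable f)
    (hw : Integrable w) (x : Sp d) :
    ∫ p : Sp d × Sp d, planeWave p.1 x * (f p.2 * w (p.1 - p.2)) ∂(volume.prod volume)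
      = (∫ q, planeWave q x * w q) * ∫ k, planeWave k x * f k := by
  rw [integral_prod_symm _ (integrable_planeWave_mul_convolution hf hw x), ← integral_const_mul]
  refine integral_congr_ae (ae_of_all _ fun k => ?_)
  beta_reduce
  rw [← integral_sub_right_eq_self (fun q => planeWave q x * w q) k, ← integral_mul_const]
  refine integral_congr_ae (ae_of_all _ fun q => ?_)
  have hq : planeWave q x = planeWave (q - k) x * planeWave k x := by
    rw [← planeWave_add_left, sub_add_cancel]
  simp only [hq]
  ring

/-- The shift by a reciprocal lattice vector in the kernel `kernelEps` is the aliasing of the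
momenta outside the dual cell: it is invisible at points `x ∈ ε • z + ε • L ℤ^d`. -/
lemma setIntegral_planeWave_mul_kernelEps (hM : M.det ≠ 0) {ε : ℝ} {x z : Sp d}
    (hx : ∀ m, planeWave (latVec M m) x = planeWave (latVec M m) (ε • z))
    {Vhat : Sp d → Sp d → ℂ} (hV : Integrable fun k => Vhat k z) {u : Sp d → ℂ}
    (hu : Integrable u (volume.restrict (cell M))) :
    ∫ k in cell M, planeWave k x * ∫ y, kernelEps M ε Vhat k y z * u y
      = ((fourierConst d : ℂ) * ∫ q, planeWave q x * Vhat q z) *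
        ∫ k in cell M, planeWave k x * u k := by
  have hcell := measurableSet_cell M
  have hf : Integrable ((cell M).indicator u) := (integrable_indicator_iff hcell).2 hu
  have hcut : ∫ k in cell M, planeWave k x * u k
      = ∫ k, planeWave k x * (cell M).indicator u k := by
    rw [← integral_indicator hcell]
    simp only [indicator_mul_right]
  rw [hcut, mul_assoc, ← integral_planeWave_mul_convolution hf hV,
    integral_prod_eq_setIntegral_cell hM (integrable_planeWave_mul_convolution hf hV x),
    ← integral_const_mul]
  refine setIntegral_congr_fun hcell fun k hk => ?_
  beta_reduce
  rw [← integral_const_mul, ← integral_const_mul]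
  refine integral_congr_ae (ae_of_all _ fun y => ?_)
  beta_reduce
  by_cases hy : y ∈ cell M
  · rw [kernelEps_of_mem hk hy, mul_assoc, mul_left_comm, ← integral_mul_const,
      ← integral_const_mul (planeWave k x)]
    congr 1
    refine integral_congr_ae (ae_of_all _ fun m => ?_)
    simp only [aliasTerm, planeWave_add_left, hx, indicator_of_mem hy]
    ring
  · simp [kernelEps, hy]

lemma ae_eq_of_setIntegral_planeWave_eq (hM : M.det ≠ 0) (x : Sp d) {f g : Sp d → ℂ}
    (hf : MemLp f 2 (volume.restrict (cell M))) (hg : MemLp g 2 (volume.restrict (cell M)))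
    (h : ∀ m, ∫ k in cell M, planeWave k (x + latVec (recip M) m) * f k
      = ∫ k in cell M, planeWave k (x + latVec (recip M) m) * g k) :
    f =ᵐ[volume.restrict (cell M)] g := by
  have hwave : AEStronglyMeasurable (fun k => planeWave k x) (volume.restrict (cell M)) :=
    (continuous_planeWave.comp (f := fun k : Sp d => (k, x)) (by fun_prop)).aestronglyMeasurable
  have hmem : MemLp (fun k => planeWave k x * (f k - g k)) 2 (volume.restrict (cell M)) :=
    (hf.sub hg).of_le_mul (c := 1) (hwave.mul (hf.sub hg).1)
      (ae_of_all _ fun k => by rw [norm_mul, norm_planeWave]; rfl)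
  have hcoeff : ∀ m, cellCoeff M (fun k => planeWave k x * (f k - g k)) m = 0 := by
    intro m
    have hdiff : ∫ k in cell M, planeWave k (x + latVec (recip M) (-m)) * (f k - g k) = 0 := by
      simp only [mul_sub]
      rw [integral_sub (integrable_planeWave_mul (hf.integrable one_le_two) _)
        (integrable_planeWave_mul (hg.integrable one_le_two) _), h, sub_self]
    rw [← hdiff, cellCoeff]
    refine integral_congr_ae (ae_of_all _ fun k => ?_)
    beta_reduce
    rw [conj_planeWave, ← latVec_neg, planeWave_add_right, planeWave_comm k (latVec _ _)]
    ring
  filter_upwards [ae_eq_zero_of_cellCoeff_eq_zero hM hmem hcoeff] with k hk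
  exact sub_eq_zero.1 ((mul_eq_zero.1 hk).resolve_left (planeWave_ne_zero k x))

end Periodization

section Identification

variable {L : Matrix (Fin d) (Fin d) ℝ} {μ c ε : ℝ} {V : Sp d → Sp d → ℝ}
  {Vhat : Sp d → Sp d → ℂ} {v : ℕ → Sp d → ℂ}

/-- The indicator function of the complement of a measurable set, as a weight. -/
def complWeight {B : Set (Sp d)} (hB : MeasurableSet B) : Weight (Sp d) where
  toFun := Bᶜ.indicator 1
  meas := measurable_one.indicator hB.compl
  bound := 1
  bound_nonneg := zero_le_one
  abs_le k := by by_cases hk : k ∈ B <;> simp [hk]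

lemma complWeight_env_eq_zero {B : Set (Sp d)} (hB : MeasurableSet B) {g : EnvSpace d}
    (hg : ∀ n, ∀ᵐ k : Sp d, k ∉ B → g n k = 0) : (complWeight hB).env volume g = 0 := by
  ext n : 2
  rw [Weight.env_apply]
  change (complWeight hB).mul volume (g n) = 0
  ext1
  filter_upwards [(complWeight hB).coeFn_mul (g n), hg n,
    Lp.coeFn_zero ℂ 2 (volume : Measure (Sp d))] with k hmul hgk hzero
  rw [hmul, hzero, Pi.zero_apply]
  by_cases hk : k ∈ B
  · simp [complWeight, hk]
  · rw [hgk hk, mul_zero]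

lemma IsONSystem.ae_synth_eq_zero {B : Set (Sp d)} (hB : MeasurableSet B)
    {ν : Measure (Sp d)} [SFinite ν] (hv : IsONSystem ν v) {g : EnvSpace d}
    (hg : ∀ n, ∀ᵐ k : Sp d, k ∉ B → g n k = 0) :
    ∀ᵐ p ∂((volume : Measure (Sp d)).prod ν), p.1 ∉ B → hv.synth volume g p = 0 := by
  have hcut : ((complWeight hB).fst (Sp d)).mul _ (hv.synth volume g) = 0 := by
    rw [← hv.synth_env, complWeight_env_eq_zero hB hg, map_zero]
  have hmul := ((complWeight hB).fst (Sp d)).coeFn_mul (hv.synth volume g)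
  rw [hcut] at hmul
  filter_upwards [hmul, Lp.coeFn_zero ℂ 2 ((volume : Measure (Sp d)).prod ν)] with p hp hzero hpB
  rw [hzero] at hp
  simpa [complWeight, Weight.fst, hpB] using hp.symm

lemma volume_real_cell_pos (hL : L.det ≠ 0) : 0 < volume.real (cell L) :=
  ENNReal.toReal_pos (Measure.measure_pos_of_mem_nhds volume
    (mem_interior_iff_mem_nhds.1 (zero_mem_interior_cell hL))).ne'
    (isCompact_cell L).measure_lt_top.ne

lemma IsPotHat.ae_setIntegral_planeWave_synth_eq (hL : L.det ≠ 0) (hε : 0 < ε)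
    (h : IsPotHat L μ c V Vhat) (hVper : ∀ x, IsPeriodic L (V x))
    (hv : IsONSystem (volume.restrict (cell L)) v) (hper : ∀ n, IsPeriodic L (v n))
    {g f : EnvSpace d} (hU : IsUeps L v V ε g f) :
    ∀ᵐ z ∂(volume.restrict (cell L)), ∀ m : Fin d → ℤ,
      ∫ k in cell (recip (ε • L)), planeWave k (ε • (z + latVec L m)) * hv.synth volume f (k, z)
        = ((fourierConst d : ℂ) *
            ∫ q, planeWave q (ε • (z + latVec L m)) * Vhat q z) *
          ∫ k in cell (recip (ε • L)), planeWave k (ε • (z + latVec L m)) *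
            hv.synth volume g (k, z) := by
  obtain ⟨ψ, hψ, -, hVψ⟩ := hU
  have hfactor : (Real.sqrt (volume.real (cell L)) : ℂ) * (fourierConst d : ℂ) ≠ 0 :=
    mul_ne_zero (by exact_mod_cast (Real.sqrt_pos.2 (volume_real_cell_pos hL)).ne')
      fourierConst_ne_zero
  filter_upwards [ae_all_iff.2 (hψ.ae_eq hL hε hv hper), ae_all_iff.2 (hVψ.ae_eq hL hε hv hper),
    h.fourier] with z hψz hVψz hVz m
  have hVm : V (ε • (z + latVec L m)) (ε⁻¹ • ε • (z + latVec L m))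
      = V (ε • (z + latVec L m)) z := by
    rw [inv_smul_smul₀ hε.ne']
    exact hVper _ m z
  have hVfourier : (V (ε • (z + latVec L m)) z : ℂ) = (fourierConst d : ℂ) *
      ∫ q, planeWave q (ε • (z + latVec L m)) * Vhat q z := hVz.2 _
  have hproduct := hVψz m
  rw [hVm, hψz m, hVfourier, brillouinScaled_eq_cell hL hε.ne'] at hproduct
  refine mul_left_cancel₀ hfactor ?_
  rw [mul_assoc, ← hproduct]
  ring

theorem IsPotHat.synth_eq_of_isUeps (hL : L.det ≠ 0) (hε : 0 < ε) (h : IsPotHat L μ c V Vhat)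
    (hVper : ∀ x, IsPeriodic L (V x)) (hv : IsONSystem (volume.restrict (cell L)) v)
    (hper : ∀ n, IsPeriodic L (v n)) {g f : EnvSpace d} (hU : IsUeps L v V ε g f) :
    hv.synth volume f =
      (h.isSchur_kernelEps (det_recip_ne_zero (det_smul_ne_zero hL hε.ne')) ε).op
        (hv.synth volume g) := by
  have hεL := det_smul_ne_zero hL hε.ne'
  have hM := det_recip_ne_zero hεL
  have hcell := measurableSet_cell (recip (ε • L))
  set κ := h.isSchur_kernelEps hM ε
  set u := hv.synth (volume : Measure (Sp d)) g
  have hpoint (z : Sp d) (m : Fin d → ℤ) :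
      ε • (z + latVec L m) = ε • z + latVec (recip (recip (ε • L))) m := by
    rw [recip_recip hεL, latVec, latVec, latMap_smul_matrix, smul_add]
  have hsupp : ∀ᵐ z ∂(volume.restrict (cell L)), ∀ᵐ k,
      k ∉ cell (recip (ε • L)) → hv.synth volume f (k, z) = 0 := by
    obtain ⟨ψ, -, hout, -⟩ := hU
    rw [brillouinScaled_eq_cell hL hε.ne'] at hout
    exact ae_prod_swap (hv.ae_synth_eq_zero hcell hout)
  have hmeas : MeasurableSet {p : Sp d × Sp d | hv.synth volume f p = κ.op u p} :=
    measurableSet_eq_fun (Lp.stronglyMeasurable _).measurable (Lp.stronglyMeasurable _).measurable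
  ext1
  refine (Measure.ae_prod_iff_ae_ae hmeas).2 ((Measure.ae_ae_comm
    (p := fun k z => hv.synth volume f (k, z) = κ.op u (k, z)) hmeas).2 ?_)
  filter_upwards [h.ae_setIntegral_planeWave_synth_eq hL hε hVper hv hper hU, h.fourier, hsupp,
    ae_memLp_slice (Lp.memLp u), ae_memLp_slice (Lp.memLp (hv.synth volume f)),
    ae_memLp_slice (Lp.memLp (κ.op u)), ae_prod_swap (κ.coeFn_op u)]
    with z hfourier hVz hsuppz hu hf hop hkernel
  have hinside := ae_eq_of_setIntegral_planeWave_eq hM (ε • z) (hf.restrict _) (hop.restrict _)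
    fun m => by
      have halias : ∀ n, planeWave (latVec (recip (ε • L)) n) (ε • (z + latVec L m))
          = planeWave (latVec (recip (ε • L)) n) (ε • z) := fun n => by
        rw [hpoint, planeWave_add_right, recip_recip hεL, planeWave_latVec_recip hεL, mul_one]
      rw [← hpoint, hfourier m, ← setIntegral_planeWave_mul_kernelEps hM halias hVz.1
        ((hu.restrict _).integrable one_le_two)]
      refine integral_congr_ae ?_
      filter_upwards [ae_restrict_of_ae hkernel] with k hk
      rw [hk, kernelFun]
  filter_upwards [(ae_restrict_iff' hcell).1 hinside, hsuppz, hkernel] with k hin hout hk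
  by_cases hkB : k ∈ cell (recip (ε • L))
  · exact hin hkB
  · rw [hout hkB, hk, kernelFun]
    simp [kernelEps, hkB]

end Identification

/-! ### Symmetry of the `k·p` operator -/

section Bloch

variable {L : Matrix (Fin d) (Fin d) ℝ} {W : Sp d → ℝ} {E : ℕ → ℝ} {v : ℕ → Sp d → ℂ}
  {dv : ℕ → Fin d → Sp d → ℂ}

lemma contDiff_planeWave (k : Sp d) : ContDiff ℝ ∞ (planeWave k) :=
  (contDiff_const.mul (Complex.ofRealCLM.contDiff.comp (innerSL ℝ k).contDiff)).cexp

lemma partialDeriv_planeWave (j : Fin d) (k x : Sp d) :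
    partialDeriv j (planeWave k) x = Complex.I * (k j : ℂ) * planeWave k x := by
  have hphase : HasFDerivAt (fun x : Sp d => Complex.I * ((inner ℝ k x : ℝ) : ℂ))
      (Complex.I • (Complex.ofRealCLM.comp (innerSL ℝ k))) x :=
    ((Complex.ofRealCLM.hasFDerivAt).comp x (innerSL ℝ k).hasFDerivAt).const_mul Complex.I
  have hwave : fderiv ℝ (planeWave k) x = _ := hphase.cexp.fderiv
  rw [partialDeriv, hwave]
  simp only [planeWave, smul_apply, ContinuousLinearMap.comp_apply, innerSL_apply_apply,
    Complex.ofRealCLM_apply, EuclideanSpace.inner_single_right, smul_eq_mul, conj_trivial, one_mul]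
  ring

lemma isPerTest_planeWave (hL : L.det ≠ 0) (m : Fin d → ℤ) :
    IsPerTest L (planeWave (-latVec (recip L) m)) := by
  refine ⟨contDiff_planeWave _, fun n x => ?_⟩
  change planeWave (-latVec (recip L) m) (x + latVec L n) = _
  rw [← latVec_neg, planeWave_add_right, planeWave_latVec_recip hL, mul_one]

lemma cellCoeff_eq (f : Sp d → ℂ) (m : Fin d → ℤ) :
    cellCoeff L f m = ∫ x in cell L, f x * planeWave (-latVec (recip L) m) x := by
  simp only [cellCoeff, conj_planeWave, mul_comm]

lemma setIntegral_mul_partialDeriv_planeWave (f : Sp d → ℂ) (j : Fin d) (m : Fin d → ℤ) :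
    ∫ x in cell L, f x * partialDeriv j (planeWave (-latVec (recip L) m)) x
      = -(Complex.I * (latVec (recip L) m j : ℂ)) * cellCoeff L f m := by
  rw [cellCoeff_eq, ← integral_const_mul]
  refine integral_congr_ae (ae_of_all _ fun x => ?_)
  simp only [partialDeriv_planeWave, PiLp.neg_apply]
  push_cast
  ring

lemma IsBlochBasis.cellCoeff_grad (hb : IsBlochBasis L W E v dv) (hL : L.det ≠ 0) (n : ℕ)
    (j : Fin d) (m : Fin d → ℤ) :
    cellCoeff L (dv n j) m = Complex.I * (latVec (recip L) m j : ℂ) * cellCoeff L (v n) m := by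
  have hweak := hb.weak_grad n j _ (isPerTest_planeWave hL m)
  rw [setIntegral_mul_partialDeriv_planeWave, ← cellCoeff_eq] at hweak
  linear_combination hweak

lemma IsBlochBasis.cellCoeff_eigen (hb : IsBlochBasis L W E v dv) (hL : L.det ≠ 0) (n : ℕ)
    (m : Fin d → ℤ) :
    (1 / 2 : ℂ) * ∑ j, (-(Complex.I * (latVec (recip L) m j : ℂ))) * cellCoeff L (dv n j) m
      + cellCoeff L (fun x => (W x : ℂ) * v n x) m = (E n : ℂ) * cellCoeff L (v n) m := by
  have heigen := hb.eigen n _ (isPerTest_planeWave hL m)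
  simp only [setIntegral_mul_partialDeriv_planeWave] at heigen
  rwa [cellCoeff_eq (v n), cellCoeff_eq (fun x => (W x : ℂ) * v n x)]

lemma IsBlochBasis.integral_conj_mul_grad (hb : IsBlochBasis L W E v dv) (hL : L.det ≠ 0)
    (n n' : ℕ) (j : Fin d) : ∫ x in cell L, conj (v n x) * dv n' j x
      = -∫ x in cell L, conj (dv n j x) * v n' x := by
  have hdet : ((|L.det| : ℝ) : ℂ) ≠ 0 := by exact_mod_cast (abs_pos.2 hL).ne'
  have hcoeff : ∀ m, -(conj (cellCoeff L (dv n j) m) * cellCoeff L (v n') m)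
      = conj (cellCoeff L (v n) m) * cellCoeff L (dv n' j) m := by
    intro m
    rw [hb.cellCoeff_grad hL, hb.cellCoeff_grad hL, map_mul, map_mul, Complex.conj_I,
      Complex.conj_ofReal]
    ring
  have hparseval := (hasSum_conj_cellCoeff_mul hL (hb.memLp n) (hb.grad_memLp n' j)).unique
    ((hasSum_conj_cellCoeff_mul hL (hb.grad_memLp n j) (hb.memLp n')).neg.congr_fun
      fun m => (hcoeff m).symm)
  rw [← mul_neg] at hparseval
  exact mul_left_cancel₀ hdet hparseval

/-- The crystal potential as a weight. -/
def potWeight (hW : IsCrystalPotential L W) : Weight (Sp d) where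
  toFun := W
  meas := hW.measurable
  bound := |hW.bounded.choose|
  bound_nonneg := abs_nonneg _
  abs_le x := by
    rw [abs_of_nonneg (zero_le_one.trans (hW.one_le x))]
    exact (hW.bounded.choose_spec x).trans (le_abs_self _)

lemma IsBlochBasis.energy_form (hb : IsBlochBasis L W E v dv) (hW : IsCrystalPotential L W)
    (hL : L.det ≠ 0) (n n' : ℕ) :
    (1 / 2 : ℂ) * ∑ j, (∫ x in cell L, conj (dv n j x) * dv n' j x)
      + ∫ x in cell L, conj (v n x) * ((W x : ℂ) * v n' x)
      = (E n' : ℂ) * ∫ x in cell L, conj (v n x) * v n' x := by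
  have hdet : ((|L.det| : ℝ) : ℂ) ≠ 0 := by exact_mod_cast (abs_pos.2 hL).ne'
  have hkinetic := (hasSum_sum (s := Finset.univ) fun j _ =>
    hasSum_conj_cellCoeff_mul hL (hb.grad_memLp n j) (hb.grad_memLp n' j)).mul_left (1 / 2 : ℂ)
  have hpotential := hasSum_conj_cellCoeff_mul (g := fun x => (W x : ℂ) * v n' x) hL (hb.memLp n)
    ((potWeight hW).memLp_mul (hb.memLp n'))
  have hmass := (hasSum_conj_cellCoeff_mul hL (hb.memLp n) (hb.memLp n')).mul_left (E n' : ℂ)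
  have hcoeff : ∀ m, (E n' : ℂ) * (conj (cellCoeff L (v n) m) * cellCoeff L (v n') m)
      = (1 / 2 : ℂ) * ∑ j, conj (cellCoeff L (dv n j) m) * cellCoeff L (dv n' j) m
        + conj (cellCoeff L (v n) m) * cellCoeff L (fun x => (W x : ℂ) * v n' x) m := by
    intro m
    have hgrad : ∀ j, conj (cellCoeff L (dv n j) m) * cellCoeff L (dv n' j) m
        = conj (cellCoeff L (v n) m) *
          (-(Complex.I * (latVec (recip L) m j : ℂ)) * cellCoeff L (dv n' j) m) := by
      intro j
      rw [hb.cellCoeff_grad hL n, map_mul, map_mul, Complex.conj_I, Complex.conj_ofReal]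
      ring
    simp only [hgrad, ← Finset.mul_sum]
    linear_combination -(conj (cellCoeff L (v n) m)) * hb.cellCoeff_eigen hL n' m
  have hparseval := ((hkinetic.add hpotential).congr_fun hcoeff).unique hmass
  rw [← Finset.mul_sum] at hparseval
  refine mul_left_cancel₀ hdet ?_
  linear_combination hparseval

end Bloch

section SkewForm

variable {𝓗 : Type*} [NormedAddCommGroup 𝓗] [InnerProductSpace ℂ 𝓗] {ι : Type*}

lemma re_inner_eq_zero_of_skew {e D : ι → 𝓗}
    (hskew : ∀ n m, inner ℂ (e n) (D m) = -inner ℂ (D n) (e m)) {c : ι → ℂ} {φ ψ : 𝓗}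
    (hφ : HasSum (fun n => c n • e n) φ) (hψ : HasSum (fun n => c n • D n) ψ) :
    (inner ℂ φ ψ).re = 0 := by
  have hlim : Tendsto (fun s : Finset ι => inner ℂ (∑ n ∈ s, c n • e n) (∑ n ∈ s, c n • D n)
      + inner ℂ (∑ n ∈ s, c n • D n) (∑ n ∈ s, c n • e n)) atTop
      (𝓝 (inner ℂ φ ψ + inner ℂ ψ φ)) :=
    (Tendsto.inner hφ hψ).add (Tendsto.inner hψ hφ)
  have hpartial : ∀ s : Finset ι, inner ℂ (∑ n ∈ s, c n • e n) (∑ n ∈ s, c n • D n)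
      + inner ℂ (∑ n ∈ s, c n • D n) (∑ n ∈ s, c n • e n) = 0 := by
    intro s
    simp only [sum_inner, inner_sum, inner_smul_left, inner_smul_right, hskew, mul_neg,
      Finset.sum_neg_distrib, neg_add_cancel]
  simp only [hpartial] at hlim
  have hsum := congrArg Complex.re (tendsto_nhds_unique hlim tendsto_const_nhds)
  rw [← inner_conj_symm ψ φ, Complex.add_re, Complex.conj_re, Complex.zero_re] at hsum
  linarith

lemma hasSum_conj_mul_inner {e : ι → 𝓗} {c : ι → ℂ} {φ : 𝓗}
    (hφ : HasSum (fun n => c n • e n) φ) (ψ : 𝓗) :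
    HasSum (fun n => conj (c n) * inner ℂ (e n) ψ) (inner ℂ φ ψ) := by
  have hconj := ((innerSL ℂ ψ).hasSum hφ).map (starRingEnd ℂ) Complex.continuous_conj
  simpa only [Function.comp_def, innerSL_apply_apply, inner_conj_symm, inner_smul_left] using hconj

lemma half_sum_norm_sq_add_re_inner {J : Type*} [Fintype J] [DecidableEq ι] {e : ι → 𝓗}
    {D : J → ι → 𝓗} {T : 𝓗 →L[ℂ] 𝓗} {E : ι → ℝ}
    (hform : ∀ n n', (1 / 2 : ℂ) * ∑ j, inner ℂ (D j n) (D j n') + inner ℂ (e n) (T (e n'))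
      = (E n' : ℂ) * if n = n' then 1 else 0) (s : Finset ι) (c : ι → ℂ) :
    1 / 2 * ∑ j, ‖∑ n ∈ s, c n • D j n‖ ^ 2
        + (inner ℂ (∑ n ∈ s, c n • e n) (T (∑ n ∈ s, c n • e n))).re
      = ∑ n ∈ s, E n * ‖c n‖ ^ 2 := by
  have hdiag : ∑ n ∈ s, ∑ n' ∈ s, conj (c n) * c n' * ((E n' : ℂ) * if n = n' then 1 else 0)
      = ((∑ n ∈ s, E n * ‖c n‖ ^ 2 : ℝ) : ℂ) := by
    rw [Complex.ofReal_sum]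
    refine Finset.sum_congr rfl fun n hn => ?_
    rw [Finset.sum_eq_single_of_mem n hn fun m _ hm => by simp [hm.symm], if_pos rfl,
      Complex.conj_mul']
    push_cast
    ring
  have hexpand : (1 / 2 : ℂ) * ∑ j, inner ℂ (∑ n ∈ s, c n • D j n) (∑ n ∈ s, c n • D j n)
      + inner ℂ (∑ n ∈ s, c n • e n) (T (∑ n ∈ s, c n • e n))
      = ∑ n ∈ s, ∑ n' ∈ s, conj (c n) * c n' *
        ((1 / 2 : ℂ) * ∑ j, inner ℂ (D j n) (D j n') + inner ℂ (e n) (T (e n'))) := by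
    simp only [map_sum, map_smul, sum_inner, inner_sum, inner_smul_left, inner_smul_right, mul_add,
      Finset.sum_add_distrib]
    congr 1
    · conv_rhs => rw [Finset.sum_comm]
      simp only [Finset.mul_sum]
      rw [Finset.sum_comm]
      refine Finset.sum_congr rfl fun n' _ => ?_
      rw [Finset.sum_comm]
      exact Finset.sum_congr rfl fun n _ => Finset.sum_congr rfl fun j _ => by ring
    · simp only [Finset.mul_sum]
      rw [Finset.sum_comm]
      exact Finset.sum_congr rfl fun n _ => Finset.sum_congr rfl fun n' _ => by ring
  simp only [hform] at hexpand
  rw [hdiag] at hexpand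
  have hre := congrArg Complex.re hexpand
  rw [Complex.add_re, Complex.ofReal_re] at hre
  rw [← hre]
  congr 1
  simp only [inner_self_eq_norm_sq_to_K]
  rw [← Complex.ofReal_re (1 / 2 * ∑ j, ‖∑ n ∈ s, c n • D j n‖ ^ 2)]
  push_cast
  rfl

variable [CompleteSpace 𝓗]

lemma summable_smul_of_norm_sq_sum_le {D : ι → 𝓗} {b : ι → ℝ} {c : ι → ℂ} {K : ℝ}
    (hbound : ∀ s : Finset ι, ‖∑ n ∈ s, c n • D n‖ ^ 2 ≤ K * ∑ n ∈ s, b n)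
    (hb : Summable b) : Summable fun n => c n • D n := by
  rw [summable_iff_vanishing_norm]
  intro δ hδ
  obtain ⟨s, hs⟩ := summable_iff_vanishing_norm.1 (hb.mul_left K) (δ ^ 2) (by positivity)
  refine ⟨s, fun t ht => lt_of_pow_lt_pow_left₀ 2 hδ.le ?_⟩
  refine (hbound t).trans_lt ((le_abs_self _).trans_lt ?_)
  rw [Finset.mul_sum]
  exact hs t ht

lemma exists_hasSum_skew {e D : ι → 𝓗} (he : Orthonormal ℂ e)
    (hskew : ∀ n m, inner ℂ (e n) (D m) = -inner ℂ (D n) (e m)) {E : ι → ℝ} {K : ℝ} {c : ι → ℂ}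
    (hbound : ∀ s : Finset ι, ‖∑ n ∈ s, c n • D n‖ ^ 2 ≤ K * ∑ n ∈ s, E n * ‖c n‖ ^ 2)
    (hc : Summable fun n => ‖c n‖ ^ 2) (hEc : Summable fun n => ‖(E n : ℂ) * c n‖ ^ 2) :
    (∀ n, Summable fun m => inner ℂ (e n) (D m) * c m) ∧
    ∃ x : ℂ, x.re = 0 ∧
      HasSum (fun n => conj (c n) * ∑' m, inner ℂ (e n) (D m) * c m) x := by
  have henergy : Summable fun n => E n * ‖c n‖ ^ 2 := by
    refine Summable.of_norm_bounded (hc.add hEc) fun n => ?_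
    rw [norm_mul, norm_pow, norm_norm, Complex.norm_mul, Complex.norm_real, mul_pow]
    nlinarith [sq_nonneg (‖E n‖ - 1), sq_nonneg ‖c n‖, mul_nonneg (sq_nonneg (‖E n‖ - 1))
      (sq_nonneg ‖c n‖)]
  obtain ⟨φ, hφ⟩ : Summable fun n => c n • e n :=
    (he.orthogonalFamily.summable_iff_norm_sq_summable (f := c)).2 hc
  obtain ⟨ψ, hψ⟩ := summable_smul_of_norm_sq_sum_le hbound henergy
  have hinner : ∀ n, HasSum (fun m => inner ℂ (e n) (D m) * c m) (inner ℂ (e n) ψ) := fun n => by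
    simpa only [innerSL_apply_apply, inner_smul_right, mul_comm] using hψ.mapL (innerSL ℂ (e n))
  refine ⟨fun n => (hinner n).summable, inner ℂ φ ψ, re_inner_eq_zero_of_skew hskew hφ hψ, ?_⟩
  simpa only [(hinner _).tsum_eq] using hasSum_conj_mul_inner hφ ψ

end SkewForm

section Akp

variable {L : Matrix (Fin d) (Fin d) ℝ} {W : Sp d → ℝ} {E : ℕ → ℝ} {v : ℕ → Sp d → ℂ}
  {dv : ℕ → Fin d → Sp d → ℂ}

lemma inner_toLp {X : Type*} [MeasurableSpace X] {μ : Measure X} {f g : X → ℂ}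
    (hf : MemLp f 2 μ) (hg : MemLp g 2 μ) :
    inner ℂ (hf.toLp f) (hg.toLp g) = ∫ x, conj (f x) * g x ∂μ := by
  rw [L2.inner_def]
  refine integral_congr_ae ?_
  filter_upwards [hf.coeFn_toLp, hg.coeFn_toLp] with x hfx hgx
  rw [hfx, hgx, RCLike.inner_apply, mul_comm]

lemma IsBlochBasis.orthonormal_toLp (hb : IsBlochBasis L W E v dv) :
    Orthonormal ℂ fun n => (hb.memLp n).toLp (v n) :=
  orthonormal_iff_ite.2 fun n m => by rw [inner_toLp, hb.orthonormal]

lemma Weight.mul_toLp {X : Type*} [MeasurableSpace X] {μ : Measure X} (a : Weight X) {f : X → ℂ}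
    (hf : MemLp f 2 μ) : a.mul μ (hf.toLp f) = (a.memLp_mul hf).toLp _ := by
  ext1
  filter_upwards [a.coeFn_mul (hf.toLp f), hf.coeFn_toLp, (a.memLp_mul hf).coeFn_toLp]
    with x hmul hfx hafx
  rw [hmul, hafx, hfx]

lemma Weight.re_inner_mul_nonneg {X : Type*} [MeasurableSpace X] {μ : Measure X} (a : Weight X)
    (ha : ∀ x, 0 ≤ a.toFun x) (f : Lp ℂ 2 μ) : 0 ≤ (inner ℂ f (a.mul μ f)).re := by
  have hre := integral_re (L2.integrable_inner (𝕜 := ℂ) f (a.mul μ f))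
  simp only [RCLike.re_eq_complex_re] at hre
  rw [L2.inner_def, ← hre]
  refine integral_nonneg_of_ae ?_
  filter_upwards [a.coeFn_mul f] with x hx
  rw [hx, RCLike.inner_apply, mul_assoc, Complex.mul_conj, ← Complex.ofReal_mul,
    Complex.ofReal_re]
  exact mul_nonneg (ha x) (Complex.normSq_nonneg _)

lemma IsBlochBasis.norm_grad_sq_le (hb : IsBlochBasis L W E v dv) (hW : IsCrystalPotential L W)
    (hL : L.det ≠ 0) (j : Fin d) (c : ℕ → ℂ) (s : Finset ℕ) :
    ‖∑ n ∈ s, c n • (hb.grad_memLp n j).toLp (dv n j)‖ ^ 2 ≤ 2 * ∑ n ∈ s, E n * ‖c n‖ ^ 2 := by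
  have henergy := half_sum_norm_sq_add_re_inner (e := fun n => (hb.memLp n).toLp (v n))
    (D := fun j n => (hb.grad_memLp n j).toLp (dv n j)) (T := (potWeight hW).mul _) (E := E)
    (fun n n' => by
      simp only [Weight.mul_toLp, inner_toLp, ← hb.orthonormal]
      exact hb.energy_form hW hL n n') s c
  have hpotential := (potWeight hW).re_inner_mul_nonneg (fun x => zero_le_one.trans (hW.one_le x))
    (∑ n ∈ s, c n • (hb.memLp n).toLp (v n))
  have hkinetic := Finset.single_le_sum
    (f := fun j => ‖∑ n ∈ s, c n • (hb.grad_memLp n j).toLp (dv n j)‖ ^ 2)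
    (fun _ _ => sq_nonneg _) (Finset.mem_univ j)
  linarith

lemma IsBlochBasis.exists_hasSum_gradElem (hb : IsBlochBasis L W E v dv)
    (hW : IsCrystalPotential L W) (hL : L.det ≠ 0) (j : Fin d) {c : ℕ → ℂ}
    (hc : Summable fun n => ‖c n‖ ^ 2) (hEc : Summable fun n => ‖(E n : ℂ) * c n‖ ^ 2) :
    (∀ n, Summable fun m => gradElem L v dv n m j * c m) ∧
    ∃ x : ℂ, x.re = 0 ∧
      HasSum (fun n => conj (c n) * ∑' m, gradElem L v dv n m j * c m) x := by
  have hskew := exists_hasSum_skew (D := fun n => (hb.grad_memLp n j).toLp (dv n j))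
    hb.orthonormal_toLp
    (fun n m => by rw [inner_toLp, inner_toLp, hb.integral_conj_mul_grad hL])
    (hb.norm_grad_sq_le hW hL j c) hc hEc
  simpa only [inner_toLp, gradElem] using hskew

lemma IsBlochBasis.hasSum_kp (hb : IsBlochBasis L W E v dv) (hW : IsCrystalPotential L W)
    (hL : L.det ≠ 0) (k : Sp d) {c : ℕ → ℂ} (hc : Summable fun n => ‖c n‖ ^ 2)
    (hEc : Summable fun n => ‖(E n : ℂ) * c n‖ ^ 2) (n : ℕ) :
    HasSum (fun m => (∑ j, (k j : ℂ) * gradElem L v dv n m j) * c m)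
      (∑ j, (k j : ℂ) * ∑' m, gradElem L v dv n m j * c m) := by
  have hcomponents := hasSum_sum (s := Finset.univ) fun j _ =>
    (((hb.exists_hasSum_gradElem hW hL j hc hEc).1 n).hasSum).mul_left (k j : ℂ)
  refine hcomponents.congr_fun fun m => ?_
  simp only [Finset.sum_mul, mul_assoc]

lemma im_neg_I_div_mul {z : ℂ} (hz : z.re = 0) (ε : ℝ) : (-(Complex.I / (ε : ℂ)) * z).im = 0 := by
  rw [neg_mul, div_mul_eq_mul_div, Complex.neg_im, Complex.div_ofReal_im, Complex.I_mul_im, hz,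
    zero_div, neg_zero]

lemma IsBlochBasis.hasSum_im_fiber (hb : IsBlochBasis L W E v dv) (hW : IsCrystalPotential L W)
    (hL : L.det ≠ 0) (ε : ℝ) (k : Sp d) {c : ℕ → ℂ} (hc : Summable fun n => ‖c n‖ ^ 2)
    (hEc : Summable fun n => ‖(E n : ℂ) * c n‖ ^ 2) :
    HasSum (fun n => (conj (c n) * (((E n / ε ^ 2 + ‖k‖ ^ 2 / 2 : ℝ) : ℂ) * c n
      - Complex.I / (ε : ℂ) * ∑' m, (∑ j, (k j : ℂ) * gradElem L v dv n m j) * c m)).im) 0 := by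
  choose x hx hsum using fun j => (hb.exists_hasSum_gradElem hW hL j hc hEc).2
  have hre : (∑ j, (k j : ℂ) * x j).re = 0 := by
    simp only [Complex.re_sum, Complex.re_ofReal_mul, hx, mul_zero, Finset.sum_const_zero]
  have him := ((hasSum_sum (s := Finset.univ) fun j _ => (hsum j).mul_left (k j : ℂ)).mul_left
    (-(Complex.I / (ε : ℂ)))).mapL Complex.imCLM
  simp only [Complex.imCLM_apply, im_neg_I_div_mul hre] at him
  refine him.congr_fun fun n => ?_
  have hsplit : conj (c n) * (((E n / ε ^ 2 + ‖k‖ ^ 2 / 2 : ℝ) : ℂ) * c n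
      - Complex.I / (ε : ℂ) * ∑ j, (k j : ℂ) * ∑' m, gradElem L v dv n m j * c m)
      = (((E n / ε ^ 2 + ‖k‖ ^ 2 / 2) * ‖c n‖ ^ 2 : ℝ) : ℂ) + -(Complex.I / (ε : ℂ)) *
          ∑ j, (k j : ℂ) * (conj (c n) * ∑' m, gradElem L v dv n m j * c m) := by
    simp only [mul_left_comm _ (conj (c n)), ← Finset.mul_sum]
    push_cast
    linear_combination
      ((E n : ℂ) / (ε : ℂ) ^ 2 + (‖k‖ : ℂ) ^ 2 / 2) * Complex.conj_mul' (c n)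
  rw [(hb.hasSum_kp hW hL k hc hEc n).tsum_eq, hsplit, Complex.add_im, Complex.ofReal_im, zero_add]

lemma lintegral_enorm_sq_coeFn {X : Type*} [MeasurableSpace X] {μ : Measure X} (f : Lp ℂ 2 μ) :
    ∫⁻ x, ‖f x‖ₑ ^ 2 ∂μ = ENNReal.ofReal (‖f‖ ^ 2) := by
  rw [← sq_eLpNorm_two, ENNReal.ofReal_pow (norm_nonneg _), Lp.norm_def,
    ENNReal.ofReal_toReal (Lp.eLpNorm_ne_top _)]

lemma summable_norm_sq (g : EnvSpace d) : Summable fun n => ‖g n‖ ^ 2 := by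
  simpa using (lp.hasSum_norm (p := 2) (by norm_num) g).summable

lemma ae_summable_sq (g : EnvSpace d) : ∀ᵐ k : Sp d, Summable fun n => ‖g n k‖ ^ 2 := by
  have hmeas : ∀ n, AEMeasurable (fun k : Sp d => ‖g n k‖ₑ ^ 2) :=
    fun n => (Lp.aestronglyMeasurable (g n)).enorm.pow_const 2
  have hfinite : ∫⁻ k : Sp d, ∑' n, ‖g n k‖ₑ ^ 2 ≠ ⊤ := by
    rw [lintegral_tsum hmeas]
    simp only [lintegral_enorm_sq_coeFn]
    exact (summable_norm_sq g).tsum_ofReal_ne_top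
  filter_upwards [ae_lt_top' (AEMeasurable.tsum hmeas) hfinite] with k hk
  have hnn : Summable fun n => ‖g n k‖₊ ^ 2 := by
    rw [← ENNReal.tsum_coe_ne_top_iff_summable]
    exact hk.ne
  simpa only [NNReal.coe_pow, coe_nnnorm] using NNReal.summable_coe.2 hnn

lemma coeFn_sub_env (g g' : EnvSpace d) :
    ∀ᵐ k : Sp d, ∀ n, (g - g') n k = g n k - g' n k :=
  ae_all_iff.2 fun n => Lp.coeFn_sub (g n) (g' n)

lemma IsAkp.sub (hb : IsBlochBasis L W E v dv) (hW : IsCrystalPotential L W) (hL : L.det ≠ 0)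
    {ε : ℝ} {g g' h h' : EnvSpace d} (hg : IsAkp E (gradElem L v dv) ε g h)
    (hg' : IsAkp E (gradElem L v dv) ε g' h') :
    IsAkp E (gradElem L v dv) ε (g - g') (h - h') := by
  filter_upwards [hg, hg', coeFn_sub_env g g', coeFn_sub_env h h', ae_summable_sq g,
    ae_summable_sq g'] with k ⟨hEg, hgh⟩ ⟨hEg', hgh'⟩ hsub hsub' hsq hsq'
  refine ⟨?_, fun n => ?_⟩
  · refine Summable.of_nonneg_of_le (fun _ => sq_nonneg _) (fun n => ?_)
      ((hEg.mul_left 2).add (hEg'.mul_left 2))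
    rw [hsub, mul_sub]
    have htriangle := norm_sub_le ((E n : ℂ) * g n k) ((E n : ℂ) * g' n k)
    nlinarith [sq_nonneg (‖(E n : ℂ) * g n k‖ - ‖(E n : ℂ) * g' n k‖),
      norm_nonneg ((E n : ℂ) * g n k - (E n : ℂ) * g' n k)]
  · have hkp := hb.hasSum_kp hW hL k hsq hEg n
    have hkp' := hb.hasSum_kp hW hL k hsq' hEg' n
    have hkp_sub := (hkp.sub hkp').tsum_eq
    simp only [← mul_sub] at hkp_sub
    simp only [hsub, hkp_sub]
    rw [hsub', hgh, hgh', hkp.tsum_eq, hkp'.tsum_eq]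
    ring

lemma coeFn_env (a : Weight (Sp d)) (g : EnvSpace d) :
    ∀ᵐ k : Sp d, ∀ n, a.env volume g n k = (a.toFun k : ℂ) * g n k :=
  ae_all_iff.2 fun n => by
    rw [Weight.env_apply]
    exact a.coeFn_mul (g n)

lemma IsAkp.env (a : Weight (Sp d)) {P : ℕ → ℕ → Fin d → ℂ} {ε : ℝ} {g h : EnvSpace d}
    (hg : IsAkp E P ε g h) : IsAkp E P ε (a.env volume g) (a.env volume h) := by
  filter_upwards [hg, coeFn_env a g, coeFn_env a h] with k ⟨hEg, hgh⟩ hag hah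
  refine ⟨?_, fun n => ?_⟩
  · simpa only [hag, norm_mul, mul_pow, mul_left_comm] using
      hEg.mul_left (‖(a.toFun k : ℂ)‖ ^ 2)
  · simp only [hag, hah, hgh, mul_left_comm _ (a.toFun k : ℂ), tsum_mul_left]
    ring

lemma integrable_conj_mul (g h : EnvSpace d) (n : ℕ) :
    Integrable fun k : Sp d => conj (g n k) * h n k := by
  simpa only [RCLike.inner_apply, mul_comm] using L2.integrable_inner (𝕜 := ℂ) (g n) (h n)

lemma integral_norm_sq_coeFn {X : Type*} [MeasurableSpace X] {μ : Measure X} (f : Lp ℂ 2 μ) :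
    ∫ x, ‖f x‖ ^ 2 ∂μ = ‖f‖ ^ 2 := by
  rw [integral_eq_lintegral_of_nonneg_ae (ae_of_all _ fun _ => sq_nonneg _)
    ((Lp.aestronglyMeasurable f).norm.pow 2)]
  simp only [ENNReal.ofReal_pow (norm_nonneg _), ofReal_norm]
  rw [lintegral_enorm_sq_coeFn, ENNReal.toReal_ofReal (sq_nonneg _)]

lemma integral_norm_im_le (g h : EnvSpace d) (n : ℕ) :
    ∫ k : Sp d, ‖(conj (g n k) * h n k).im‖ ≤ ‖g n‖ ^ 2 + ‖h n‖ ^ 2 := by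
  have hsq : ∀ f : Lp ℂ 2 (volume : Measure (Sp d)), Integrable fun k => ‖f k‖ ^ 2 :=
    fun f => (Lp.memLp f).integrable_norm_pow (p := 2) (by norm_num)
  rw [← integral_norm_sq_coeFn, ← integral_norm_sq_coeFn, ← integral_add (hsq _) (hsq _)]
  refine integral_mono (integrable_conj_mul g h n).im.norm ((hsq _).add (hsq _)) fun k => ?_
  have hnorm : ‖(conj (g n k) * h n k).im‖ ≤ ‖g n k‖ * ‖h n k‖ :=
    (Complex.abs_im_le_norm _).trans_eq (by rw [norm_mul, RCLike.norm_conj])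
  refine hnorm.trans ?_
  change _ ≤ ‖g n k‖ ^ 2 + ‖h n k‖ ^ 2
  nlinarith [two_mul_le_add_sq ‖g n k‖ ‖h n k‖, norm_nonneg (g n k), norm_nonneg (h n k),
    mul_nonneg (norm_nonneg (g n k)) (norm_nonneg (h n k))]

lemma im_inner_eq_integral_tsum (g h : EnvSpace d) :
    (inner ℂ g h).im = ∫ k : Sp d, ∑' n, (conj (g n k) * h n k).im := by
  have him : ∀ n, (inner ℂ (g n) (h n)).im = ∫ k : Sp d, (conj (g n k) * h n k).im := by
    intro n
    have hcomm := integral_im (integrable_conj_mul g h n)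
    simp only [RCLike.im_eq_complex_im] at hcomm
    rw [hcomm, L2.inner_def]
    simp only [RCLike.inner_apply, mul_comm]
  have hinner := (lp.hasSum_inner (𝕜 := ℂ) g h).mapL Complex.imCLM
  simp only [Complex.imCLM_apply, him] at hinner
  refine hinner.unique (hasSum_integral_of_summable_integral_norm
    (fun n => (integrable_conj_mul g h n).im) ?_)
  exact Summable.of_nonneg_of_le (fun _ => integral_nonneg fun _ => norm_nonneg _)
    (integral_norm_im_le g h) ((summable_norm_sq g).add (summable_norm_sq h))

lemma IsAkp.inner_im (hb : IsBlochBasis L W E v dv) (hW : IsCrystalPotential L W)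
    (hL : L.det ≠ 0) {ε : ℝ} {g h : EnvSpace d} (hg : IsAkp E (gradElem L v dv) ε g h) :
    (inner ℂ g h).im = 0 := by
  rw [im_inner_eq_integral_tsum]
  refine integral_eq_zero_of_ae ?_
  filter_upwards [hg, ae_summable_sq g] with k ⟨hEg, hgh⟩ hsq
  simp only [hgh]
  exact (hb.hasSum_im_fiber hW hL ε k hsq hEg).tsum_eq

end Akp

/-! ### Energy estimate for mild solutions -/

section SlidingMean

variable {H : Type*} [NormedAddCommGroup H] [NormedSpace ℝ H] {g : ℝ → H}

/-- The mean of `g` over `[s, s + h]`. For a mild solution `g` it takes values in the domain and is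
a classical solution of the equation, even if `g` itself is neither. -/
def steklov (g : ℝ → H) (h s : ℝ) : H :=
  h⁻¹ • ∫ x in s..s + h, g x

lemma steklov_eq (hg : Continuous g) (h s : ℝ) :
    steklov g h s = h⁻¹ • ((∫ x in (0 : ℝ)..s + h, g x) - ∫ x in (0 : ℝ)..s, g x) := by
  rw [steklov, intervalIntegral.integral_interval_sub_left (hg.intervalIntegrable _ _)
    (hg.intervalIntegrable _ _)]

variable [CompleteSpace H]

lemma hasDerivAt_steklov (hg : Continuous g) (h s : ℝ) :
    HasDerivAt (steklov g h) (h⁻¹ • (g (s + h) - g s)) s := by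
  have hprim : ∀ t, HasDerivAt (fun t => ∫ x in (0 : ℝ)..t, g x) (g t) t := fun t =>
    (hg.integral_hasStrictDerivAt 0 t).hasDerivAt
  rw [funext (steklov_eq hg h)]
  exact (((hprim (s + h)).comp_add_const s h).sub (hprim s)).const_smul h⁻¹

lemma tendsto_steklov (hg : Continuous g) (s : ℝ) :
    Tendsto (fun h => steklov g h s) (𝓝[>] 0) (𝓝 (g s)) := by
  simp only [steklov_eq hg]
  exact (hg.integral_hasStrictDerivAt 0 s).hasDerivAt.tendsto_slope_zero_right

end SlidingMean

lemma continuous_comp_max_zero {X : Type*} [TopologicalSpace X] {g : ℝ → X}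
    (hg : ContinuousOn g (Ici 0)) : Continuous fun s => g (max 0 s) :=
  hg.comp_continuous (by fun_prop) fun _ => mem_Ici.2 (le_max_left _ _)

section Energy

variable {H : Type*} [NormedAddCommGroup H] [InnerProductSpace ℂ H]

lemma re_inner_neg_I_smul_add {x a : H} (ha : (inner ℂ x a).im = 0) (b : H) :
    (inner ℂ x (-(Complex.I • (a + b)))).re = (inner ℂ x b).im := by
  rw [inner_neg_right, inner_smul_right, inner_add_right, Complex.neg_re, Complex.I_mul_re,
    Complex.add_im, ha, zero_add, neg_neg]

variable [NormedSpace ℝ H]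

lemma hasDerivAt_norm_sq {F : ℝ → H} {F' : H} {t : ℝ} (hF : HasDerivAt F F' t) :
    HasDerivAt (fun s => ‖F s‖ ^ 2) (2 * (inner ℂ (F t) F').re) t := by
  have hre := Complex.reCLM.hasFDerivAt.comp_hasDerivAt t (hF.inner ℂ hF)
  have hnorm : ∀ s, Complex.reCLM (inner ℂ (F s) (F s)) = ‖F s‖ ^ 2 := fun s =>
    inner_self_eq_norm_sq (𝕜 := ℂ) (F s)
  rw [Complex.reCLM_apply, Complex.add_re, ← inner_conj_symm F', Complex.conj_re, ← two_mul] at hre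
  exact hre.congr_of_eventuallyEq (Eventually.of_forall fun s => (hnorm s).symm)

lemma sq_norm_le_of_symmetric_evolution {F : ℝ → H} {t c η : ℝ} (hc : 0 ≤ c) (ht : 0 ≤ t)
    (hF : ∀ s, 0 ≤ s → s ≤ t → ∃ a b, HasDerivAt F (-(Complex.I • (a + b))) s ∧
      (inner ℂ (F s) a).im = 0 ∧ ‖b‖ ≤ c * ‖F s‖ + η) :
    ‖F t‖ ^ 2 ≤ (‖F 0‖ ^ 2 + η ^ 2) * Real.exp ((2 * c + 1) * t) := by
  have hrate : ∀ s ∈ Icc 0 t, ∃ x, HasDerivAt (fun s => ‖F s‖ ^ 2) x s ∧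
      x ≤ (2 * c + 1) * ‖F s‖ ^ 2 + η ^ 2 := by
    intro s hs
    obtain ⟨a, b, hderiv, ha, hb⟩ := hF s hs.1 hs.2
    refine ⟨_, hasDerivAt_norm_sq hderiv, ?_⟩
    have hcauchy : (inner ℂ (F s) b).im ≤ ‖F s‖ * ‖b‖ :=
      ((le_abs_self _).trans (Complex.abs_im_le_norm _)).trans (norm_inner_le_norm _ _)
    rw [re_inner_neg_I_smul_add ha]
    nlinarith [mul_le_mul_of_nonneg_left hb (norm_nonneg (F s)), sq_nonneg (‖F s‖ - η)]
  choose! f' hf' hbound using hrate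
  have hgronwall := le_gronwallBound_of_liminf_deriv_right_le (f := fun s => ‖F s‖ ^ 2) (f' := f')
    (δ := ‖F 0‖ ^ 2) (fun s hs => (hf' s hs).continuousAt.continuousWithinAt)
    (fun s hs r hr =>
      (hf' s (Ico_subset_Icc_self hs)).hasDerivWithinAt.liminf_right_slope_le hr)
    le_rfl (fun s hs => hbound s (Ico_subset_Icc_self hs)) t (right_mem_Icc.2 ht)
  refine hgronwall.trans ?_
  rw [gronwallBound_of_K_ne_0 (by positivity), sub_zero]
  have hdiv : η ^ 2 / (2 * c + 1) ≤ η ^ 2 := div_le_self (sq_nonneg _) (by linarith)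
  have hdiv_nonneg : 0 ≤ η ^ 2 / (2 * c + 1) := by positivity
  nlinarith [mul_le_mul_of_nonneg_right hdiv (Real.exp_pos ((2 * c + 1) * t)).le]

/-- A real-linear relation `A x a`, read `a = A x`, that is the graph of a symmetric operator; its
domain need not be dense. -/
structure IsSymmetricGraph (A : H → H → Prop) : Prop where
  eq_zero : ∀ {a}, A 0 a → a = 0
  sub : ∀ {x y a b}, A x a → A y b → A (x - y) (a - b)
  smul : ∀ (r : ℝ) {x a}, A x a → A (r • x) (r • a)
  inner_im : ∀ {x a}, A x a → (inner ℂ x a).im = 0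

/-- Mild solutions of `i ∂ₜ g = (A + U) g`, `g 0 = g₀`, for an operator given by its graph `A` and
a bounded perturbation `U`. -/
structure IsMildFlow (A : H → H → Prop) (U : H →L[ℂ] H) (g₀ : H) (g : ℝ → H) : Prop where
  continuousOn : ContinuousOn g (Ici 0)
  exists_eq : ∀ t, 0 ≤ t → ∃ a, A (∫ s in (0 : ℝ)..t, g s) a ∧
    g t = g₀ - Complex.I • (a + U (∫ s in (0 : ℝ)..t, g s))

variable {A : H → H → Prop} {U U₀ M : H →L[ℂ] H} {g₀ : H} {g f : ℝ → H} {c η h s t : ℝ}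

lemma IsMildFlow.comp_max (hg : IsMildFlow A U g₀ g) :
    IsMildFlow A U g₀ fun s => g (max 0 s) where
  continuousOn := (continuous_comp_max_zero hg.continuousOn).continuousOn
  exists_eq t ht := by
    have hint : ∫ s in (0 : ℝ)..t, g (max 0 s) = ∫ s in (0 : ℝ)..t, g s :=
      intervalIntegral.integral_congr fun s hs => by
        rw [uIcc_of_le ht] at hs
        simp only [max_eq_right hs.1]
    rw [hint, max_eq_right ht]
    exact hg.exists_eq t ht

lemma IsMildFlow.apply_zero (hA : IsSymmetricGraph A) (hg : IsMildFlow A U g₀ g) : g 0 = g₀ := by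
  obtain ⟨a, ha, hga⟩ := hg.exists_eq 0 le_rfl
  rw [intervalIntegral.integral_same] at ha hga
  rw [hga, hA.eq_zero ha, map_zero, add_zero, smul_zero, sub_zero]

variable [CompleteSpace H] [IsScalarTower ℝ ℂ H]

lemma IsMildFlow.exists_hasDerivAt_steklov (hA : IsSymmetricGraph A) (hg : IsMildFlow A U g₀ g)
    (hgc : Continuous g) (hh : 0 ≤ h) (hs : 0 ≤ s) :
    ∃ a, A (steklov g h s) a ∧
      HasDerivAt (steklov g h) (-(Complex.I • (a + U (steklov g h s)))) s := by
  obtain ⟨a, ha, hga⟩ := hg.exists_eq s hs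
  obtain ⟨a', ha', hga'⟩ := hg.exists_eq (s + h) (add_nonneg hs hh)
  refine ⟨h⁻¹ • (a' - a), ?_, ?_⟩
  · rw [steklov_eq hgc]
    exact hA.smul _ (hA.sub ha' ha)
  · convert hasDerivAt_steklov hgc h s using 1
    rw [steklov_eq hgc, U.map_smul_of_tower, map_sub, hga, hga', ← smul_add, smul_comm, ← smul_neg]
    congr 1
    module

lemma IsMildFlow.norm_map_steklov_le (hA : IsSymmetricGraph A) (hf : IsMildFlow A U₀ g₀ f)
    (hfc : Continuous f) (hM : ∀ {x a}, A x a → A (M x) (M a)) (hc : 0 ≤ c)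
    (hU₀ : ∀ x, ‖M (U₀ x)‖ ≤ c * ‖M x‖) (hh : 0 ≤ h) (ht : 0 ≤ t) :
    ‖M (steklov f h t)‖ ≤ Real.exp ((2 * c + 1) * t / 2) * ‖M (steklov f h 0)‖ := by
  have henergy := sq_norm_le_of_symmetric_evolution (F := fun s => M (steklov f h s)) (η := 0) hc ht
    fun s hs _ => by
      obtain ⟨a, ha, hderiv⟩ := hf.exists_hasDerivAt_steklov hA hfc hh hs
      refine ⟨M a, M (U₀ (steklov f h s)), ?_, hA.inner_im (hM ha), (hU₀ _).trans_eq (by ring)⟩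
      simpa only [Function.comp_def, ContinuousLinearMap.coe_restrictScalars', map_neg, map_smul,
        map_add] using (M.restrictScalars ℝ).hasFDerivAt.comp_hasDerivAt s hderiv
  refine le_of_sq_le_sq (henergy.trans_eq ?_) (by positivity)
  rw [mul_pow, ← Real.exp_nat_mul]
  push_cast
  ring_nf

lemma IsMildFlow.norm_steklov_sub_sq_le (hA : IsSymmetricGraph A) (hg : IsMildFlow A U g₀ g)
    (hf : IsMildFlow A U₀ g₀ f) (hgc : Continuous g) (hfc : Continuous f)
    (hM : ∀ {x a}, A x a → A (M x) (M a)) (hc : 0 ≤ c) (hη : 0 ≤ η)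
    (hU : ∀ x, ‖U x‖ ≤ c * ‖x‖) (hU₀ : ∀ x, ‖M (U₀ x)‖ ≤ c * ‖M x‖)
    (hUU₀ : ∀ x, ‖U x - U₀ x‖ ≤ η * ‖M x‖) (hh : 0 ≤ h) (ht : 0 ≤ t) :
    ‖steklov g h t - steklov f h t‖ ^ 2 ≤ (‖steklov g h 0 - steklov f h 0‖ ^ 2 +
      (η * (Real.exp ((2 * c + 1) * t / 2) * ‖M (steklov f h 0)‖)) ^ 2) *
        Real.exp ((2 * c + 1) * t) := by
  refine sq_norm_le_of_symmetric_evolution (F := fun s => steklov g h s - steklov f h s) hc ht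
    fun s hs hst => ?_
  obtain ⟨a, ha, hga⟩ := hg.exists_hasDerivAt_steklov hA hgc hh hs
  obtain ⟨b, hb, hfb⟩ := hf.exists_hasDerivAt_steklov hA hfc hh hs
  refine ⟨a - b, U (steklov g h s - steklov f h s) + (U (steklov f h s) - U₀ (steklov f h s)),
    ?_, hA.inner_im (hA.sub ha hb), ?_⟩
  · convert hga.fun_sub hfb using 1
    rw [map_sub]
    module
  · refine (norm_add_le _ _).trans (add_le_add (hU _) ((hUU₀ _).trans ?_))
    refine mul_le_mul_of_nonneg_left
      ((hf.norm_map_steklov_le hA hfc hM hc hU₀ hh hs).trans ?_) hη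
    gcongr

lemma IsMildFlow.norm_sub_le (hA : IsSymmetricGraph A) (hg : IsMildFlow A U g₀ g)
    (hf : IsMildFlow A U₀ g₀ f) (hM : ∀ {x a}, A x a → A (M x) (M a)) (hc : 0 ≤ c) (hη : 0 ≤ η)
    (hU : ∀ x, ‖U x‖ ≤ c * ‖x‖) (hU₀ : ∀ x, ‖M (U₀ x)‖ ≤ c * ‖M x‖)
    (hUU₀ : ∀ x, ‖U x - U₀ x‖ ≤ η * ‖M x‖) (ht : 0 ≤ t) :
    ‖g t - f t‖ ≤ η * Real.exp ((2 * c + 1) * t) * ‖M g₀‖ := by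
  wlog hcont : Continuous g ∧ Continuous f generalizing g f
  · simpa only [max_eq_right ht] using this hg.comp_max hf.comp_max
      ⟨continuous_comp_max_zero hg.continuousOn, continuous_comp_max_zero hf.continuousOn⟩
  obtain ⟨hgc, hfc⟩ := hcont
  have hzero : g 0 - f 0 = 0 := by rw [hg.apply_zero hA, hf.apply_zero hA, sub_self]
  have hlim := le_of_tendsto_of_tendsto
    (((tendsto_steklov hgc t).sub (tendsto_steklov hfc t)).norm.pow 2)
    (((((tendsto_steklov hgc 0).sub (tendsto_steklov hfc 0)).norm.pow 2).add
      (((((M.continuous.tendsto _).comp (tendsto_steklov hfc 0)).norm.const_mul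
        (Real.exp ((2 * c + 1) * t / 2))).const_mul η).pow 2)).mul_const
          (Real.exp ((2 * c + 1) * t)))
    (eventually_nhdsWithin_of_forall fun h hh =>
      hg.norm_steklov_sub_sq_le hA hf hgc hfc hM hc hη hU hU₀ hUU₀ (le_of_lt hh) ht)
  rw [hzero, norm_zero, hf.apply_zero hA] at hlim
  refine le_of_sq_le_sq (hlim.trans_eq ?_) (by positivity)
  have hexp : Real.exp ((2 * c + 1) * t / 2) ^ 2 = Real.exp ((2 * c + 1) * t) := by
    rw [← Real.exp_nat_mul]
    push_cast
    ring_nf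
  linear_combination (η * ‖M g₀‖) ^ 2 * Real.exp ((2 * c + 1) * t) * hexp

end Energy

/-! ### The error estimate -/

section Main

variable {L : Matrix (Fin d) (Fin d) ℝ} {W : Sp d → ℝ} {E : ℕ → ℝ} {v : ℕ → Sp d → ℂ}
  {dv : ℕ → Fin d → Sp d → ℂ} {μ c ε R : ℝ} {V : Sp d → Sp d → ℝ} {Vhat : Sp d → Sp d → ℂ}
  {g₀ : EnvSpace d} {g gkp : ℝ → EnvSpace d}

lemma IsAkp.eq_zero {P : ℕ → ℕ → Fin d → ℂ} {h : EnvSpace d} (hh : IsAkp E P ε 0 h) : h = 0 := by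
  ext1
  funext n
  refine Lp.eq_zero_iff_ae_eq_zero.2 ?_
  have hzero : ∀ᵐ k : Sp d, ∀ n, (0 : EnvSpace d) n k = 0 :=
    ae_all_iff.2 fun _ => Lp.coeFn_zero _ _ _
  filter_upwards [hh, hzero] with k ⟨_, hhk⟩ hk
  simp only [hhk, hk, mul_zero, tsum_zero, sub_zero, Pi.zero_apply]

lemma IsAkp.smul (r : ℝ) {P : ℕ → ℕ → Fin d → ℂ} {g h : EnvSpace d} (hg : IsAkp E P ε g h) :
    IsAkp E P ε (r • g) (r • h) := by
  have hsmul : ∀ f : EnvSpace d, ∀ᵐ k : Sp d, ∀ n, (r • f) n k = (r : ℂ) * f n k := fun f =>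
    ae_all_iff.2 fun n => by
      filter_upwards [Lp.coeFn_smul r (f n)] with k hk
      rw [lp.coeFn_smul, Pi.smul_apply, hk, Pi.smul_apply, Complex.real_smul]
  filter_upwards [hg, hsmul g, hsmul h] with k ⟨hEg, hgh⟩ hrg hrh
  refine ⟨?_, fun n => ?_⟩
  · simpa only [hrg, norm_mul, mul_pow, mul_left_comm] using hEg.mul_left (‖(r : ℂ)‖ ^ 2)
  · simp only [hrg, hrh, hgh, mul_left_comm _ (r : ℂ), tsum_mul_left]
    ring

lemma isSymmetricGraph_isAkp (hb : IsBlochBasis L W E v dv) (hW : IsCrystalPotential L W)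
    (hL : L.det ≠ 0) : IsSymmetricGraph (IsAkp E (gradElem L v dv) ε) where
  eq_zero := IsAkp.eq_zero
  sub hg hg' := hg.sub hb hW hL hg'
  smul r _ _ hg := hg.smul r
  inner_im hg := hg.inner_im hb hW hL

lemma enorm_kpWeight_sq_le (hR : 0 < R) (k : Sp d) :
    ‖((kpWeight d μ R hR).toFun k : ℂ)‖ₑ ^ 2 ≤ ENNReal.ofReal ((1 + ‖k‖ ^ 2) ^ μ) := by
  have hpos : 0 ≤ (kpWeight d μ R hR).toFun k := le_min (by positivity) hR.le
  rw [← ofReal_norm, Complex.norm_real, Real.norm_of_nonneg hpos, ← ENNReal.ofReal_pow hpos]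
  refine ENNReal.ofReal_le_ofReal ((pow_le_pow_left₀ hpos (min_le_left _ _) 2).trans_eq ?_)
  rw [← Real.rpow_natCast, ← Real.rpow_mul (by positivity), Nat.cast_ofNat,
    div_mul_cancel₀ _ two_ne_zero]

lemma norm_kpWeight_env_le (hR : 0 < R) {g : EnvSpace d} (hg : MemL2mu μ g) :
    ‖(kpWeight d μ R hR).env volume g‖ ≤ normL2mu μ g := by
  refine Real.le_sqrt_of_sq_le ?_
  have hnorm := (lp.hasSum_norm (p := 2) (by norm_num) ((kpWeight d μ R hR).env volume g)).tsum_eq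
  simp only [ENNReal.toReal_ofNat, Real.rpow_ofNat] at hnorm
  rw [← hnorm, ← ENNReal.ofReal_le_iff_le_toReal hg.ne,
    ENNReal.ofReal_tsum_of_nonneg (fun _ => sq_nonneg _) (summable_norm_sq _)]
  refine ENNReal.tsum_le_tsum fun n => ?_
  rw [← lintegral_enorm_sq_coeFn]
  refine lintegral_mono_ae ?_
  filter_upwards [(kpWeight d μ R hR).coeFn_mul (g n)] with k hk
  rw [Weight.env_apply, hk, enorm_mul, mul_pow]
  gcongr
  exact enorm_kpWeight_sq_le hR k

lemma IsPotHat.isMildFlow_of_isUeps (h : IsPotHat L μ c V Vhat) (hL : L.det ≠ 0) (hε : 0 < ε)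
    (hVper : ∀ x, IsPeriodic L (V x)) (hv : IsONSystem (volume.restrict (cell L)) v)
    (hper : ∀ n, IsPeriodic L (v n)) {A : EnvSpace d → EnvSpace d → Prop}
    (hg : IsMildSolution A (IsUeps L v V ε) g₀ g) :
    IsMildFlow A (hv.compress
      (h.isSchur_kernelEps (det_recip_ne_zero (det_smul_ne_zero hL hε.ne')) ε).op) g₀ g where
  continuousOn := hg.1
  exists_eq t ht := by
    obtain ⟨a, u, ha, hu, hgt⟩ := hg.2 t ht
    have hcoeffs := congrArg (hv.coeffs volume) (h.synth_eq_of_isUeps hL hε hVper hv hper hu)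
    rw [hv.coeffs_synth] at hcoeffs
    exact ⟨a, ha, by rw [hgt, hcoeffs, hv.compress_apply]⟩

lemma IsPotHat.isMildFlow_of_isU0 (h : IsPotHat L μ c V Vhat)
    (hv : IsONSystem (volume.restrict (cell L)) v) {A : EnvSpace d → EnvSpace d → Prop}
    (hg : IsMildSolution A (IsU0 L v V) g₀ g) :
    IsMildFlow A (hv.compress h.isSchur_kernel0.op) g₀ g where
  continuousOn := hg.1
  exists_eq t ht := by
    obtain ⟨a, u, ha, hu, hgt⟩ := hg.2 t ht
    exact ⟨a, ha, by rw [hgt, h.eq_of_isU0 hv hu, hv.compress_apply]⟩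

lemma IsPotHat.norm_compress_kernelEps_le (h : IsPotHat L μ c V Vhat)
    (hv : IsONSystem (volume.restrict (cell L)) v) {M : Matrix (Fin d) (Fin d) ℝ}
    (hM : M.det ≠ 0) (x : EnvSpace d) :
    ‖hv.compress (h.isSchur_kernelEps hM ε).op x‖ ≤ c * ‖x‖ := by
  rw [← (hv.synth volume).norm_map x]
  exact (hv.norm_coeffs_le _).trans ((h.isSchur_kernelEps hM ε).norm_op_apply_le _)

lemma IsPotHat.norm_env_compress_kernel0_le (h : IsPotHat L μ c V Vhat)
    (hv : IsONSystem (volume.restrict (cell L)) v) {a : Weight (Sp d)} (ha : a.IsModerate μ)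
    (x : EnvSpace d) :
    ‖a.env volume (hv.compress h.isSchur_kernel0.op x)‖ ≤ c * ‖a.env volume x‖ := by
  rw [← hv.norm_fst_mul_synth a x, hv.compress_apply, ← hv.coeffs_mul]
  exact (hv.norm_coeffs_le _).trans (h.norm_weight_op0_le ha _)

lemma IsPotHat.norm_compress_sub_le (h : IsPotHat L μ c V Vhat)
    (hv : IsONSystem (volume.restrict (cell L)) v) {M : Matrix (Fin d) (Fin d) ℝ}
    (hM : M.det ≠ 0) {a : Weight (Sp d)} (ha : a.IsModerate μ) (hR : 0 < R)
    (hRa : ∀ k ∉ interior (cell M), R ≤ a.toFun k) (x : EnvSpace d) :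
    ‖hv.compress (h.isSchur_kernelEps hM ε).op x - hv.compress h.isSchur_kernel0.op x‖
      ≤ R⁻¹ * (c + c) * ‖a.env volume x‖ := by
  rw [← hv.norm_fst_mul_synth, hv.compress_apply, hv.compress_apply, ← map_sub]
  exact (hv.norm_coeffs_le _).trans (h.norm_opEps_sub_op0_le hM ε ha hR hRa _)

lemma IsPotHat.norm_mild_sub_le (h : IsPotHat L μ c V Vhat) (hL : L.det ≠ 0)
    (hVper : ∀ x, IsPeriodic L (V x)) {r : ℝ} (hr : 0 < r)
    (hrL : ∀ ε > 0, ∀ k ∉ interior (cell (recip (ε • L))), r / ε ≤ ‖k‖)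
    (hW : IsCrystalPotential L W) (hb : IsBlochBasis L W E v dv) (hε : 0 < ε)
    (hg₀ : MemL2mu μ g₀)
    (hg : IsMildSolution (IsAkp E (gradElem L v dv) ε) (IsUeps L v V ε) g₀ g)
    (hgkp : IsMildSolution (IsAkp E (gradElem L v dv) ε) (IsU0 L v V) g₀ gkp)
    {τ t : ℝ} (ht : t ∈ Icc 0 τ) :
    ‖g t - gkp t‖ ≤ ((r / ε) ^ μ)⁻¹ * (c + c) * Real.exp ((2 * c + 1) * τ) * normL2mu μ g₀ := by
  have hs : 0 < r / ε := div_pos hr hε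
  have hR := Real.rpow_pos_of_pos hs μ
  have hv : IsONSystem (volume.restrict (cell L)) v := ⟨hb.memLp, hb.orthonormal⟩
  have hmod : (kpWeight d μ _ hR).IsModerate μ := isModerate_kpWeight h.mu_nonneg hR
  have hM := det_recip_ne_zero (det_smul_ne_zero hL hε.ne')
  have hc := h.nonneg
  have hstability := (h.isMildFlow_of_isUeps hL hε hVper hv hb.periodic hg).norm_sub_le
    (isSymmetricGraph_isAkp hb hW hL) (h.isMildFlow_of_isU0 hv hgkp)
    (M := (kpWeight d μ _ hR).env volume) (IsAkp.env _) hc (by positivity)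
    (h.norm_compress_kernelEps_le hv hM) (h.norm_env_compress_kernel0_le hv hmod)
    (h.norm_compress_sub_le hv hM hmod hR fun k hk =>
      rpow_le_kpWeight h.mu_nonneg hs (hrL ε hε k hk)) ht.1
  refine hstability.trans ?_
  gcongr
  · exact ht.2
  · exact norm_kpWeight_env_le hR hg₀

end Main

end KP

end

theorem theorem5p3 {d : ℕ} (L : Matrix (Fin d) (Fin d) ℝ) (hL : L.det ≠ 0)
    (μ : ℝ) (hμ : 0 ≤ μ) (V : KP.Sp d → KP.Sp d → ℝ) (hV : KP.MemW L μ V)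
    (τ : ℝ) (hτ : 0 ≤ τ) :
    ∃ C : ℝ, 0 ≤ C ∧
      ∀ (W : KP.Sp d → ℝ) (E : ℕ → ℝ) (v : ℕ → KP.Sp d → ℂ) (dv : ℕ → Fin d → KP.Sp d → ℂ),
        KP.IsCrystalPotential L W → KP.IsBlochBasis L W E v dv →
      ∀ (ε : ℝ), 0 < ε →
      ∀ (gin : KP.EnvSpace d), KP.MemL2mu μ gin →
      ∀ (g gkp : ℝ → KP.EnvSpace d),
        KP.IsMildSolution (KP.IsAkp E (KP.gradElem L v dv) ε) (KP.IsUeps L v V ε) gin g →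
        KP.IsMildSolution (KP.IsAkp E (KP.gradElem L v dv) ε) (KP.IsU0 L v V) gin gkp →
      ∀ t ∈ Set.Icc (0 : ℝ) τ,
        ‖g t - gkp t‖ ≤ ε ^ μ * C * KP.normL2mu μ gin := by
  obtain ⟨c, Vhat, h⟩ := hV.exists_isPotHat hμ
  obtain ⟨r, hr, hrL⟩ := KP.exists_le_norm_of_notMem_interior_cell_recip hL
  have hc := h.nonneg
  refine ⟨(r ^ μ)⁻¹ * (c + c) * Real.exp ((2 * c + 1) * τ), by positivity, ?_⟩
  intro W E v dv hW hb ε hε gin hgin g gkp hg hgkp t ht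
  refine (h.norm_mild_sub_le hL hV.periodic hr hrL hW hb hε hgin hg hgkp ht).trans_eq ?_
  rw [Real.div_rpow hr.le hε.le, inv_div]
  ring
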